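/- For $|q|<1$ let $(q)_n=\prod_{j=1}^n(1-q^j)$, $(q)_\infty=\prod_{j\ge1}(1-q^j)$, and for $k\ge1$ let $$H_{A_k}(q)=\sum_{n_1,\dots,n_k\ge0}\frac{q^{n_1n_2+\cdots+n_{k-1}n_k+n_1+\cdots+n_k}}{(q)_{n_1}\cdots(q)_{n_k}}$$ be the graph series of the path $A_k$ with $k$ nodes. In general, the graph series of a finite simple graph with adjacency matrix $C$ is $\sum_{\boldsymbol n}q^{\frac12\boldsymbol nC\boldsymbol n^T+\sum_v n_v}/\prod_v(q)_{n_v}$. Let $\gamma$ be the Euler–Mascheroni constant. As $t\to0^+$: 1. $(e^{-t})_\infty H_{A_2}(e^{-t})=\frac1t+O(1)$; 2. $(e^{-t})_\infty^2H_{A_3}(e^{-t})=1+O(t)$; 3. $(e^{-t})_\infty^2H_{A_4}(e^{-t})=\frac{\gamma-\log t}{t}-\log t+O(1)$; 4. $(e^{-t})_\infty^3H_{A_5}(e^{-t})=1+O(t)$; 5. $(e^{-t})_\infty^3H_{A_6}(e^{-t})=\frac{2(\gamma-\log t)}{t}-2\log t+O(1)$; 6. $(e^{-t})_\infty^4H_{A_7}(e^{-t})=1+O(t)$;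 7. $(e^{-t})_\infty^4H_{A_8}(e^{-t})=\frac{3(\gamma-\log t)}{t}-6\log t+O(1)$. Moreover, with $q=e^{2\pi i\tau}$: (a) $f(\tau)=q(q)_\infty^2H_{A_4}(q)$ is a holomorphic quantum modular form of weight $1$ for $\mathrm{SL}_2(\mathbb Z)$ with trivial multiplier. That is, $f$ is holomorphic on the upper half-plane $\mathbb H$ and, for every $M=\left(\begin{smallmatrix}a&b\\c&d\end{smallmatrix}\right)\in\mathrm{SL}_2(\mathbb Z)$, the function $f(\tau)-(c\tau+d)^{-1}f(M\tau)$ extends holomorphically to $\{\tau\in\mathbb C:c\tau+d\notin(-\infty,0]\}$ (a domain strictly larger than $\mathbb H$ unless $M=-\left(\begin{smallmatrix}1&n\\0&1\end{smallmatrix}\right)$, in which case this set is empty). (b) $q^{1/24}\cdot q(q)_\infty^3H_{A_5}(q)$ and $q^{1/24}\cdot q(1-q)(q)_\infty^4H_{A_7}(q)$, where $q^{1/24}=e^{2\pi i\tau/24}$, are quantum modular forms of weight $\frac32$ for $\mathrm{SL}_2(\mathbb Z)$ with quantum set $\mathbb Q$ and the multiplier $\chi$ of the Dedekind eta function, i.e.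 $\eta(M\tau)=\chi(M)(c\tau+d)^{1/2}\eta(\tau)$ with the principal square root. That is, for every $x\in\mathbb Q$ the limit $f(x)$ of the function at $\tau=x+iy$ as $y\to0^+$ exists, and for every $M=\left(\begin{smallmatrix}a&b\\c&d\end{smallmatrix}\right)\in\mathrm{SL}_2(\mathbb Z)$ the function $f(x)-\chi(M)^{-1}(cx+d)^{-3/2}f(Mx)$ on $\{x\in\mathbb Q:cx+d>0\}$ extends to a real-analytic function on $\{x\in\mathbb R:cx+d>0\}$. (Since $M$ and $-M$ act equally, this covers all $x$ with $cx+d\ne0$.) -/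

import Mathlib

open Filter Topology Asymptotics UpperHalfPlane Matrix.SpecialLinearGroup
open scoped MatrixGroups Manifold

noncomputable section

/-- The finite `q`-Pochhammer symbol `(q)_n = (q;q)_n = ∏_{j=1}^{n} (1 - q^j)`. -/
def qPoch (q : ℂ) (n : ℕ) : ℂ := ∏ j ∈ Finset.range n, (1 - q ^ (j + 1))

/-- The infinite `q`-Pochhammer symbol `(q)_∞ = ∏_{j ≥ 1} (1 - q^j)`, for `|q| < 1`. -/
def qPochInf (q : ℂ) : ℂ := ∏' j : ℕ, (1 - q ^ (j + 1))

open Classical in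
/-- The graph series
`H_G(q) = ∑_{n ∈ ℕ₀^V} q^{½ n C n^T + ∑_v n_v} / ∏_v (q)_{n_v}`, for `|q| < 1`, where `C` is the
adjacency matrix of the simple graph `G`. Here `½ n C n^T` is the sum of `n_u n_v` over the edges
`{u, v}` of `G`. -/
def graphSeries {V : Type*} [Fintype V] (G : SimpleGraph V) (q : ℂ) : ℂ :=
  ∑' n : V → ℕ,
    q ^ ((∑ e ∈ G.edgeFinset, (e.map n).mul) + ∑ v, n v) / ∏ v, qPoch q (n v)

/-- The graph series `H_{A_k}` of the path graph `A_k` with `k` nodes. -/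
def HA (k : ℕ) (q : ℂ) : ℂ := graphSeries (SimpleGraph.pathGraph k) q

/-- `e(z) = exp(2πiz)`. -/
def expTwoPiI (z : ℂ) : ℂ := Complex.exp (2 * Real.pi * Complex.I * z)

/-- `χ` is the multiplier system of the Dedekind eta function:
`η(Mτ) = χ(M) (cτ+d)^{1/2} η(τ)`, with the principal branch of the square root. -/
def IsEtaMultiplier (χ : SL(2, ℤ) → ℂ) : Prop :=
  ∀ (M : SL(2, ℤ)) (τ : ℍ),
    ModularForm.eta ((M • τ : ℍ) : ℂ) =
      χ M * ((M 1 0 : ℂ) * (τ : ℂ) + (M 1 1 : ℂ)) ^ (1 / 2 : ℂ) * ModularForm.eta (τ : ℂ)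

/-- `f : ℍ → ℂ` is a holomorphic quantum modular form of weight `k` and multiplier `χ` for `Γ`:
it is holomorphic, and for every `M = (a, b; c, d) ∈ Γ` the obstruction to modularity
`f(τ) - χ(M)⁻¹ (cτ+d)^{-k} f(Mτ)` extends holomorphically to the cut plane of all `τ ∈ ℂ` with
`cτ + d ∉ (-∞, 0]`. For `c ≠ 0` this is `ℂ` without a closed real half-line, a domain strictly
larger than `ℍ`; for `c = 0` it is `ℂ` if `d = 1`, and empty if `d = -1`. -/
def IsHolomorphicQuantumModularForm (k : ℝ) (χ : SL(2, ℤ) → ℂ) (Γ : Subgroup SL(2, ℤ))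
    (f : ℍ → ℂ) : Prop :=
  MDiff f ∧
  ∀ M ∈ Γ, ∃ g : ℂ → ℂ,
    DifferentiableOn ℂ g {z : ℂ | (M 1 0 : ℂ) * z + (M 1 1 : ℂ) ∈ Complex.slitPlane} ∧
    ∀ τ : ℍ, (M 1 0 : ℂ) * (τ : ℂ) + (M 1 1 : ℂ) ∈ Complex.slitPlane →
      f τ - (χ M)⁻¹ * ((M 1 0 : ℂ) * (τ : ℂ) + (M 1 1 : ℂ)) ^ (-(k : ℂ)) * f (M • τ) = g τ

/-- `f`, regarded as a function on the quantum set `Q ⊆ ℚ`, is a quantum modular form of weight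
`k` and multiplier `χ` for `Γ`: for every `M = (a, b; c, d) ∈ Γ` the obstruction to modularity
`f(x) - χ(M)⁻¹ (cx+d)^{-k} f(Mx)` extends to a real-analytic function on the open set of all real
`x` with `cx + d > 0`. (The matrices `M` and `-M` act in the same way on `x`, and together they
account for all `x` with `cx + d ≠ 0`; on `cx + d > 0` the power is unambiguous.) -/
def IsQuantumModularForm (k : ℝ) (χ : SL(2, ℤ) → ℂ) (Γ : Subgroup SL(2, ℤ)) (Q : Set ℚ)
    (f : ℚ → ℂ) : Prop :=
  ∀ M ∈ Γ, ∃ g : ℝ → ℂ,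
    AnalyticOnNhd ℝ g {x : ℝ | 0 < (M 1 0 : ℝ) * x + (M 1 1 : ℝ)} ∧
    ∀ x ∈ Q, 0 < (M 1 0 : ℚ) * x + (M 1 1 : ℚ) →
      ((M 0 0 : ℚ) * x + (M 0 1 : ℚ)) / ((M 1 0 : ℚ) * x + (M 1 1 : ℚ)) ∈ Q →
      f x - (χ M)⁻¹ * ((((M 1 0 : ℝ) * (x : ℝ) + (M 1 1 : ℝ)) ^ (-k) : ℝ) : ℂ) *
        f (((M 0 0 : ℚ) * x + (M 0 1 : ℚ)) / ((M 1 0 : ℚ) * x + (M 1 1 : ℚ))) = g (x : ℝ)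

/-- `f : ℚ → ℂ` is the function of vertical boundary values of `F`, a function on the upper
half-plane: `f(x) = lim_{y → 0⁺} F(x + iy)` for all rational `x`. -/
def IsBoundaryValue (F : ℂ → ℂ) (f : ℚ → ℂ) : Prop :=
  ∀ x : ℚ, Tendsto (fun y : ℝ => F ((x : ℂ) + (y : ℂ) * Complex.I)) (𝓝[>] 0) (𝓝 (f x))

end

/-!
The graph series of a path is computed node by node. With `F_0 = 1` and
`F_{k+1}(m) = ∑_n F_k(n) q^{(m+1)n} / (q)_n` one has `H_{A_k} = F_k(0)` (`pathSum`,
`HA_succ_eq_pathSum`). The transfer operator is symmetric for the weight `qⁿ / (q)_n`, so that the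
path can be cut at any node (`pathSum_split`). Euler's series `∑ xⁿ / (q)_n` at `x = q^{m+1}` is
`(q)_m / (q)_∞`, hence `F_1`, …, `F_4` are elementary, and `HA_two`, …, `HA_eight` express the graph
series by `(q)_∞`, the Lambert series `L = ∑ qⁿ / (1 - qⁿ)` (`lambertSum`; it enters through
Uchimura's identity `∑ (1 - (q)_∞ / (q)_n) = L`, `tsum_one_sub_div_qPoch`) and the sum of tails
`D = ∑ ((q)_n - (q)_∞)` (`pochTails`). In particular `q (q)_∞² H_{A_4} = L`, `q (q)_∞³ H_{A_5} = D`
and `q (1 - q) (q)_∞⁴ H_{A_7} = D - 1 + (q)_∞ + (q)_∞ L`.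

For `L`, consider the sum of the errors of the trapezoidal rule for `∫ dw / w` on
`[nz + k, nz + k + 1]` over all `n ≥ 1` and `k ≥ 0`. This double series `trapSeries` converges
absolutely on the slit plane. By the partial fractions of the cotangent, its values at `z` and `-z`
differ by `2πi L` (`trapSeries_sub_trapSeries_neg`), and it satisfies Guinand's functional equation
under `z ↦ 1 / z` (`trapSeries_sub_inv`), since a symmetric double sum cancels. This gives the
expansion of `L` as `q → 1` (`lambertSum_isBigO`) and shows that `L(z) - z⁻¹ L(-1 / z)` is
`lambertPeriod`, holomorphic on the slit plane (`lambertSum_sub_neg_inv`). As `L` has period `1`,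
the statement for `S` propagates to all `M` by Euclid's algorithm, in an order in which all the cut
planes match (`modularGroup_induction`).

For `D`, summation by parts shows that it is `1 + t + O(t²)` (`isBigO_pochTails`). For its values at
the rational points, the two-variable series `∑ (x)_{n+1} xⁿ` is expanded into a theta series. Its
value at `x = 1` is the pentagonal number theorem, and its derivative at `x = 1` gives
`D = -(q)_∞ L - θ'` (`tsum_thetaTerm_one_and_pochTails`). After multiplication by `q^{1/24}`, `θ'`
becomes half the difference of `∑ ± ν q^{ν²/24}` and `η`. Writing `ν` as an integral of exponentials
identifies that series, up to a constant, with `∫_0^∞ (η(z) - η(z + iu)) u^{-3/2} du`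
(`integral_eta_sub_eq_thetaSeries`). Since `η` decays rapidly at every rational `x`
(`exists_norm_eta_le_im_pow`), this has the boundary value `-∫_0^∞ η(x + iu) u^{-3/2} du`, the
Eichler integral at `x`. Integrating the corresponding holomorphic differential around the ideal
triangle with vertices `0`, `x`, `∞` shows that the Eichler integral is invariant of weight `3/2`
under inversion, up to an integral over the imaginary axis, which is analytic in `x > 0`
(`eichlerIntegral_sub_inversion`, `analyticAt_periodIntegral`). Again this propagates from the
generators to all `M` (`isQuantumModularForm_of_S`). The eta multiplier exists because the quotient
of the two sides of its equation is continuous with values in the 24th roots of unity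
(`exists_isEtaMultiplier`).
-/

/-! ### Finite and infinite `q`-Pochhammer symbols -/

section QSeries

variable {q : ℂ}

@[simp] lemma qPoch_zero (q : ℂ) : qPoch q 0 = 1 := by simp [qPoch]

lemma qPoch_succ (q : ℂ) (n : ℕ) : qPoch q (n + 1) = qPoch q n * (1 - q ^ (n + 1)) := by
  simp [qPoch, Finset.prod_range_succ]

lemma norm_pow_succ_lt_one (hq : ‖q‖ < 1) (n : ℕ) : ‖q ^ (n + 1)‖ < 1 := by
  rw [norm_pow]
  exact pow_lt_one₀ (norm_nonneg _) hq (Nat.succ_ne_zero n)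

lemma one_sub_ne_zero_of_norm_lt_one {x : ℂ} (hx : ‖x‖ < 1) : 1 - x ≠ 0 := by
  intro h
  rw [← sub_eq_zero.1 h, norm_one] at hx
  exact lt_irrefl _ hx

lemma one_sub_pow_succ_ne_zero (hq : ‖q‖ < 1) (n : ℕ) : 1 - q ^ (n + 1) ≠ 0 :=
  one_sub_ne_zero_of_norm_lt_one (norm_pow_succ_lt_one hq n)

lemma qPoch_ne_zero (hq : ‖q‖ < 1) (n : ℕ) : qPoch q n ≠ 0 :=
  Finset.prod_ne_zero_iff.2 fun j _ => one_sub_pow_succ_ne_zero hq j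

lemma tendsto_qPoch (hq : ‖q‖ < 1) : Tendsto (qPoch q) atTop (𝓝 (qPochInf q)) :=
  (ModularForm.multipliable_one_sub_pow hq).hasProd.tendsto_prod_nat

lemma qPochInf_ne_zero (hq : ‖q‖ < 1) : qPochInf q ≠ 0 := by
  have h := tprod_one_add_ne_zero_of_summable (f := fun n : ℕ => -q ^ (n + 1))
    (fun i => by simpa [sub_eq_add_neg] using one_sub_pow_succ_ne_zero hq i)
    (by
      simpa using (summable_nat_add_iff 1).mpr
        (summable_geometric_of_lt_one (norm_nonneg _) hq))
  simpa [qPochInf, sub_eq_add_neg] using h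

lemma exists_norm_inv_qPoch_le (hq : ‖q‖ < 1) : ∃ C : ℝ, 0 < C ∧ ∀ n, ‖(qPoch q n)⁻¹‖ ≤ C := by
  obtain ⟨C, hC⟩ := ((tendsto_qPoch hq).inv₀ (qPochInf_ne_zero hq)).norm.bddAbove_range
  exact ⟨max C 1, by positivity, fun n => (hC ⟨n, rfl⟩).trans (le_max_left _ _)⟩

/-- Euler's series `∑ xⁿ / (q)_n`, equal to `1 / (x; q)_∞` for `|x| < 1`. -/
noncomputable def eulerSeries (q x : ℂ) : ℂ := ∑' n : ℕ, x ^ n / qPoch q n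

lemma summable_mul_pow_div_qPoch (hq : ‖q‖ < 1) {x : ℂ} (hx : ‖x‖ < 1) {a : ℕ → ℂ} {A : ℝ}
    (ha : ∀ n, ‖a n‖ ≤ A) : Summable fun n => a n * (x ^ n / qPoch q n) := by
  obtain ⟨C, hC0, hC⟩ := exists_norm_inv_qPoch_le hq
  refine Summable.of_norm_bounded
    ((summable_geometric_of_lt_one (norm_nonneg x) hx).mul_left (A * C)) fun n => ?_
  have hA : 0 ≤ A := (norm_nonneg _).trans (ha 0)
  rw [div_eq_mul_inv, norm_mul, norm_mul, norm_pow]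
  calc ‖a n‖ * (‖x‖ ^ n * ‖(qPoch q n)⁻¹‖) ≤ A * (‖x‖ ^ n * C) := by
        gcongr
        · exact ha n
        · exact hC n
    _ = A * C * ‖x‖ ^ n := by ring

lemma summable_pow_div_qPoch (hq : ‖q‖ < 1) {x : ℂ} (hx : ‖x‖ < 1) :
    Summable fun n => x ^ n / qPoch q n := by
  simpa using summable_mul_pow_div_qPoch hq hx (a := fun _ => 1) (A := 1) (by simp)

lemma summable_nat_mul_pow_div_qPoch (hq : ‖q‖ < 1) {x : ℂ} (hx : ‖x‖ < 1) :
    Summable fun n : ℕ => n * (x ^ n / qPoch q n) := by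
  obtain ⟨C, hC0, hC⟩ := exists_norm_inv_qPoch_le hq
  have h := (summable_norm_pow_mul_geometric_of_norm_lt_one 1 hx).mul_left C
  refine Summable.of_norm_bounded h fun n => ?_
  rw [div_eq_mul_inv, norm_mul, norm_mul, norm_mul, pow_one]
  have := hC n
  calc ‖(n : ℂ)‖ * (‖x ^ n‖ * ‖(qPoch q n)⁻¹‖) ≤ ‖(n : ℂ)‖ * (‖x ^ n‖ * C) := by gcongr
    _ = _ := by ring

lemma norm_mul_lt_one {x y : ℂ} (hx : ‖x‖ < 1) (hy : ‖y‖ ≤ 1) : ‖x * y‖ < 1 := by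
  rw [norm_mul]
  exact (mul_le_of_le_one_right (norm_nonneg _) hy).trans_lt hx

/-- The coefficient identity behind the `q`-difference equations of Euler's series. -/
lemma pow_succ_div_qPoch_sub (hq : ‖q‖ < 1) (x : ℂ) (n : ℕ) :
    x ^ (n + 1) / qPoch q (n + 1) - (x * q) ^ (n + 1) / qPoch q (n + 1)
      = x * (x ^ n / qPoch q n) := by
  have h1 := qPoch_ne_zero hq n
  have h2 := one_sub_pow_succ_ne_zero hq n
  rw [qPoch_succ, mul_pow]
  field_simp
  ring

/-- The `q`-difference equation of Euler's series. -/
lemma eulerSeries_sub (hq : ‖q‖ < 1) {x : ℂ} (hx : ‖x‖ < 1) :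
    eulerSeries q (x * q) = (1 - x) * eulerSeries q x := by
  have h1 := summable_pow_div_qPoch hq hx
  have h2 := summable_pow_div_qPoch hq (norm_mul_lt_one hx hq.le)
  have : eulerSeries q x - eulerSeries q (x * q) = x * eulerSeries q x := by
    rw [eulerSeries, eulerSeries, ← h1.tsum_sub h2, (h1.sub h2).tsum_eq_zero_add]
    simp only [pow_succ_div_qPoch_sub hq x, pow_zero, sub_self, zero_add]
    rw [tsum_mul_left]
  linear_combination -this

lemma eulerSeries_mul_pow (hq : ‖q‖ < 1) {x : ℂ} (hx : ‖x‖ < 1) (n : ℕ) :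
    eulerSeries q (x * q ^ n) = (∏ j ∈ Finset.range n, (1 - x * q ^ j)) * eulerSeries q x := by
  induction n with
  | zero => simp
  | succ n ih =>
    have : ‖x * q ^ n‖ < 1 :=
      norm_mul_lt_one hx (by rw [norm_pow]; exact pow_le_one₀ (norm_nonneg _) hq.le)
    rw [pow_succ, ← mul_assoc, eulerSeries_sub hq this, ih, Finset.prod_range_succ]
    ring

/-- Continuity of Euler's series at `0`, along a geometric sequence. -/
lemma tendsto_eulerSeries_zero (hq : ‖q‖ < 1) {x : ℂ} (hx : ‖x‖ < 1) :
    Tendsto (fun n : ℕ => eulerSeries q (x * q ^ n)) atTop (𝓝 1) := by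
  obtain ⟨C, hC0, hC⟩ := exists_norm_inv_qPoch_le hq
  have h0 : Tendsto (fun n : ℕ => x * q ^ n) atTop (𝓝 0) := by
    simpa using (tendsto_pow_atTop_nhds_zero_of_norm_lt_one hq).const_mul x
  have key := tendsto_tsum_of_dominated_convergence (𝓕 := atTop)
    (f := fun (n : ℕ) (k : ℕ) => (x * q ^ n) ^ k / qPoch q k)
    (g := fun k => if k = 0 then 1 else 0) (bound := fun k => ‖x‖ ^ k * C)
    ((summable_geometric_of_lt_one (norm_nonneg x) hx).mul_right C)
    (fun k => ?_) (Eventually.of_forall fun n k => ?_)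
  · simpa [eulerSeries] using key
  · rcases eq_or_ne k 0 with rfl | hk
    · simp
    · simpa [hk] using (h0.pow k).div_const (qPoch q k)
  · rw [div_eq_mul_inv, norm_mul, norm_pow]
    gcongr
    · rw [norm_mul, norm_pow]
      exact mul_le_of_le_one_right (norm_nonneg _) (pow_le_one₀ (norm_nonneg _) hq.le)
    · exact hC k

/-- Euler's series at `q` is `1 / (q)_∞`: iterate the `q`-difference equation down to `0`. -/
lemma eulerSeries_self_mul (hq : ‖q‖ < 1) : eulerSeries q q * qPochInf q = 1 := by
  have h1 := tendsto_eulerSeries_zero hq hq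
  have h2 : Tendsto (fun n : ℕ => eulerSeries q (q * q ^ n)) atTop
      (𝓝 (qPochInf q * eulerSeries q q)) := by
    refine ((tendsto_qPoch hq).mul_const _).congr fun n => ?_
    rw [eulerSeries_mul_pow hq hq, qPoch]
    simp only [pow_succ']
  rw [mul_comm]
  exact tendsto_nhds_unique h2 h1

lemma eulerSeries_pow_succ (hq : ‖q‖ < 1) (m : ℕ) :
    eulerSeries q (q ^ (m + 1)) = qPoch q m / qPochInf q := by
  rw [eq_div_iff (qPochInf_ne_zero hq), pow_succ', eulerSeries_mul_pow hq hq, mul_assoc,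
    eulerSeries_self_mul hq, mul_one, qPoch]
  simp only [pow_succ']

/-! ### Graph series of paths by the transfer operator -/

/-- `pathSum q k m` is the graph series of the path `A_k` with an extra weight `q ^ (m * n₁)` at its
first node, computed node by node. -/
noncomputable def pathSum (q : ℂ) : ℕ → ℕ → ℂ
  | 0, _ => 1
  | k + 1, m => ∑' n : ℕ, pathSum q k n * ((q ^ (m + 1)) ^ n / qPoch q n)

lemma exists_norm_tsum_mul_le (hq : ‖q‖ < 1) {φ : ℕ → ℂ} {A : ℝ} (hφ : ∀ n, ‖φ n‖ ≤ A) :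
    ∃ B : ℝ, ∀ m : ℕ, ‖∑' n : ℕ, φ n * ((q ^ (m + 1)) ^ n / qPoch q n)‖ ≤ B := by
  obtain ⟨C, hC0, hC⟩ := exists_norm_inv_qPoch_le hq
  have hs := (summable_geometric_of_lt_one (norm_nonneg q) hq).mul_left (A * C)
  refine ⟨_, fun m => tsum_of_norm_bounded hs.hasSum fun n => ?_⟩
  have hA : 0 ≤ A := (norm_nonneg _).trans (hφ 0)
  rw [div_eq_mul_inv, norm_mul, norm_mul, norm_pow, norm_pow, mul_assoc A C, mul_comm C]
  gcongr
  · exact hφ n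
  · calc ‖q‖ ^ (m + 1) ≤ ‖q‖ ^ 1 := pow_le_pow_of_le_one (norm_nonneg _) hq.le (by omega)
      _ = ‖q‖ := pow_one _
  · exact hC n

lemma exists_norm_pathSum_le (hq : ‖q‖ < 1) (k : ℕ) : ∃ A : ℝ, ∀ m, ‖pathSum q k m‖ ≤ A := by
  induction k with
  | zero => exact ⟨1, by simp [pathSum]⟩
  | succ k ih =>
    obtain ⟨A, hA⟩ := ih
    exact exists_norm_tsum_mul_le hq hA

lemma summable_prod_comp {f : ℕ → ℝ} (hf : Summable f) (h0 : ∀ n, 0 ≤ f n) (k : ℕ) :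
    Summable fun n : Fin k → ℕ => ∏ i, f (n i) := by
  induction k with
  | zero => exact (hasSum_fintype _).summable
  | succ k ih =>
    rw [← (Fin.consEquiv fun _ => ℕ).summable_iff]
    have := hf.mul_of_nonneg ih h0 (fun n => Finset.prod_nonneg fun i _ => h0 _)
    refine this.congr fun p => ?_
    simp [Fin.consEquiv, Fin.prod_univ_succ]

/-- The summand of the graph series of the path with `k + 1` nodes, weighted by `q ^ (m * n₁)`. -/
noncomputable def pathTerm (q : ℂ) (k m : ℕ) (n : Fin (k + 1) → ℕ) : ℂ :=
  q ^ (m * n 0 + ∑ i : Fin k, n i.castSucc * n i.succ + ∑ i, n i) / ∏ i, qPoch q (n i)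

lemma summable_pathTerm (hq : ‖q‖ < 1) (k m : ℕ) : Summable (pathTerm q k m) := by
  obtain ⟨C, hC0, hC⟩ := exists_norm_inv_qPoch_le hq
  have hs := summable_prod_comp ((summable_geometric_of_lt_one (norm_nonneg q) hq).mul_left C)
    (fun n => by positivity) (k + 1)
  refine Summable.of_norm_bounded hs fun n => ?_
  rw [pathTerm, div_eq_mul_inv, norm_mul, norm_pow, ← Finset.prod_inv_distrib, norm_prod,
    Finset.prod_mul_distrib, mul_comm, Finset.prod_pow_eq_pow_sum]
  have h1 : ∏ i, ‖(qPoch q (n i))⁻¹‖ ≤ ∏ i : Fin (k + 1), C :=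
    Finset.prod_le_prod (fun _ _ => norm_nonneg _) fun i _ => hC _
  exact mul_le_mul h1 (pow_le_pow_of_le_one (norm_nonneg _) hq.le (by omega)) (by positivity)
    (by positivity)

lemma tsum_pathTerm (hq : ‖q‖ < 1) (k m : ℕ) : ∑' n, pathTerm q k m n = pathSum q (k + 1) m := by
  induction k generalizing m with
  | zero =>
    rw [← (Equiv.funUnique (Fin 1) ℕ).symm.tsum_eq]
    simp only [pathSum, one_mul]
    refine tsum_congr fun n => ?_
    simp [pathTerm, pow_succ, pow_add, pow_mul, mul_pow]
  | succ k ih =>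
    have hs := summable_pathTerm hq (k + 1) m
    rw [← (Fin.consEquiv fun _ => ℕ).summable_iff] at hs
    -- Sum over the variable of the first node last; its value is the weight of the rest of the
    -- path.
    rw [← (Fin.consEquiv fun _ => ℕ).tsum_eq]
    refine hs.tsum_prod.trans ?_
    rw [pathSum]
    refine tsum_congr fun a => ?_
    rw [← ih a, ← tsum_mul_right]
    refine tsum_congr fun n => ?_
    simp only [Function.comp_apply, Fin.consEquiv, Equiv.coe_fn_mk, pathTerm, Fin.cons_zero,
      Fin.sum_univ_succ, Fin.cons_succ, Fin.castSucc_zero, Fin.prod_univ_succ, ← Fin.succ_castSucc]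
    rw [div_mul_div_comm, mul_comm (_ * _) (qPoch q a), ← pow_mul, ← pow_add]
    congr 2
    ring

/-- The edges of the path, enumerated by their lower end points. -/
lemma sum_edgeFinset_pathGraph (k : ℕ) (n : Fin (k + 1) → ℕ)
    [Fintype (SimpleGraph.pathGraph (k + 1)).edgeSet] :
    ∑ e ∈ (SimpleGraph.pathGraph (k + 1)).edgeFinset, (e.map n).mul
      = ∑ i : Fin k, n i.castSucc * n i.succ := by
  classical
  have h : (SimpleGraph.pathGraph (k + 1)).edgeFinset
      = Finset.univ.image fun i : Fin k => s(i.castSucc, i.succ) := by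
    ext e
    induction e using Sym2.ind with
    | _ a b =>
      simp only [SimpleGraph.mem_edgeFinset, SimpleGraph.mem_edgeSet, SimpleGraph.pathGraph_adj,
        Finset.mem_image, Finset.mem_univ, true_and, Sym2.eq_iff, Fin.ext_iff, Fin.val_castSucc,
        Fin.val_succ]
      constructor
      · rintro (h | h)
        · exact ⟨⟨a, by omega⟩, Or.inl ⟨rfl, h⟩⟩
        · exact ⟨⟨b, by omega⟩, Or.inr ⟨rfl, h⟩⟩
      · rintro ⟨i, h | h⟩ <;> omega
  rw [h, Finset.sum_image]
  · simp
  · intro i _ j _ hij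
    simp only [Sym2.eq_iff, Fin.ext_iff, Fin.val_castSucc, Fin.val_succ] at hij
    ext
    omega

lemma HA_succ_eq_pathSum (hq : ‖q‖ < 1) (k : ℕ) : HA (k + 1) q = pathSum q (k + 1) 0 := by
  rw [← tsum_pathTerm hq, HA, graphSeries]
  refine tsum_congr fun n => ?_
  rw [sum_edgeFinset_pathGraph, pathTerm, zero_mul, zero_add]

/-- The transfer operator is symmetric for the weight `qⁿ / (q)_n`. -/
lemma tsum_transfer_symm (hq : ‖q‖ < 1) {φ ψ : ℕ → ℂ} {A B : ℝ} (hφ : ∀ n, ‖φ n‖ ≤ A)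
    (hψ : ∀ n, ‖ψ n‖ ≤ B) :
    ∑' m : ℕ, (∑' n : ℕ, φ n * ((q ^ (m + 1)) ^ n / qPoch q n)) * (ψ m * (q ^ m / qPoch q m))
      = ∑' n : ℕ, φ n * (q ^ n / qPoch q n)
          * ∑' m : ℕ, ψ m * ((q ^ (n + 1)) ^ m / qPoch q m) := by
  obtain ⟨C, hC0, hC⟩ := exists_norm_inv_qPoch_le hq
  have hA : 0 ≤ A := (norm_nonneg _).trans (hφ 0)
  have hB : 0 ≤ B := (norm_nonneg _).trans (hψ 0)
  have hs : Summable fun p : ℕ × ℕ =>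
      φ p.2 * ((q ^ (p.1 + 1)) ^ p.2 / qPoch q p.2) * (ψ p.1 * (q ^ p.1 / qPoch q p.1)) := by
    have hg := summable_geometric_of_lt_one (norm_nonneg q) hq
    refine Summable.of_norm_bounded ((hg.mul_left (B * C)).mul_of_nonneg (hg.mul_left (A * C))
      (fun _ => by positivity) (fun _ => by positivity)) fun p => ?_
    simp only [div_eq_mul_inv, norm_mul, norm_pow]
    rw [mul_comm]
    have h1 : (‖q‖ ^ (p.1 + 1)) ^ p.2 ≤ ‖q‖ ^ p.2 := by
      gcongr
      calc ‖q‖ ^ (p.1 + 1) ≤ ‖q‖ ^ 1 := pow_le_pow_of_le_one (norm_nonneg _) hq.le (by omega)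
        _ = ‖q‖ := pow_one _
    calc ‖ψ p.1‖ * (‖q‖ ^ p.1 * ‖(qPoch q p.1)⁻¹‖)
          * (‖φ p.2‖ * ((‖q‖ ^ (p.1 + 1)) ^ p.2 * ‖(qPoch q p.2)⁻¹‖))
        ≤ B * (‖q‖ ^ p.1 * C) * (A * (‖q‖ ^ p.2 * C)) := by
          gcongr
          · exact hψ _
          · exact hC _
          · exact hφ _
          · exact hC _
      _ = _ := by ring
  simp only [← tsum_mul_right, ← tsum_mul_left]
  rw [← hs.tsum_prod, ← (Equiv.prodComm ℕ ℕ).tsum_eq]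
  refine ((Equiv.prodComm ℕ ℕ).summable_iff.2 hs).tsum_prod.trans ?_
  refine tsum_congr fun n => tsum_congr fun m => ?_
  simp only [Function.comp_apply, Equiv.prodComm_apply, Prod.swap]
  have e : (q ^ (m + 1)) ^ n * q ^ m = (q ^ (n + 1)) ^ m * q ^ n := by
    rw [← pow_mul, ← pow_mul, ← pow_add, ← pow_add]
    congr 1
    ring
  calc _ = φ n * ψ m * (qPoch q n)⁻¹ * (qPoch q m)⁻¹ * ((q ^ (m + 1)) ^ n * q ^ m) := by
        simp only [div_eq_mul_inv]; ring
    _ = _ := by rw [e]; simp only [div_eq_mul_inv]; ring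

/-- A path splits at any interior node. -/
lemma pathSum_split (hq : ‖q‖ < 1) (i j : ℕ) :
    pathSum q (i + j + 1) 0 = ∑' n : ℕ, pathSum q i n * (pathSum q j n * (q ^ n / qPoch q n)) := by
  induction j generalizing i with
  | zero => simp [pathSum]
  | succ j ih =>
    rw [show i + (j + 1) + 1 = (i + 1) + j + 1 by ring, ih (i + 1)]
    obtain ⟨A, hA⟩ := exists_norm_pathSum_le hq i
    obtain ⟨B, hB⟩ := exists_norm_pathSum_le hq j
    simp only [pathSum]
    rw [tsum_transfer_symm hq hA hB]
    refine tsum_congr fun n => ?_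
    ring

end QSeries

/-! ### Closed forms of the graph series of short paths -/

section ClosedForms

variable {q : ℂ}

/-- The Lambert series `∑_{n ≥ 1} qⁿ / (1 - qⁿ)`, the generating function of the number of
divisors. -/
noncomputable def lambertSum (q : ℂ) : ℂ := ∑' n : ℕ, q ^ (n + 1) / (1 - q ^ (n + 1))

/-- The sum of tails `∑_{m ≥ 0} ((q)_m - (q)_∞)`. -/
noncomputable def pochTails (q : ℂ) : ℂ := ∑' m : ℕ, (qPoch q m - qPochInf q)

lemma norm_eulerSeries_sub_one_le (hq : ‖q‖ < 1) {r : ℝ} (hr : r < 1) :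
    ∃ C : ℝ, 0 ≤ C ∧ ∀ x : ℂ, ‖x‖ ≤ r → ‖eulerSeries q x - 1‖ ≤ C * ‖x‖ := by
  rcases lt_or_ge r 0 with h0 | h0
  · exact ⟨0, le_rfl, fun x hx => absurd (hx.trans_lt h0) (norm_nonneg x).not_gt⟩
  obtain ⟨C, hC0, hC⟩ := exists_norm_inv_qPoch_le hq
  have hs := (summable_geometric_of_lt_one h0 hr)
  refine ⟨(∑' n : ℕ, r ^ n) * C, mul_nonneg (tsum_nonneg fun n => by positivity) hC0.le,
    fun x hx => ?_⟩
  rw [eulerSeries, (summable_pow_div_qPoch hq (hx.trans_lt hr)).tsum_eq_zero_add]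
  simp only [pow_zero, qPoch_zero, div_one, add_sub_cancel_left]
  refine (tsum_of_norm_bounded (hs.mul_right (C * ‖x‖)).hasSum fun n => ?_).trans_eq ?_
  · rw [div_eq_mul_inv, norm_mul, norm_pow, pow_succ]
    calc ‖x‖ ^ n * ‖x‖ * ‖(qPoch q (n + 1))⁻¹‖ ≤ r ^ n * ‖x‖ * C := by
          gcongr
          exact hC _
      _ = _ := by ring
  · rw [tsum_mul_right]; ring

lemma exists_norm_qPoch_sub_le (hq : ‖q‖ < 1) :
    ∃ C : ℝ, 0 ≤ C ∧ ∀ n, ‖qPoch q n - qPochInf q‖ ≤ C * ‖q‖ ^ n := by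
  obtain ⟨C, hC0, hC⟩ := norm_eulerSeries_sub_one_le hq hq
  refine ⟨‖qPochInf q‖ * C, by positivity, fun n => ?_⟩
  have h : qPoch q n - qPochInf q = qPochInf q * (eulerSeries q (q ^ (n + 1)) - 1) := by
    rw [eulerSeries_pow_succ hq]
    field_simp [qPochInf_ne_zero hq]
  have h1 : ‖q ^ (n + 1)‖ ≤ ‖q‖ ^ n := by
    rw [norm_pow]
    exact pow_le_pow_of_le_one (norm_nonneg _) hq.le (Nat.le_succ n)
  have h2 : ‖q ^ (n + 1)‖ ≤ ‖q‖ := by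
    rw [norm_pow]
    exact pow_le_of_le_one (norm_nonneg _) hq.le (Nat.succ_ne_zero n)
  rw [h, norm_mul, mul_assoc]
  gcongr
  exact (hC _ h2).trans (by gcongr)

lemma summable_qPoch_sub (hq : ‖q‖ < 1) : Summable fun n => qPoch q n - qPochInf q := by
  obtain ⟨C, _, hC⟩ := exists_norm_qPoch_sub_le hq
  exact Summable.of_norm_bounded
    ((summable_geometric_of_lt_one (norm_nonneg q) hq).mul_left C) hC

lemma one_sub_div_qPoch (hq : ‖q‖ < 1) (n : ℕ) :
    1 - qPochInf q / qPoch q n = (qPoch q n - qPochInf q) * (qPoch q n)⁻¹ := by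
  have := qPoch_ne_zero hq n
  field_simp

lemma exists_norm_one_sub_div_qPoch_le (hq : ‖q‖ < 1) :
    ∃ C : ℝ, 0 ≤ C ∧ ∀ n, ‖1 - qPochInf q / qPoch q n‖ ≤ C * ‖q‖ ^ n := by
  obtain ⟨C, h0, hC⟩ := exists_norm_qPoch_sub_le hq
  obtain ⟨C', h0', hC'⟩ := exists_norm_inv_qPoch_le hq
  refine ⟨C * C', by positivity, fun n => ?_⟩
  rw [one_sub_div_qPoch hq, norm_mul]
  calc _ ≤ C * ‖q‖ ^ n * C' := by
        gcongr
        · exact hC n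
        · exact hC' n
    _ = _ := by ring

lemma summable_one_sub_div_qPoch (hq : ‖q‖ < 1) :
    Summable fun n => 1 - qPochInf q / qPoch q n := by
  obtain ⟨C, _, hC⟩ := exists_norm_one_sub_div_qPoch_le hq
  exact Summable.of_norm_bounded
    ((summable_geometric_of_lt_one (norm_nonneg q) hq).mul_left C) hC

lemma norm_inv_one_sub_pow_le (hq : ‖q‖ < 1) (n : ℕ) :
    ‖(1 - q ^ (n + 1))⁻¹‖ ≤ (1 - ‖q‖)⁻¹ := by
  rw [norm_inv]
  refine inv_anti₀ (by linarith) ?_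
  have h2 : ‖q ^ (n + 1)‖ ≤ ‖q‖ := by
    rw [norm_pow]
    exact pow_le_of_le_one (norm_nonneg _) hq.le (Nat.succ_ne_zero n)
  have := norm_sub_norm_le (1 : ℂ) (q ^ (n + 1))
  rw [norm_one] at this
  linarith

lemma norm_lambert_term_le (hq : ‖q‖ < 1) (n : ℕ) :
    ‖q ^ (n + 1) / (1 - q ^ (n + 1))‖ ≤ (1 - ‖q‖)⁻¹ * ‖q‖ ^ n := by
  rw [div_eq_mul_inv, norm_mul, mul_comm, norm_pow]
  have h0 : 0 ≤ (1 - ‖q‖)⁻¹ := inv_nonneg.2 (by linarith)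
  gcongr ?_ * ?_
  · exact norm_inv_one_sub_pow_le hq n
  · exact pow_le_pow_of_le_one (norm_nonneg _) hq.le (Nat.le_succ n)

lemma summable_lambert (hq : ‖q‖ < 1) : Summable fun n : ℕ => q ^ (n + 1) / (1 - q ^ (n + 1)) :=
  Summable.of_norm_bounded
    ((summable_geometric_of_lt_one (norm_nonneg q) hq).mul_left _) (norm_lambert_term_le hq)

lemma norm_lambertSum_le (hq : ‖q‖ < 1) : ‖lambertSum q‖ ≤ (1 - ‖q‖)⁻¹ ^ 2 := by
  have h := (summable_geometric_of_lt_one (norm_nonneg q) hq).mul_left (1 - ‖q‖)⁻¹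
  refine (tsum_of_norm_bounded h.hasSum (norm_lambert_term_le hq)).trans_eq ?_
  rw [tsum_mul_left, tsum_geometric_of_lt_one (norm_nonneg q) hq, sq]

/-- Summation by parts for a geometrically decaying sequence. -/
lemma tsum_eq_tsum_succ_mul_sub {r : ℕ → ℂ} {C : ℝ} (hq : ‖q‖ < 1)
    (hr : ∀ n, ‖r n‖ ≤ C * ‖q‖ ^ n) :
    ∑' n, r n = ∑' n : ℕ, (n + 1 : ℂ) * (r n - r (n + 1)) := by
  have hg : Summable fun n : ℕ => (n : ℝ) * ‖q‖ ^ n := by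
    simpa using summable_pow_mul_geometric_of_norm_lt_one 1 (r := ‖q‖) (by simpa using hq)
  have hg' : Summable fun n : ℕ => C * ‖q‖ ^ n :=
    (summable_geometric_of_lt_one (norm_nonneg q) hq).mul_left C
  have h0 : Summable r := Summable.of_norm_bounded hg' hr
  have h1 : Summable fun n : ℕ => (n : ℂ) * r n := by
    refine Summable.of_norm_bounded (hg.mul_left C) fun n => ?_
    rw [norm_mul, Complex.norm_natCast]
    calc (n : ℝ) * ‖r n‖ ≤ n * (C * ‖q‖ ^ n) := by gcongr; exact hr n
      _ = _ := by ring
  have h2 : ∑' n : ℕ, (n : ℂ) * r n = ∑' n : ℕ, ((n + 1 : ℕ) : ℂ) * r (n + 1) := by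
    rw [h1.tsum_eq_zero_add]; simp
  have h3 := (summable_nat_add_iff 1).2 h1
  have : ∀ n : ℕ, (n + 1 : ℂ) * (r n - r (n + 1))
      = ((n : ℂ) * r n + r n) - ((n + 1 : ℕ) : ℂ) * r (n + 1) := fun n => by push_cast; ring
  rw [tsum_congr this, (h1.add h0).tsum_sub h3, h1.tsum_add h0, ← h2]
  ring

lemma inv_qPoch_sub_inv_qPoch (hq : ‖q‖ < 1) (n : ℕ) :
    (qPoch q (n + 1))⁻¹ - (qPoch q n)⁻¹ = q ^ (n + 1) / qPoch q (n + 1) := by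
  have h1 := qPoch_ne_zero hq n
  have h2 := one_sub_pow_succ_ne_zero hq n
  rw [qPoch_succ]
  field_simp
  ring

/-- The `q`-difference equation of `∑ n xⁿ / (q)_n`, that is, of `x` times the derivative of Euler's
series. -/
lemma tsum_nat_mul_sub (hq : ‖q‖ < 1) {x : ℂ} (hx : ‖x‖ < 1) :
    ∑' n : ℕ, n * ((x * q) ^ n / qPoch q n)
      = (1 - x) * ∑' n : ℕ, n * (x ^ n / qPoch q n) - x * eulerSeries q x := by
  have h1 := summable_nat_mul_pow_div_qPoch hq hx
  have h2 := summable_nat_mul_pow_div_qPoch hq (norm_mul_lt_one hx hq.le)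
  have h3 := summable_pow_div_qPoch hq hx
  have : ∑' n : ℕ, n * (x ^ n / qPoch q n) - ∑' n : ℕ, n * ((x * q) ^ n / qPoch q n)
      = x * (∑' n : ℕ, n * (x ^ n / qPoch q n) + eulerSeries q x) := by
    rw [← h1.tsum_sub h2, (h1.sub h2).tsum_eq_zero_add, eulerSeries, ← h1.tsum_add h3,
      ← tsum_mul_left]
    simp only [Nat.cast_zero, zero_mul, sub_self, zero_add]
    refine tsum_congr fun n => ?_
    rw [← mul_sub, pow_succ_div_qPoch_sub hq]
    push_cast
    ring
  linear_combination -this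

/-- The logarithmic derivative of Euler's series at `q` is the Lambert series. -/
lemma tsum_nat_mul_eq_lambertSum (hq : ‖q‖ < 1) :
    qPochInf q * ∑' n : ℕ, n * (q ^ n / qPoch q n) = lambertSum q := by
  -- `e k` is `x` times the logarithmic derivative of Euler's series, at `x = q ^ (k + 1)`. Its
  -- decrements are the terms of the Lambert series, and it tends to `0`.
  set e : ℕ → ℂ := fun k =>
    (∑' n : ℕ, n * ((q * q ^ k) ^ n / qPoch q n)) / eulerSeries q (q * q ^ k) with he
  have hlt : ∀ k : ℕ, ‖q * q ^ k‖ < 1 := fun k =>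
    norm_mul_lt_one hq (by rw [norm_pow]; exact pow_le_one₀ (norm_nonneg _) hq.le)
  have hE : ∀ k : ℕ, eulerSeries q (q * q ^ k) ≠ 0 := fun k => by
    rw [← pow_succ', eulerSeries_pow_succ hq]
    exact div_ne_zero (qPoch_ne_zero hq k) (qPochInf_ne_zero hq)
  have hrec : ∀ k, e (k + 1) = e k - q ^ (k + 1) / (1 - q ^ (k + 1)) := fun k => by
    have h1 := one_sub_pow_succ_ne_zero hq k
    have h2 := hE k
    have h3 : q * q ^ (k + 1) = q * q ^ k * q := by ring
    simp only [he]
    rw [h3, tsum_nat_mul_sub hq (hlt k), eulerSeries_sub hq (hlt k)]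
    rw [pow_succ'] at h1 ⊢
    field_simp
  have hsum : ∀ K, ∑ k ∈ Finset.range K, q ^ (k + 1) / (1 - q ^ (k + 1)) = e 0 - e K := fun K => by
    induction K with
    | zero => simp
    | succ K ih => rw [Finset.sum_range_succ, ih, hrec]; ring
  have hlim : Tendsto e atTop (𝓝 0) := by
    obtain ⟨C, hC0, hC⟩ := exists_norm_inv_qPoch_le hq
    have hnum : Tendsto (fun k : ℕ => ∑' n : ℕ, n * ((q * q ^ k) ^ n / qPoch q n)) atTop (𝓝 0) := by
      have h0 : Tendsto (fun n : ℕ => q * q ^ n) atTop (𝓝 0) := by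
        simpa using (tendsto_pow_atTop_nhds_zero_of_norm_lt_one hq).const_mul q
      have hg := (summable_norm_pow_mul_geometric_of_norm_lt_one 1 hq).mul_right C
      have key := tendsto_tsum_of_dominated_convergence (𝓕 := atTop)
        (f := fun (k : ℕ) (n : ℕ) => (n : ℂ) * ((q * q ^ k) ^ n / qPoch q n))
        (g := fun _ => 0) hg
        (fun n => ?_) (Eventually.of_forall fun k n => ?_)
      · simpa using key
      · rcases eq_or_ne n 0 with rfl | hn
        · simp
        · simpa [hn] using ((h0.pow n).div_const (qPoch q n)).const_mul (n : ℂ)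
      · rw [div_eq_mul_inv, norm_mul, norm_mul, norm_mul, norm_pow, norm_mul, pow_one, norm_pow,
          norm_pow, mul_assoc]
        gcongr
        · exact mul_le_of_le_one_right (norm_nonneg _) (pow_le_one₀ (norm_nonneg _) hq.le)
        · exact hC n
    have := hnum.div (tendsto_eulerSeries_zero hq hq) one_ne_zero
    rwa [zero_div] at this
  have h1 : Tendsto (fun K => e 0 - e K) atTop (𝓝 (lambertSum q)) :=
    (summable_lambert hq).hasSum.tendsto_sum_nat.congr hsum
  have h2 : Tendsto (fun K => e 0 - e K) atTop (𝓝 (e 0 - 0)) := tendsto_const_nhds.sub hlim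
  rw [tendsto_nhds_unique h1 h2]
  simp only [he, pow_zero, mul_one, sub_zero]
  rw [eq_div_iff (by simpa using hE 0)]
  linear_combination (∑' n : ℕ, n * (q ^ n / qPoch q n)) * eulerSeries_self_mul hq

/-- Uchimura's identity, by summation by parts. -/
lemma tsum_one_sub_div_qPoch (hq : ‖q‖ < 1) :
    ∑' n : ℕ, (1 - qPochInf q / qPoch q n) = lambertSum q := by
  obtain ⟨C, _, hC⟩ := exists_norm_one_sub_div_qPoch_le hq
  rw [tsum_eq_tsum_succ_mul_sub hq hC, ← tsum_nat_mul_eq_lambertSum hq,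
    (summable_nat_mul_pow_div_qPoch hq hq).tsum_eq_zero_add]
  simp only [Nat.cast_zero, zero_mul, zero_add]
  rw [← tsum_mul_left]
  refine tsum_congr fun n => ?_
  have := inv_qPoch_sub_inv_qPoch hq n
  push_cast
  linear_combination (n + 1 : ℂ) * qPochInf q * this

lemma tsum_one_sub_div_qPoch_succ (hq : ‖q‖ < 1) :
    ∑' n : ℕ, (1 - qPochInf q / qPoch q (n + 1)) = lambertSum q - 1 + qPochInf q := by
  have h := (summable_one_sub_div_qPoch hq).tsum_eq_zero_add
  rw [tsum_one_sub_div_qPoch hq, qPoch_zero, div_one] at h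
  linear_combination -h

lemma pathSum_one (hq : ‖q‖ < 1) (m : ℕ) : pathSum q 1 m = qPoch q m / qPochInf q := by
  rw [← eulerSeries_pow_succ hq]
  simp [pathSum, eulerSeries]

lemma pathSum_two (hq : ‖q‖ < 1) (m : ℕ) :
    pathSum q 2 m = (1 - q ^ (m + 1))⁻¹ / qPochInf q := by
  rw [pathSum, ← tsum_geometric_of_norm_lt_one (norm_pow_succ_lt_one hq m), ← tsum_div_const]
  refine tsum_congr fun n => ?_
  rw [pathSum_one hq]
  have := qPoch_ne_zero hq n
  field_simp

/-- The factor `1 / (1 - q ^ (n + 1))` of `pathSum q 2 n` completes `(q)_n` to `(q)_{n+1}`, so that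
Euler's series at `q ^ (m + 1)` without its first term appears. -/
lemma pathSum_three (hq : ‖q‖ < 1) (h0 : q ≠ 0) (m : ℕ) :
    pathSum q 3 m = (qPoch q m - qPochInf q) / (qPochInf q ^ 2 * q ^ (m + 1)) := by
  have hP := qPochInf_ne_zero hq
  have hx := norm_pow_succ_lt_one hq m
  have h := (summable_pow_div_qPoch hq hx).tsum_eq_zero_add
  rw [← eulerSeries, eulerSeries_pow_succ hq] at h
  have h2 : pathSum q 3 m
      = (∑' n : ℕ, (q ^ (m + 1)) ^ (n + 1) / qPoch q (n + 1)) / (qPochInf q * q ^ (m + 1)) := by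
    rw [pathSum, ← tsum_div_const]
    refine tsum_congr fun n => ?_
    have h1 := qPoch_ne_zero hq n
    have h2 := one_sub_pow_succ_ne_zero hq n
    have h3 : q ^ (m + 1) ≠ 0 := pow_ne_zero _ h0
    rw [pathSum_two hq, qPoch_succ, pow_succ (q ^ (m + 1)) n]
    generalize q ^ (m + 1) = x at *
    field_simp
  rw [h2]
  simp only [pow_zero, qPoch_zero, div_one] at h
  have h3 : q ^ (m + 1) ≠ 0 := pow_ne_zero _ h0
  generalize q ^ (m + 1) = x at *
  field_simp
  field_simp at h
  linear_combination -h

lemma pathSum_four (hq : ‖q‖ < 1) (h0 : q ≠ 0) (m : ℕ) :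
    q * qPochInf q ^ 2 * pathSum q 4 m = ∑' n : ℕ, (q ^ m) ^ n * (1 - qPochInf q / qPoch q n) := by
  have hP := qPochInf_ne_zero hq
  rw [pathSum, ← tsum_mul_left]
  refine tsum_congr fun n => ?_
  have h1 := qPoch_ne_zero hq n
  rw [pathSum_three hq h0, ← pow_mul, ← pow_mul, show (m + 1) * n = m * n + n by ring, pow_add,
    pow_succ]
  field_simp
  ring

lemma pathSum_four_zero (hq : ‖q‖ < 1) (h0 : q ≠ 0) :
    q * qPochInf q ^ 2 * pathSum q 4 0 = lambertSum q := by
  rw [pathSum_four hq h0, ← tsum_one_sub_div_qPoch hq]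
  simp

lemma pathSum_four_succ (hq : ‖q‖ < 1) (h0 : q ≠ 0) (m : ℕ) :
    q * qPochInf q ^ 2 * pathSum q 4 (m + 1) = (1 - q ^ (m + 1))⁻¹ - qPoch q m := by
  have hP := qPochInf_ne_zero hq
  have hx := norm_pow_succ_lt_one hq m
  have h1 := summable_geometric_of_norm_lt_one hx
  have h2 := (summable_pow_div_qPoch hq hx).mul_left (qPochInf q)
  have h3 : ∀ n : ℕ, (q ^ (m + 1)) ^ n * (1 - qPochInf q / qPoch q n)
      = (q ^ (m + 1)) ^ n - qPochInf q * ((q ^ (m + 1)) ^ n / qPoch q n) := fun n => by ring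
  rw [pathSum_four hq h0, tsum_congr h3, h1.tsum_sub h2, tsum_geometric_of_norm_lt_one hx,
    tsum_mul_left, ← eulerSeries, eulerSeries_pow_succ hq]
  field_simp

lemma inv_one_sub_eq (hq : ‖q‖ < 1) (n : ℕ) :
    (1 - q ^ (n + 1))⁻¹ = 1 + q ^ (n + 1) / (1 - q ^ (n + 1)) := by
  have := one_sub_pow_succ_ne_zero hq n
  field_simp
  ring

theorem HA_two (hq : ‖q‖ < 1) : qPochInf q * HA 2 q = (1 - q)⁻¹ := by
  have hP := qPochInf_ne_zero hq
  rw [HA_succ_eq_pathSum hq, pathSum_two hq, zero_add, pow_one]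
  field_simp

theorem HA_three (hq : ‖q‖ < 1) : q * qPochInf q ^ 2 * HA 3 q = 1 - qPochInf q := by
  have hP := qPochInf_ne_zero hq
  -- After splitting at the middle node the summands are `(q)_n - (q)_{n+1}`.
  have ht : HasSum (fun n => qPoch q n - qPoch q (n + 1)) (1 - qPochInf q) := by
    have hs : Summable fun n => qPoch q n - qPoch q (n + 1) := by
      have h := summable_qPoch_sub hq
      refine (h.sub ((summable_nat_add_iff 1).2 h)).congr fun n => by ring
    have h2 := hs.hasSum.tendsto_sum_nat
    simp only [Finset.sum_range_sub'] at h2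
    rw [qPoch_zero] at h2
    rw [← tendsto_nhds_unique h2 (tendsto_const_nhds.sub (tendsto_qPoch hq))]
    exact hs.hasSum
  rw [HA_succ_eq_pathSum hq, pathSum_split hq 1 1, ← ht.tsum_eq, ← tsum_mul_left]
  refine tsum_congr fun n => ?_
  have h1 := qPoch_ne_zero hq n
  rw [pathSum_one hq, qPoch_succ]
  field_simp
  ring

theorem HA_four (hq : ‖q‖ < 1) : q * qPochInf q ^ 2 * HA 4 q = lambertSum q := by
  have hP := qPochInf_ne_zero hq
  rw [HA_succ_eq_pathSum hq, pathSum_split hq 1 2, lambertSum, ← tsum_mul_left]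
  refine tsum_congr fun n => ?_
  have h1 := qPoch_ne_zero hq n
  rw [pathSum_one hq, pathSum_two hq]
  field_simp
  ring

theorem HA_five (hq : ‖q‖ < 1) (h0 : q ≠ 0) : q * qPochInf q ^ 3 * HA 5 q = pochTails q := by
  have hP := qPochInf_ne_zero hq
  rw [HA_succ_eq_pathSum hq, pathSum_split hq 1 3, pochTails, ← tsum_mul_left]
  refine tsum_congr fun n => ?_
  have h1 := qPoch_ne_zero hq n
  rw [pathSum_one hq, pathSum_three hq h0, pow_succ]
  field_simp
  ring

lemma div_qPoch_succ (hq : ‖q‖ < 1) (n : ℕ) :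
    qPochInf q / qPoch q n * (1 - q ^ (n + 1))⁻¹ = qPochInf q / qPoch q (n + 1) := by
  rw [qPoch_succ]
  have h1 := qPoch_ne_zero hq n
  have h2 := one_sub_pow_succ_ne_zero hq n
  field_simp

theorem HA_six (hq : ‖q‖ < 1) (h0 : q ≠ 0) :
    q * qPochInf q ^ 3 * HA 6 q = 2 * lambertSum q - 1 + qPochInf q := by
  have hP := qPochInf_ne_zero hq
  have h1 := (summable_nat_add_iff 1).2 (summable_one_sub_div_qPoch hq)
  have h2 : 2 * lambertSum q - 1 + qPochInf q
      = ∑' n : ℕ, (q ^ (n + 1) / (1 - q ^ (n + 1)) + (1 - qPochInf q / qPoch q (n + 1))) := by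
    rw [(summable_lambert hq).tsum_add h1, tsum_one_sub_div_qPoch_succ hq, ← lambertSum]
    ring
  rw [h2, HA_succ_eq_pathSum hq, pathSum_split hq 2 3, ← tsum_mul_left]
  refine tsum_congr fun n => ?_
  have h3 := qPoch_ne_zero hq n
  rw [pathSum_two hq, pathSum_three hq h0, ← div_qPoch_succ hq, pow_succ q n]
  have h4 := inv_one_sub_eq hq n
  rw [pow_succ] at h4
  have h5 : q * qPochInf q ^ 3 * ((1 - q ^ n * q)⁻¹ / qPochInf q
      * ((qPoch q n - qPochInf q) / (qPochInf q ^ 2 * (q ^ n * q)) * (q ^ n / qPoch q n)))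
      = (1 - q ^ n * q)⁻¹ * (1 - qPochInf q / qPoch q n) := by
    generalize (1 - q ^ n * q)⁻¹ = y
    field_simp
  rw [h5]
  linear_combination h4

theorem HA_seven (hq : ‖q‖ < 1) (h0 : q ≠ 0) :
    q * (1 - q) * qPochInf q ^ 4 * HA 7 q
      = pochTails q - 1 + qPochInf q + qPochInf q * lambertSum q := by
  have hP := qPochInf_ne_zero hq
  obtain ⟨C, hC0, hC⟩ := exists_norm_qPoch_sub_le hq
  obtain ⟨C', hC0', hC'⟩ := exists_norm_inv_qPoch_le hq
  -- Splitting at the middle node gives `∑ b n / q ^ (n + 1)`, up to a factor. The factor `1 - q` is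
  -- what makes this computable: it turns the sum into the boundary term `b 0` and the series of
  -- `(b n - b (n + 1)) / q ^ (n + 1)`, whose terms no longer contain negative powers of `q`.
  set b : ℕ → ℂ := fun n => (qPoch q n - qPochInf q) ^ 2 / qPoch q n with hb
  have hn0 : 0 < ‖q‖ := norm_pos_iff.2 h0
  have hs : Summable fun n : ℕ => b n / q ^ n := by
    refine Summable.of_norm_bounded
      ((summable_geometric_of_lt_one (norm_nonneg q) hq).mul_left (C ^ 2 * C')) fun n => ?_
    simp only [hb]
    rw [norm_div, norm_pow q, div_le_iff₀ (pow_pos hn0 n), div_eq_mul_inv, norm_mul, norm_pow]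
    calc ‖qPoch q n - qPochInf q‖ ^ 2 * ‖(qPoch q n)⁻¹‖ ≤ (C * ‖q‖ ^ n) ^ 2 * C' := by
          gcongr
          · exact hC n
          · exact hC' n
      _ = _ := by ring
  have hs1 : Summable fun n : ℕ => b n / q ^ (n + 1) := by
    refine (hs.div_const q).congr fun n => ?_
    rw [pow_succ, div_div]
  have hs2 := (summable_nat_add_iff 1).2 hs
  have h7 : q * (1 - q) * qPochInf q ^ 4 * HA 7 q = (1 - q) * ∑' n : ℕ, b n / q ^ (n + 1) := by
    rw [HA_succ_eq_pathSum hq, pathSum_split hq 3 3, mul_comm q, mul_assoc, mul_assoc,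
      ← tsum_mul_left, ← tsum_mul_left]
    congr 1
    refine tsum_congr fun n => ?_
    have h1 := qPoch_ne_zero hq n
    simp only [hb]
    rw [pathSum_three hq h0, pow_succ]
    field_simp
    ring
  have e1 : q * ∑' n : ℕ, b n / q ^ (n + 1) = ∑' n : ℕ, b n / q ^ n := by
    rw [← tsum_mul_left]
    refine tsum_congr fun n => ?_
    rw [pow_succ]
    field_simp
  have e2 := hs.tsum_eq_zero_add
  have e3 : ∑' n : ℕ, b n / q ^ (n + 1) - ∑' n : ℕ, b (n + 1) / q ^ (n + 1)
      = pochTails q + qPochInf q * (lambertSum q - 1 + qPochInf q) := by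
    have h1 := (summable_nat_add_iff 1).2 (summable_one_sub_div_qPoch hq)
    rw [← hs1.tsum_sub hs2, pochTails, ← tsum_one_sub_div_qPoch_succ hq, ← tsum_mul_left,
      ← (summable_qPoch_sub hq).tsum_add (h1.mul_left _)]
    refine tsum_congr fun n => ?_
    have h1 := qPoch_ne_zero hq n
    have h2 := one_sub_pow_succ_ne_zero hq n
    have h3 : q ^ (n + 1) ≠ 0 := pow_ne_zero _ h0
    simp only [hb]
    rw [qPoch_succ]
    generalize q ^ (n + 1) = x at *
    field_simp
    ring
  have e4 : b 0 / q ^ 0 = (1 - qPochInf q) ^ 2 := by simp [hb]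
  rw [h7]
  linear_combination e3 - e1 - e2 - e4

lemma summable_div_qPoch_mul_lambert (hq : ‖q‖ < 1) : Summable fun n : ℕ =>
    qPochInf q / qPoch q (n + 1) * (q ^ (n + 1) / (1 - q ^ (n + 1))) := by
  have h1 := summable_norm_iff.2 (summable_lambert hq)
  obtain ⟨C, hC0, hC⟩ := exists_norm_inv_qPoch_le hq
  refine Summable.of_norm_bounded (h1.mul_left (‖qPochInf q‖ * C)) fun n => ?_
  rw [div_eq_mul_inv, norm_mul, norm_mul]
  gcongr
  exact hC _

/-- Obtained by computing `H_{A_5}` in two ways: by splitting the path at its second node, and at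
its end. -/
lemma tsum_div_qPoch_mul_lambert (hq : ‖q‖ < 1) (h0 : q ≠ 0) :
    ∑' n : ℕ, qPochInf q / qPoch q (n + 1) * (q ^ (n + 1) / (1 - q ^ (n + 1))) = pochTails q := by
  have hP := qPochInf_ne_zero hq
  have hs : Summable fun n => pathSum q 4 n * (q ^ n / qPoch q n) := by
    obtain ⟨A, hA⟩ := exists_norm_pathSum_le hq 4
    exact summable_mul_pow_div_qPoch hq hq hA
  have h5 : HA 5 q = ∑' n, pathSum q 4 n * (q ^ n / qPoch q n) := by
    rw [HA_succ_eq_pathSum hq, pathSum_split hq 0 4]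
    simp [pathSum]
  have h1 := HA_five hq h0
  rw [h5, hs.tsum_eq_zero_add, mul_add] at h1
  have h2 : ∀ n : ℕ, q * qPochInf q ^ 3 * (pathSum q 4 (n + 1) * (q ^ (n + 1) / qPoch q (n + 1)))
      = qPochInf q / qPoch q (n + 1) * (q ^ (n + 1) / (1 - q ^ (n + 1)))
        - qPochInf q * (q ^ (n + 1) / (1 - q ^ (n + 1))) := fun n => by
    have h3 := pathSum_four_succ hq h0 n
    have h4 := qPoch_ne_zero hq n
    have h5 := one_sub_pow_succ_ne_zero hq n
    rw [show q * qPochInf q ^ 3 * (pathSum q 4 (n + 1) * (q ^ (n + 1) / qPoch q (n + 1)))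
      = (q * qPochInf q ^ 2 * pathSum q 4 (n + 1)) * qPochInf q
        * (q ^ (n + 1) / qPoch q (n + 1)) by ring, h3, qPoch_succ]
    field_simp
  have h3 : q * qPochInf q ^ 3 * (pathSum q 4 0 * (q ^ 0 / qPoch q 0))
      = qPochInf q * lambertSum q := by
    rw [← pathSum_four_zero hq h0, pow_zero, qPoch_zero]
    ring
  rw [← tsum_mul_left, tsum_congr h2, h3,
    (summable_div_qPoch_mul_lambert hq).tsum_sub ((summable_lambert hq).mul_left _),
    tsum_mul_left, ← lambertSum] at h1
  linear_combination h1

theorem HA_eight (hq : ‖q‖ < 1) (h0 : q ≠ 0) :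
    q ^ 2 * qPochInf q ^ 4 * HA 8 q
      = 3 * lambertSum q - 1 + qPochInf q - 2 * pochTails q := by
  have hP := qPochInf_ne_zero hq
  have hs : Summable fun n => pathSum q 4 n * (pathSum q 3 n * (q ^ n / qPoch q n)) := by
    obtain ⟨A, hA⟩ := exists_norm_pathSum_le hq 4
    obtain ⟨B, hB⟩ := exists_norm_pathSum_le hq 3
    have hA0 : 0 ≤ A := (norm_nonneg _).trans (hA 0)
    simp only [← mul_assoc]
    refine summable_mul_pow_div_qPoch hq hq (A := A * B) fun n => ?_
    rw [norm_mul]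
    gcongr
    · exact hA n
    · exact hB n
  have h3 : ∀ n : ℕ, q ^ 2 * qPochInf q ^ 4
      * (pathSum q 4 n * (pathSum q 3 n * (q ^ n / qPoch q n)))
      = (q * qPochInf q ^ 2 * pathSum q 4 n) * (1 - qPochInf q / qPoch q n) := fun n => by
    have h4 := qPoch_ne_zero hq n
    rw [pathSum_three hq h0, pow_succ]
    field_simp
    ring
  -- Split at the fifth node. The formula for `pathSum q 4` is different at `n = 0`, so that this
  -- term is treated separately.
  have h4 : ∀ n : ℕ, q ^ 2 * qPochInf q ^ 4
      * (pathSum q 4 (n + 1) * (pathSum q 3 (n + 1) * (q ^ (n + 1) / qPoch q (n + 1))))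
      = (1 - qPochInf q / qPoch q (n + 1)) + q ^ (n + 1) / (1 - q ^ (n + 1))
        - qPochInf q / qPoch q (n + 1) * (q ^ (n + 1) / (1 - q ^ (n + 1)))
        - (qPoch q n - qPochInf q) + qPochInf q * (q ^ (n + 1) / (1 - q ^ (n + 1))) := fun n => by
    have h4 := qPoch_ne_zero hq n
    have h5 := one_sub_pow_succ_ne_zero hq n
    rw [h3, pathSum_four_succ hq h0, qPoch_succ]
    field_simp
    ring
  have s1 := (summable_nat_add_iff 1).2 (summable_one_sub_div_qPoch hq)
  have s2 := summable_lambert hq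
  have s3 := summable_div_qPoch_mul_lambert hq
  have s4 := summable_qPoch_sub hq
  rw [HA_succ_eq_pathSum hq, pathSum_split hq 4 3, hs.tsum_eq_zero_add, mul_add, h3,
    pathSum_four_zero hq h0, ← tsum_mul_left, tsum_congr h4,
    (((s1.add s2).sub s3).sub s4).tsum_add (s2.mul_left _), ((s1.add s2).sub s3).tsum_sub s4,
    (s1.add s2).tsum_sub s3, s1.tsum_add s2, tsum_one_sub_div_qPoch_succ hq,
    tsum_div_qPoch_mul_lambert hq h0, tsum_mul_left, ← lambertSum, ← pochTails, qPoch_zero]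
  ring

end ClosedForms

/-! ### The sum of tails as a partial theta function -/

section PartialTheta

variable {q : ℂ}

/-- The pentagonal number `k (3 k + 1) / 2`. -/
def pent (k : ℕ) : ℕ := k * (3 * k + 1) / 2

lemma two_mul_pent (k : ℕ) : 2 * pent k = k * (3 * k + 1) := by
  rw [pent, mul_comm 2, Nat.div_mul_cancel]
  rcases Nat.even_or_odd' k with ⟨j, rfl | rfl⟩
  · exact ⟨j * (3 * (2 * j) + 1), by ring⟩
  · exact ⟨(2 * j + 1) * (3 * j + 2), by ring⟩

lemma pent_succ (k : ℕ) : pent (k + 1) = pent k + 3 * k + 2 := by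
  have h1 := two_mul_pent k
  have h2 := two_mul_pent (k + 1)
  nlinarith

lemma le_pent (k : ℕ) : k ≤ pent k := by
  have := two_mul_pent k
  nlinarith [sq_nonneg (k : ℤ), Nat.le_mul_self k]

/-- The `k`-th term of the two-variable theta series: the two summands belong to the integers
`6k + 1` and `6k + 5`. -/
noncomputable def thetaTerm (q x : ℂ) (k : ℕ) : ℂ :=
  (-1) ^ k * q ^ pent k * (x ^ (3 * k) - q ^ (2 * k + 1) * x ^ (3 * k + 2))

/-- `∑ (x; q)_{n+1} xⁿ`, which is `1 - x` times `∑ (xq; q)_n xⁿ`. The factor keeps it bounded as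
`x → 1`. -/
noncomputable def stepSeries (q x : ℂ) : ℂ :=
  ∑' n : ℕ, (∏ j ∈ Finset.range (n + 1), (1 - x * q ^ j)) * x ^ n

/-- The finite products `(x; q)_n` are bounded, uniformly in `|x| ≤ 1` and `n`. -/
lemma norm_prod_one_sub_le (hq : ‖q‖ < 1) : ∃ C : ℝ, 0 ≤ C ∧ ∀ x : ℂ, ‖x‖ ≤ 1 → ∀ n : ℕ,
    ‖∏ j ∈ Finset.range n, (1 - x * q ^ j)‖ ≤ C := by
  refine ⟨Real.exp (∑' j : ℕ, ‖q‖ ^ j), (Real.exp_pos _).le, fun x hx n => ?_⟩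
  have hs := summable_geometric_of_lt_one (norm_nonneg q) hq
  calc ‖∏ j ∈ Finset.range n, (1 - x * q ^ j)‖
      = ∏ j ∈ Finset.range n, ‖1 - x * q ^ j‖ := norm_prod _ _
    _ ≤ ∏ j ∈ Finset.range n, Real.exp (‖q‖ ^ j) := by
        refine Finset.prod_le_prod (fun _ _ => norm_nonneg _) fun j _ => ?_
        have h1 : ‖x * q ^ j‖ ≤ ‖q‖ ^ j := by
          rw [norm_mul, norm_pow]
          exact mul_le_of_le_one_left (by positivity) hx
        have h2 := norm_sub_le (1 : ℂ) (x * q ^ j)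
        rw [norm_one] at h2
        linarith [Real.add_one_le_exp (‖q‖ ^ j)]
    _ = Real.exp (∑ j ∈ Finset.range n, ‖q‖ ^ j) := (Real.exp_sum _ _).symm
    _ ≤ _ := Real.exp_le_exp.2 (hs.sum_le_tsum _ fun _ _ => by positivity)

lemma summable_prod_one_sub_mul_pow (hq : ‖q‖ < 1) {x y : ℂ} (hx : ‖x‖ ≤ 1) (hy : ‖y‖ < 1) (a : ℕ) :
    Summable fun n : ℕ => (∏ j ∈ Finset.range (n + a), (1 - x * q ^ j)) * y ^ n := by
  obtain ⟨C, hC0, hC⟩ := norm_prod_one_sub_le hq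
  refine Summable.of_norm_bounded
    ((summable_geometric_of_lt_one (norm_nonneg y) hy).mul_left C) fun n => ?_
  rw [norm_mul, norm_pow]
  gcongr
  exact hC x hx _

/-- The recursions of `(xq; q)_n` at its two ends turn the series into itself at `xq`. -/
lemma stepSeries_eq (hq : ‖q‖ < 1) {x : ℂ} (hx : ‖x‖ < 1) :
    stepSeries q x = 1 - q * x ^ 2 - q ^ 2 * x ^ 3 * stepSeries q (x * q) := by
  set p : ℕ → ℂ := fun n => ∏ j ∈ Finset.range n, (1 - x * q * q ^ j) with hp
  have hxq : ‖x * q‖ < 1 := norm_mul_lt_one hx hq.le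
  have hp1 : ∀ n, p (n + 1) = p n * (1 - x * q * q ^ n) := fun n => Finset.prod_range_succ _ _
  have hstep : ∀ n, (∏ j ∈ Finset.range (n + 1), (1 - x * q ^ j)) = (1 - x) * p n := fun n => by
    rw [Finset.prod_range_succ', mul_comm, pow_zero, mul_one]
    congr 1
    refine Finset.prod_congr rfl fun j _ => ?_
    ring
  have s0 : Summable fun n => p n * x ^ n := summable_prod_one_sub_mul_pow hq hxq.le hx 0
  have s1 : Summable fun n => p (n + 1) * x ^ (n + 1) := (summable_nat_add_iff 1).2 s0
  have s2 : Summable fun n => p n * (x * q) ^ n := summable_prod_one_sub_mul_pow hq hxq.le hxq 0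
  have e1 : stepSeries q x = (1 - x) * ∑' n, p n * x ^ n := by
    rw [stepSeries, ← tsum_mul_left]
    refine tsum_congr fun n => ?_
    rw [hstep, mul_assoc]
  have e2 : ∑' n, p n * x ^ n = 1 + x * ∑' n, p n * x ^ n
      - x ^ 2 * q * ∑' n, p n * (x * q) ^ n := by
    conv_lhs => rw [s0.tsum_eq_zero_add]
    rw [← tsum_mul_left, ← tsum_mul_left, add_sub_assoc,
      ← (s0.mul_left x).tsum_sub (s2.mul_left (x ^ 2 * q))]
    congr 1
    · simp [hp]
    · refine tsum_congr fun n => ?_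
      rw [hp1]
      ring
  have e3 : ∑' n, p n * (x * q) ^ n = 1 + x * q * stepSeries q (x * q) := by
    rw [s2.tsum_eq_zero_add, stepSeries, ← tsum_mul_left]
    congr 1
    · simp [hp]
    · refine tsum_congr fun n => ?_
      simp only [hp]
      ring_nf
  rw [e1]
  linear_combination e2 - x ^ 2 * q * e3

lemma stepSeries_eq_sum (hq : ‖q‖ < 1) {x : ℂ} (hx : ‖x‖ < 1) (K : ℕ) :
    stepSeries q x = ∑ k ∈ Finset.range K, thetaTerm q x k
      + (-1) ^ K * q ^ pent K * x ^ (3 * K) * stepSeries q (x * q ^ K) := by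
  induction K with
  | zero => simp [pent]
  | succ K ih =>
    have hK : ‖x * q ^ K‖ < 1 :=
      norm_mul_lt_one hx (by rw [norm_pow]; exact pow_le_one₀ (norm_nonneg _) hq.le)
    rw [ih, stepSeries_eq hq hK, Finset.sum_range_succ, thetaTerm, pent_succ, pow_succ q K,
      ← mul_assoc x]
    ring

lemma norm_thetaTerm_le (hq : ‖q‖ < 1) {x : ℂ} (hx : ‖x‖ ≤ 1) (k : ℕ) :
    ‖thetaTerm q x k‖ ≤ 2 * ‖q‖ ^ k := by
  have h1 : ‖q‖ ^ pent k ≤ ‖q‖ ^ k := pow_le_pow_of_le_one (norm_nonneg _) hq.le (le_pent k)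
  have h2 : ‖x ^ (3 * k) - q ^ (2 * k + 1) * x ^ (3 * k + 2)‖ ≤ 2 := by
    refine (norm_sub_le _ _).trans ?_
    simp only [norm_mul, norm_pow]
    have h3 : ‖x‖ ^ (3 * k) ≤ 1 := pow_le_one₀ (norm_nonneg _) hx
    have h4 : ‖q‖ ^ (2 * k + 1) * ‖x‖ ^ (3 * k + 2) ≤ 1 :=
      mul_le_one₀ (pow_le_one₀ (norm_nonneg _) hq.le) (by positivity)
        (pow_le_one₀ (norm_nonneg _) hx)
    linarith
  rw [thetaTerm, norm_mul, norm_mul, norm_pow, norm_pow, norm_neg, norm_one, one_pow, one_mul,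
    mul_comm]
  exact mul_le_mul h2 h1 (by positivity) zero_le_two

lemma summable_thetaTerm (hq : ‖q‖ < 1) {x : ℂ} (hx : ‖x‖ ≤ 1) : Summable (thetaTerm q x) :=
  Summable.of_norm_bounded ((summable_geometric_of_lt_one (norm_nonneg q) hq).mul_left 2)
    (norm_thetaTerm_le hq hx)

/-- Iterating `stepSeries_eq` produces the theta series, and the remainder tends to zero. -/
lemma stepSeries_eq_tsum_thetaTerm (hq : ‖q‖ < 1) {x : ℂ} (hx : ‖x‖ < 1) :
    stepSeries q x = ∑' k, thetaTerm q x k := by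
  obtain ⟨C, hC0, hC⟩ := norm_prod_one_sub_le hq
  have hle : ∀ K : ℕ, ‖x * q ^ K‖ ≤ ‖x‖ := fun K => by
    rw [norm_mul, norm_pow]
    exact mul_le_of_le_one_right (norm_nonneg _) (pow_le_one₀ (norm_nonneg _) hq.le)
  have hb : ∀ K : ℕ, ‖stepSeries q (x * q ^ K)‖ ≤ ∑' n : ℕ, C * ‖x‖ ^ n := fun K => by
    refine tsum_of_norm_bounded
      ((summable_geometric_of_lt_one (norm_nonneg x) hx).mul_left C).hasSum fun n => ?_
    rw [norm_mul, norm_pow]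
    gcongr
    · exact hC _ ((hle K).trans hx.le) _
    · exact hle K
  have hrem : Tendsto (fun K : ℕ => (-1) ^ K * q ^ pent K * x ^ (3 * K) *
      stepSeries q (x * q ^ K)) atTop (𝓝 0) := by
    refine squeeze_zero_norm (a := fun K => ‖q‖ ^ K * ∑' n : ℕ, C * ‖x‖ ^ n) (fun K => ?_) ?_
    · simp only [norm_mul, norm_pow, norm_neg, norm_one, one_pow, one_mul]
      have h1 : ‖q‖ ^ pent K ≤ ‖q‖ ^ K := pow_le_pow_of_le_one (norm_nonneg _) hq.le (le_pent K)
      have h2 : ‖x‖ ^ (3 * K) ≤ 1 := pow_le_one₀ (norm_nonneg _) hx.le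
      refine mul_le_mul ?_ (hb K) (norm_nonneg _) (by positivity)
      calc _ ≤ ‖q‖ ^ K * 1 := mul_le_mul h1 h2 (by positivity) (by positivity)
        _ = _ := mul_one _
    · simpa using (tendsto_pow_atTop_nhds_zero_of_lt_one (norm_nonneg q) hq).mul_const
        (∑' n : ℕ, C * ‖x‖ ^ n)
  have h1 := (summable_thetaTerm hq hx.le).hasSum.tendsto_sum_nat.add hrem
  rw [add_zero] at h1
  exact tendsto_nhds_unique (tendsto_const_nhds.congr (stepSeries_eq_sum hq hx)) h1

/-- The relation between the theta series and Euler's series, away from the boundary `x = 1`. -/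
lemma eulerSeries_mul_tsum_thetaTerm (hq : ‖q‖ < 1) {x : ℂ} (hx : ‖x‖ < 1) :
    eulerSeries q (x * q) * ∑' k, thetaTerm q x k
      = 1 + (1 - x) * ∑' n : ℕ, (eulerSeries q (x * q ^ (n + 1)) - 1) * x ^ n := by
  have hxq : ‖x * q‖ < 1 := norm_mul_lt_one hx hq.le
  obtain ⟨C, hC0, hC⟩ := norm_eulerSeries_sub_one_le hq hx
  have hle : ∀ K : ℕ, ‖x * q ^ K‖ ≤ ‖x‖ := fun K => by
    rw [norm_mul, norm_pow]
    exact mul_le_of_le_one_right (norm_nonneg _) (pow_le_one₀ (norm_nonneg _) hq.le)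
  have hs1 : Summable fun n : ℕ => (eulerSeries q (x * q ^ (n + 1)) - 1) * x ^ n := by
    refine Summable.of_norm_bounded
      ((summable_geometric_of_lt_one (norm_nonneg x) hx).mul_left (C * ‖x‖)) fun n => ?_
    rw [norm_mul, norm_pow]
    gcongr
    exact (hC _ (hle _)).trans (mul_le_mul_of_nonneg_left (hle _) hC0)
  have hs2 := summable_geometric_of_norm_lt_one hx
  have h1 : (1 - x) * ∑' n : ℕ, x ^ n = 1 := by
    rw [tsum_geometric_of_norm_lt_one hx, mul_inv_cancel₀ (one_sub_ne_zero_of_norm_lt_one hx)]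
  rw [← stepSeries_eq_tsum_thetaTerm hq hx, stepSeries, ← tsum_mul_left]
  nth_rewrite 2 [← h1]
  rw [← mul_add, ← hs2.tsum_add hs1, ← tsum_mul_left]
  refine tsum_congr fun n => ?_
  have h2 := eulerSeries_mul_pow hq hxq n
  rw [mul_assoc, ← pow_succ'] at h2
  rw [h2, Finset.prod_range_succ', pow_zero, mul_one]
  have h3 : ∏ k ∈ Finset.range n, (1 - x * q ^ (k + 1))
      = ∏ j ∈ Finset.range n, (1 - x * q * q ^ j) :=
    Finset.prod_congr rfl fun j _ => by ring
  rw [h3]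
  ring

/-- The difference quotient `(1 - xᵐ) / (1 - x) = 1 + x + ⋯ + x^{m-1}`. -/
noncomputable def geomQuot (x : ℂ) (m : ℕ) : ℂ := ∑ i ∈ Finset.range m, x ^ i

lemma pow_eq_one_sub_geomQuot (x : ℂ) (m : ℕ) : x ^ m = 1 - (1 - x) * geomQuot x m := by
  rw [geomQuot, mul_neg_geom_sum]
  ring

lemma norm_geomQuot_le {x : ℂ} (hx : ‖x‖ ≤ 1) (m : ℕ) : ‖geomQuot x m‖ ≤ m := by
  refine (norm_sum_le _ _).trans ?_
  calc ∑ i ∈ Finset.range m, ‖x ^ i‖ ≤ ∑ i ∈ Finset.range m, (1 : ℝ) :=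
        Finset.sum_le_sum fun i _ => by rw [norm_pow]; exact pow_le_one₀ (norm_nonneg _) hx
    _ = m := by simp

/-- Abel's theorem for the one-sided derivative at `x = 1`, for an absolutely convergent series of
monomials. -/
lemma tendsto_tsum_geomQuot {a : ℕ → ℂ} {e : ℕ → ℕ} (ha : Summable fun k => ‖a k‖ * e k) :
    Tendsto (fun x : ℝ => ∑' k, a k * geomQuot x (e k)) (𝓝[<] 1) (𝓝 (∑' k, a k * e k)) := by
  refine tendsto_tsum_of_dominated_convergence ha (fun k => ?_) ?_
  · have hc : Continuous fun x : ℝ => a k * geomQuot x (e k) := by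
      unfold geomQuot
      fun_prop
    have := hc.tendsto 1
    simp only [geomQuot, Complex.ofReal_one, one_pow, Finset.sum_const, Finset.card_range,
      nsmul_eq_mul, mul_one] at this
    exact this.mono_left nhdsWithin_le_nhds
  · filter_upwards [Ioo_mem_nhdsLT (show (0 : ℝ) < 1 by norm_num)] with x hx k
    rw [norm_mul]
    gcongr
    exact norm_geomQuot_le (by rw [Complex.norm_real, Real.norm_of_nonneg hx.1.le]; exact hx.2.le) _

lemma tsum_mul_pow_eq {a : ℕ → ℂ} {e : ℕ → ℕ} (ha : Summable fun k => ‖a k‖ * e k)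
    (ha' : Summable a) {x : ℂ} (hx : ‖x‖ ≤ 1) :
    ∑' k, a k * x ^ e k = ∑' k, a k - (1 - x) * ∑' k, a k * geomQuot x (e k) := by
  have h : Summable fun k => a k * geomQuot x (e k) := by
    refine Summable.of_norm_bounded ha fun k => ?_
    rw [norm_mul]
    gcongr
    exact norm_geomQuot_le hx _
  rw [← tsum_mul_left, ← ha'.tsum_sub (h.mul_left _)]
  refine tsum_congr fun k => ?_
  rw [pow_eq_one_sub_geomQuot]
  ring

/-- The derivative at `x = 1` of `∑ thetaTerm q x k`, computed term by term. -/
noncomputable def thetaDeriv (q : ℂ) : ℂ := ∑' k : ℕ,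
  (-1) ^ k * q ^ pent k * ((3 * k : ℕ) - q ^ (2 * k + 1) * (3 * k + 2 : ℕ))

lemma summable_thetaDeriv_aux (hq : ‖q‖ < 1) :
    (Summable fun k : ℕ => ‖(-1) ^ k * q ^ pent k‖ * (3 * k : ℕ)) ∧
    (Summable fun k : ℕ => ‖-((-1) ^ k * q ^ pent k * q ^ (2 * k + 1))‖ * (3 * k + 2 : ℕ)) ∧
    (Summable fun k : ℕ => (-1) ^ k * q ^ pent k) ∧
    (Summable fun k : ℕ => -((-1) ^ k * q ^ pent k * q ^ (2 * k + 1))) := by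
  have hg := summable_geometric_of_lt_one (norm_nonneg q) hq
  have hg1 : Summable fun n : ℕ => (n : ℝ) * ‖q‖ ^ n := by
    simpa using summable_pow_mul_geometric_of_norm_lt_one 1 (r := ‖q‖) (by simpa using hq)
  have b1 : ∀ k : ℕ, ‖(-1) ^ k * q ^ pent k‖ ≤ ‖q‖ ^ k := fun k => by
    simp only [norm_mul, norm_pow, norm_neg, norm_one, one_pow, one_mul]
    exact pow_le_pow_of_le_one (norm_nonneg _) hq.le (le_pent k)
  have b2 : ∀ k : ℕ, ‖-((-1) ^ k * q ^ pent k * q ^ (2 * k + 1))‖ ≤ ‖q‖ ^ k := fun k => by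
    rw [norm_neg, norm_mul]
    refine (mul_le_of_le_one_right (norm_nonneg _) ?_).trans (b1 k)
    rw [norm_pow]
    exact pow_le_one₀ (norm_nonneg _) hq.le
  refine ⟨?_, ?_, Summable.of_norm_bounded hg b1, Summable.of_norm_bounded hg b2⟩
  · refine Summable.of_nonneg_of_le (fun k => by positivity) (fun k => ?_) (hg1.mul_left 3)
    calc _ ≤ ‖q‖ ^ k * (3 * k : ℕ) := by gcongr; exact b1 k
      _ = _ := by push_cast; ring
  · refine Summable.of_nonneg_of_le (fun k => by positivity) (fun k => ?_)
      ((hg1.mul_left 3).add (hg.mul_left 2))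
    calc _ ≤ ‖q‖ ^ k * (3 * k + 2 : ℕ) := by gcongr; exact b2 k
      _ = _ := by push_cast; ring

/-- First-order expansion of the theta series at `x = 1` from the left. -/
lemma exists_tsum_thetaTerm_eq (hq : ‖q‖ < 1) : ∃ g : ℝ → ℂ,
    Tendsto g (𝓝[<] 1) (𝓝 (thetaDeriv q)) ∧
    ∀ x : ℝ, 0 < x → x < 1 →
      ∑' k, thetaTerm q x k = ∑' k, thetaTerm q 1 k - (1 - x) * g x := by
  obtain ⟨h1, h2, h3, h4⟩ := summable_thetaDeriv_aux hq
  refine ⟨_, ((tendsto_tsum_geomQuot h1).add (tendsto_tsum_geomQuot h2)).trans_eq ?_, ?_⟩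
  · congr 1
    have h1' : Summable fun k : ℕ => (-1) ^ k * q ^ pent k * (3 * k : ℕ) :=
      .of_norm (h1.congr fun k => by rw [norm_mul _ ((3 * k : ℕ) : ℂ), Complex.norm_natCast])
    have h2' : Summable fun k : ℕ => -((-1) ^ k * q ^ pent k * q ^ (2 * k + 1)) * (3 * k + 2 : ℕ) :=
      .of_norm (h2.congr fun k => by rw [norm_mul _ ((3 * k + 2 : ℕ) : ℂ), Complex.norm_natCast])
    rw [thetaDeriv, ← h1'.tsum_add h2']
    refine tsum_congr fun k => ?_
    ring
  · intro x hx0 hx1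
    have hx : ‖(x : ℂ)‖ ≤ 1 := by
      rw [Complex.norm_real, Real.norm_of_nonneg hx0.le]
      exact hx1.le
    have key : ∀ y : ℂ, ‖y‖ ≤ 1 → ∑' k, thetaTerm q y k
        = ∑' k : ℕ, (-1) ^ k * q ^ pent k * y ^ (3 * k)
          + ∑' k : ℕ, -((-1) ^ k * q ^ pent k * q ^ (2 * k + 1)) * y ^ (3 * k + 2) := fun y hy => by
      rw [← Summable.tsum_add]
      · refine tsum_congr fun k => ?_
        rw [thetaTerm]
        ring
      · refine Summable.of_norm_bounded h3.norm fun k => ?_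
        rw [norm_mul, norm_pow y]
        exact mul_le_of_le_one_right (norm_nonneg _) (pow_le_one₀ (norm_nonneg _) hy)
      · refine Summable.of_norm_bounded h4.norm fun k => ?_
        rw [norm_mul, norm_pow y]
        exact mul_le_of_le_one_right (norm_nonneg _) (pow_le_one₀ (norm_nonneg _) hy)
    rw [key x hx, key 1 (by simp), tsum_mul_pow_eq h1 h3 hx, tsum_mul_pow_eq h2 h4 hx]
    simp only [one_pow, mul_one]
    ring

/-- First-order expansion of Euler's series at `xq`, `x → 1` from the left. -/
lemma exists_eulerSeries_eq (hq : ‖q‖ < 1) : ∃ g : ℝ → ℂ,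
    Tendsto g (𝓝[<] 1) (𝓝 (lambertSum q / qPochInf q)) ∧
    ∀ x : ℝ, 0 < x → x < 1 → eulerSeries q (x * q) = (qPochInf q)⁻¹ - (1 - x) * g x := by
  have h0 : Summable fun n : ℕ => ‖q ^ n / qPoch q n‖ * n :=
    (summable_nat_mul_pow_div_qPoch hq hq).norm.congr fun n => by
      rw [norm_mul, Complex.norm_natCast, mul_comm]
  refine ⟨_, (tendsto_tsum_geomQuot (e := fun n => n) h0).trans_eq ?_, fun x hx0 hx1 => ?_⟩
  · congr 1
    rw [← tsum_nat_mul_eq_lambertSum hq, mul_div_cancel_left₀ _ (qPochInf_ne_zero hq)]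
    exact tsum_congr fun n => mul_comm _ _
  · have hx : ‖(x : ℂ)‖ ≤ 1 := by
      rw [Complex.norm_real, Real.norm_of_nonneg hx0.le]
      exact hx1.le
    rw [← eq_inv_of_mul_eq_one_left (eulerSeries_self_mul hq), eulerSeries, eulerSeries,
      ← tsum_mul_pow_eq (e := fun n => n) h0 (summable_pow_div_qPoch hq hq) hx]
    refine tsum_congr fun n => ?_
    rw [mul_pow]
    ring

/-- The right-hand side of `eulerSeries_mul_tsum_thetaTerm`, divided by `1 - x`, tends to a multiple
of the sum of tails as `x → 1`. -/
lemma tendsto_eulerSeries_tails (hq : ‖q‖ < 1) :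
    Tendsto (fun x : ℝ => ∑' n : ℕ, (eulerSeries q (x * q ^ (n + 1)) - 1) * (x : ℂ) ^ n) (𝓝[<] 1)
      (𝓝 (pochTails q / qPochInf q)) := by
  have hP := qPochInf_ne_zero hq
  obtain ⟨C, hC0, hC⟩ := norm_eulerSeries_sub_one_le hq hq
  have hlim : pochTails q / qPochInf q = ∑' n : ℕ, (eulerSeries q (q ^ (n + 1)) - 1) := by
    rw [pochTails, ← tsum_div_const]
    refine tsum_congr fun n => ?_
    rw [eulerSeries_pow_succ hq]
    field_simp
  have hb : ∀ (x : ℝ) (n : ℕ), 0 < x → x < 1 → ‖(x : ℂ) * q ^ (n + 1)‖ ≤ ‖q‖ ^ (n + 1) := by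
    intro x n hx0 hx1
    rw [norm_mul, norm_pow, Complex.norm_real, Real.norm_of_nonneg hx0.le]
    exact mul_le_of_le_one_left (by positivity) hx1.le
  rw [hlim]
  refine tendsto_tsum_of_dominated_convergence (bound := fun n => C * ‖q‖ ^ (n + 1))
    (((summable_nat_add_iff 1).2 (summable_geometric_of_lt_one (norm_nonneg q) hq)).mul_left C)
    (fun n => ?_) ?_
  · -- continuity of Euler's series along the segment from `0` to `q ^ (n + 1)`
    have hcont : Tendsto (fun x : ℝ => eulerSeries q (x * q ^ (n + 1))) (𝓝[<] 1)
        (𝓝 (eulerSeries q (q ^ (n + 1)))) := by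
      refine tendsto_tsum_of_dominated_convergence
        (bound := fun k => ‖(q ^ (n + 1)) ^ k / qPoch q k‖)
        (summable_pow_div_qPoch hq (norm_pow_succ_lt_one hq n)).norm (fun k => ?_) ?_
      · have hc : Continuous fun x : ℝ => ((x : ℂ) * q ^ (n + 1)) ^ k / qPoch q k := by fun_prop
        have := hc.tendsto 1
        rw [Complex.ofReal_one, one_mul] at this
        exact this.mono_left nhdsWithin_le_nhds
      · filter_upwards [Ioo_mem_nhdsLT (show (0 : ℝ) < 1 by norm_num)] with x hx k
        rw [norm_div, norm_div, norm_pow, norm_pow _ k, norm_pow q]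
        gcongr
        exact hb x n hx.1 hx.2
    have hpow : Tendsto (fun x : ℝ => (x : ℂ) ^ n) (𝓝[<] 1) (𝓝 1) := by
      have hc : Continuous fun x : ℝ => (x : ℂ) ^ n := by fun_prop
      have := hc.tendsto 1
      rw [Complex.ofReal_one, one_pow] at this
      exact this.mono_left nhdsWithin_le_nhds
    simpa using (hcont.sub_const 1).mul hpow
  · filter_upwards [Ioo_mem_nhdsLT (show (0 : ℝ) < 1 by norm_num)] with x hx n
    have h1 := hb x n hx.1 hx.2
    have h2 : ‖q‖ ^ (n + 1) ≤ ‖q‖ := pow_le_of_le_one (norm_nonneg _) hq.le (Nat.succ_ne_zero n)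
    rw [norm_mul, norm_pow, Complex.norm_real, Real.norm_of_nonneg hx.1.le]
    calc _ ≤ C * ‖q‖ ^ (n + 1) * 1 := by
          have hx0 := hx.1.le
          gcongr
          · exact (hC _ (h1.trans h2)).trans (by gcongr)
          · exact pow_le_one₀ hx0 hx.2.le
      _ = _ := mul_one _

/-- Value and one-sided derivative at `x = 1` of the theta series: the first is the pentagonal
number theorem, the second evaluates the sum of tails. -/
lemma tsum_thetaTerm_one_and_pochTails (hq : ‖q‖ < 1) :
    ∑' k, thetaTerm q 1 k = qPochInf q ∧
      pochTails q = -(qPochInf q * lambertSum q) - thetaDeriv q := by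
  have hP := qPochInf_ne_zero hq
  obtain ⟨g, hg, hg'⟩ := exists_tsum_thetaTerm_eq hq
  obtain ⟨l, hl, hl'⟩ := exists_eulerSeries_eq hq
  have hz := tendsto_eulerSeries_tails hq
  set Z : ℝ → ℂ := fun x => ∑' n : ℕ, (eulerSeries q (x * q ^ (n + 1)) - 1) * (x : ℂ) ^ n with hZ
  have hx1 : Tendsto (fun x : ℝ => 1 - (x : ℂ)) (𝓝[<] 1) (𝓝 0) := by
    have hc : Continuous fun x : ℝ => 1 - (x : ℂ) := by fun_prop
    have := hc.tendsto 1
    rw [Complex.ofReal_one, sub_self] at this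
    exact this.mono_left nhdsWithin_le_nhds
  set Θ := ∑' k, thetaTerm q 1 k with hΘ
  -- Both factors on the left are expanded to first order in `1 - x`. The constant terms give the
  -- first claim, the linear terms the second.
  have key : ∀ᶠ x : ℝ in 𝓝[<] 1, ((qPochInf q)⁻¹ - (1 - x) * l x) * (Θ - (1 - x) * g x)
      = 1 + (1 - x) * Z x := by
    filter_upwards [Ioo_mem_nhdsLT (show (0 : ℝ) < 1 by norm_num)] with x hx
    rw [← hl' x hx.1 hx.2, ← hg' x hx.1 hx.2]
    refine eulerSeries_mul_tsum_thetaTerm hq ?_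
    rw [Complex.norm_real, Real.norm_of_nonneg hx.1.le]
    exact hx.2
  have h1 : Θ = qPochInf q := by
    have e1 := (tendsto_const_nhds (x := (qPochInf q)⁻¹)).sub (hx1.mul hl)
    have e2 := (tendsto_const_nhds (x := Θ)).sub (hx1.mul hg)
    have e3 := (tendsto_const_nhds (x := (1 : ℂ))).add (hx1.mul hz)
    have := tendsto_nhds_unique ((e1.mul e2).congr' key) e3
    simp only [zero_mul, sub_zero, add_zero] at this
    field_simp at this
    exact this
  refine ⟨h1, ?_⟩
  have key2 : ∀ᶠ x : ℝ in 𝓝[<] 1,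
      -(qPochInf q)⁻¹ * g x - l x * Θ + (1 - x) * (l x * g x) = Z x := by
    filter_upwards [key, self_mem_nhdsWithin] with x hx hx'
    have h2 : (1 : ℂ) - x ≠ 0 := by
      rw [sub_ne_zero]
      intro h
      exact (ne_of_lt hx') (by exact_mod_cast h.symm)
    have h3 : (qPochInf q)⁻¹ * Θ = 1 := by rw [h1, inv_mul_cancel₀ hP]
    refine mul_left_cancel₀ h2 ?_
    linear_combination hx - h3
  have e := ((hg.const_mul (-(qPochInf q)⁻¹)).sub (hl.mul_const Θ)).add (hx1.mul (hl.mul hg))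
  have := tendsto_nhds_unique (e.congr' key2) hz
  rw [h1] at this
  field_simp at this
  linear_combination -this

end PartialTheta

/-! ### A double series for the period function of the Lambert series -/

section TrapezoidSeries

/-- The error of the trapezoidal rule for `∫ dw / w` over `[z, z + 1]`. -/
noncomputable def trapErr (z : ℂ) : ℂ :=
  Complex.log (z + 1) - Complex.log z - (1 / z + 1 / (z + 1)) / 2

/-- The double series `∑_{n ≥ 1, k ≥ 0} trapErr (n z + k)`, holomorphic on the slit plane. It equals
`∑_{n ≥ 1} (ψ(nz) - log(nz) + 1 / (2nz))` with the digamma function `ψ`. -/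
noncomputable def trapSeries (z : ℂ) : ℂ :=
  ∑' p : ℕ × ℕ, trapErr ((p.1 + 1 : ℕ) * z + (p.2 : ℕ))

lemma add_nonneg_mem_slitPlane {z : ℂ} (hz : z ∈ Complex.slitPlane) {s : ℝ} (hs : 0 ≤ s) :
    z + s ∈ Complex.slitPlane := by
  rw [Complex.mem_slitPlane_iff] at hz ⊢
  simp only [Complex.add_re, Complex.ofReal_re, Complex.add_im, Complex.ofReal_im, add_zero]
  rcases hz with h | h
  · left; linarith
  · exact Or.inr h

lemma pos_mul_mem_slitPlane {z : ℂ} (hz : z ∈ Complex.slitPlane) {s : ℝ} (hs : 0 < s) :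
    (s : ℂ) * z ∈ Complex.slitPlane := by
  rw [Complex.mem_slitPlane_iff] at hz ⊢
  rw [Complex.re_ofReal_mul, Complex.im_ofReal_mul]
  rcases hz with h | h
  · left; positivity
  · right; exact mul_ne_zero hs.ne' h

lemma natCast_mul_add_mem_slitPlane {z : ℂ} (hz : z ∈ Complex.slitPlane) (n k : ℕ) :
    ((n + 1 : ℕ) : ℂ) * z + (k : ℕ) ∈ Complex.slitPlane := by
  have h1 := pos_mul_mem_slitPlane hz (s := (n + 1 : ℕ)) (by positivity)
  have h2 := add_nonneg_mem_slitPlane h1 (s := (k : ℕ)) (by positivity)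
  simpa using h2

/-- The usual error bound of the trapezoidal rule, of the size of the second derivative of `1 / w`.
-/
lemma norm_trapErr_le {z : ℂ} (hz : z ∈ Complex.slitPlane) {R : ℝ} (hR : 0 < R)
    (h : ∀ s : ℝ, 0 ≤ s → s ≤ 1 → R ≤ ‖z + s‖) : ‖trapErr z‖ ≤ (R ^ 3)⁻¹ := by
  set f : ℝ → ℂ := fun s =>
    Complex.log (z + s) - Complex.log z - (s / 2) * (1 / z + 1 / (z + s)) with hf
  have hz0 : z ≠ 0 := Complex.slitPlane_ne_zero hz
  have hRz : R ≤ ‖z‖ := by simpa using h 0 le_rfl zero_le_one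
  -- `f` interpolates between `0` and `trapErr z`, and the first-order terms of its derivative
  -- cancel.
  have hd : ∀ s ∈ Set.Icc (0 : ℝ) 1, HasDerivWithinAt f
      (-(s ^ 2 / 2 : ℝ) * (z * (z + s) ^ 2)⁻¹) (Set.Icc (0 : ℝ) 1) s := by
    intro s hs
    have hzs := add_nonneg_mem_slitPlane hz hs.1
    have hzs0 : z + s ≠ 0 := Complex.slitPlane_ne_zero hzs
    have h0 : HasDerivAt (fun s : ℝ => (s : ℂ)) 1 s := Complex.ofRealCLM.hasDerivAt
    have h1 : HasDerivAt (fun s : ℝ => z + s) 1 s := h0.const_add z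
    have h2 := h1.clog_real hzs
    have h3 := h1.fun_inv hzs0
    have h4 := (h2.sub_const (Complex.log z)).sub ((h0.div_const 2).mul (h3.const_add (1 / z)))
    refine (h4.congr_deriv ?_).hasDerivWithinAt.congr_of_mem (fun x _ => ?_) hs
    · push_cast
      field_simp
      ring
    · simp [hf]
  have hb : ∀ s ∈ Set.Ico (0 : ℝ) 1,
      ‖-((s ^ 2 / 2 : ℝ) : ℂ) * (z * (z + s) ^ 2)⁻¹‖ ≤ (R ^ 3)⁻¹ := by
    intro s hs
    rw [norm_mul, norm_neg, Complex.norm_real, norm_inv, norm_mul, norm_pow,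
      Real.norm_of_nonneg (by positivity)]
    have h1 := h s hs.1 hs.2.le
    have h2 : R ^ 3 ≤ ‖z‖ * ‖z + s‖ ^ 2 := by
      calc R ^ 3 = R * R ^ 2 := by ring
        _ ≤ _ := by gcongr
    have h3 : s ^ 2 / 2 ≤ 1 := by nlinarith [hs.1, hs.2]
    calc s ^ 2 / 2 * (‖z‖ * ‖z + s‖ ^ 2)⁻¹ ≤ 1 * (R ^ 3)⁻¹ := by
          gcongr
      _ = _ := one_mul _
  have := norm_image_sub_le_of_norm_deriv_le_segment_01' hd hb
  simp only [hf, Complex.ofReal_one, Complex.ofReal_zero, add_zero, sub_self, zero_div,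
    zero_mul, sub_zero] at this
  convert! this using 2
  rw [trapErr]
  ring

lemma summable_rpow_three_halves : Summable fun n : ℕ => (((n + 1 : ℕ) : ℝ) ^ (3 / 2 : ℝ))⁻¹ :=
  (summable_nat_add_iff (f := fun n : ℕ => ((n : ℝ) ^ (3 / 2 : ℝ))⁻¹) 1).2
    (Real.summable_nat_rpow_inv.2 (by norm_num))

/-- The summable bound for the double series. -/
noncomputable def trapBound (p : ℕ × ℕ) : ℝ :=
  (((p.1 + 1 : ℕ) : ℝ) ^ (3 / 2 : ℝ))⁻¹ * (((p.2 + 1 : ℕ) : ℝ) ^ (3 / 2 : ℝ))⁻¹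

lemma summable_trapBound : Summable trapBound := by
  have h0 : 0 ≤ fun n : ℕ => (((n + 1 : ℕ) : ℝ) ^ (3 / 2 : ℝ))⁻¹ := fun n => by positivity
  have h := summable_rpow_three_halves.mul_of_nonneg summable_rpow_three_halves h0 h0
  exact h.congr fun p => rfl

lemma inv_pow_three_le_trapBound {y : ℝ} (hy : 1 ≤ y) (p : ℕ × ℕ) :
    (((p.1 + 1 : ℕ) * y + (p.2 : ℕ)) ^ 3)⁻¹ ≤ y⁻¹ * trapBound p := by
  set A : ℝ := (p.1 + 1 : ℕ) * y + (p.2 : ℕ)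
  have hp1 : (1 : ℝ) ≤ ((p.1 + 1 : ℕ) : ℝ) := by exact_mod_cast Nat.succ_le_succ (Nat.zero_le _)
  have hp2 : (0 : ℝ) ≤ (p.2 : ℝ) := Nat.cast_nonneg _
  have h1 : ((p.1 + 1 : ℕ) : ℝ) * y ≤ A := by simp only [A]; linarith
  have h2 : ((p.2 + 1 : ℕ) : ℝ) ≤ A := by
    simp only [A]
    push_cast at hp1 ⊢
    nlinarith
  have hA : 0 < A := lt_of_lt_of_le (by positivity) h2
  -- The three powers of `A` are shared evenly between the two summation variables.
  have h3 : A ^ 3 = A ^ (3 / 2 : ℝ) * A ^ (3 / 2 : ℝ) := by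
    rw [← Real.rpow_add hA, ← Real.rpow_natCast]
    norm_num
  have h4 : y * (((p.1 + 1 : ℕ) : ℝ) ^ (3 / 2 : ℝ)) ≤ A ^ (3 / 2 : ℝ) := by
    calc y * (((p.1 + 1 : ℕ) : ℝ) ^ (3 / 2 : ℝ))
        ≤ y ^ (3 / 2 : ℝ) * (((p.1 + 1 : ℕ) : ℝ) ^ (3 / 2 : ℝ)) := by
          gcongr
          exact Real.self_le_rpow_of_one_le hy (by norm_num)
      _ = (((p.1 + 1 : ℕ) : ℝ) * y) ^ (3 / 2 : ℝ) := by
          rw [Real.mul_rpow (by positivity) (by positivity), mul_comm]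
      _ ≤ _ := by gcongr
  have h5 : ((p.2 + 1 : ℕ) : ℝ) ^ (3 / 2 : ℝ) ≤ A ^ (3 / 2 : ℝ) := by gcongr
  rw [trapBound, ← mul_inv, ← mul_inv, h3]
  refine inv_anti₀ (by positivity) ?_
  rw [← mul_assoc]
  gcongr

/-- `δ` is a lower bound for `‖a z + b‖ / (a + b)` over nonnegative `a` and `b`. -/
def IsSectorBound (δ : ℝ) (z : ℂ) : Prop := ∀ a b : ℝ, 0 ≤ a → 0 ≤ b → δ * (a + b) ≤ ‖a * z + b‖

lemma exists_isSectorBound {K : Set ℂ} (hK : IsCompact K) (hKs : K ⊆ Complex.slitPlane) :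
    ∃ δ : ℝ, 0 < δ ∧ ∀ z ∈ K, IsSectorBound δ z := by
  rcases K.eq_empty_or_nonempty with rfl | hne
  · exact ⟨1, one_pos, by simp⟩
  -- By homogeneity it suffices to consider `a + b = 1`, a compact set of parameters on which
  -- `a z + b` does not vanish.
  have hc : ContinuousOn (fun p : ℂ × ℝ => ‖(p.2 : ℂ) * p.1 + (1 - p.2 : ℝ)‖)
      (K ×ˢ Set.Icc (0 : ℝ) 1) :=
    Continuous.continuousOn (by fun_prop)
  obtain ⟨p, hp, hmin⟩ := (hK.prod isCompact_Icc).exists_isMinOn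
    (hne.prod (Set.nonempty_Icc.2 zero_le_one)) hc
  have hpos : 0 < ‖(p.2 : ℂ) * p.1 + (1 - p.2 : ℝ)‖ := by
    rw [norm_pos_iff]
    rcases hp.2.1.eq_or_lt with h | h
    · simp [← h]
    · exact Complex.slitPlane_ne_zero (add_nonneg_mem_slitPlane
        (pos_mul_mem_slitPlane (hKs hp.1) h) (by linarith [hp.2.2]))
  refine ⟨_, hpos, fun z hz a b ha hb => ?_⟩
  rcases (add_nonneg ha hb).eq_or_lt with h | h
  · rw [← h, mul_zero]
    exact norm_nonneg _
  · have h1 := hmin (show (z, a / (a + b)) ∈ K ×ˢ Set.Icc (0 : ℝ) 1 from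
      ⟨hz, by positivity, (div_le_one h).2 (by linarith)⟩)
    simp only [Set.mem_ofPred_eq] at h1
    have h2 : (a : ℂ) * z + b
        = ((a + b : ℝ) : ℂ) * (((a / (a + b) : ℝ) : ℂ) * z + (1 - a / (a + b) : ℝ)) := by
      have : ((a : ℂ) + b) ≠ 0 := by exact_mod_cast h.ne'
      push_cast
      field_simp
      ring
    rw [h2, norm_mul, Complex.norm_real, Real.norm_of_nonneg h.le, mul_comm]
    gcongr

lemma norm_trapErr_mul_add_le {δ : ℝ} (hδ : 0 < δ) {z : ℂ} (hz : z ∈ Complex.slitPlane)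
    (hd : IsSectorBound δ z) {y : ℝ} (hy : 1 ≤ y) (p : ℕ × ℕ) :
    ‖trapErr ((p.1 + 1 : ℕ) * (y * z) + (p.2 : ℕ))‖ ≤ y⁻¹ * ((δ ^ 3)⁻¹ * trapBound p) := by
  have hA : 0 < ((p.1 + 1 : ℕ) * y + (p.2 : ℕ) : ℝ) := by positivity
  have h1 := norm_trapErr_le (R := δ * ((p.1 + 1 : ℕ) * y + (p.2 : ℕ)))
    (natCast_mul_add_mem_slitPlane (pos_mul_mem_slitPlane hz (by linarith)) p.1 p.2)
    (by positivity) fun s hs0 _ => ?_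
  · refine h1.trans ?_
    rw [mul_pow, mul_inv, mul_left_comm]
    gcongr
    exact inv_pow_three_le_trapBound hy p
  · have h2 := hd ((p.1 + 1 : ℕ) * y) ((p.2 : ℕ) + s) (by positivity) (by positivity)
    refine le_trans ?_ (h2.trans_eq ?_)
    · gcongr
      linarith
    · push_cast
      ring_nf

lemma norm_trapErr_le_trapBound {δ : ℝ} (hδ : 0 < δ) {z : ℂ} (hz : z ∈ Complex.slitPlane)
    (hd : IsSectorBound δ z) (p : ℕ × ℕ) :
    ‖trapErr ((p.1 + 1 : ℕ) * z + (p.2 : ℕ))‖ ≤ (δ ^ 3)⁻¹ * trapBound p := by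
  simpa using norm_trapErr_mul_add_le hδ hz hd le_rfl p

lemma summable_trapErr {z : ℂ} (hz : z ∈ Complex.slitPlane) :
    Summable fun p : ℕ × ℕ => trapErr ((p.1 + 1 : ℕ) * z + (p.2 : ℕ)) := by
  obtain ⟨δ, hδ, hd⟩ := exists_isSectorBound (isCompact_singleton (x := z)) (by simpa using hz)
  exact Summable.of_norm_bounded (summable_trapBound.mul_left _)
    (norm_trapErr_le_trapBound hδ hz (hd z rfl))

lemma differentiableAt_trapErr {z : ℂ} (hz : z ∈ Complex.slitPlane) :
    DifferentiableAt ℂ trapErr z := by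
  have h1 : z + 1 ∈ Complex.slitPlane := by
    simpa using add_nonneg_mem_slitPlane hz (s := 1) zero_le_one
  have h2 := Complex.slitPlane_ne_zero hz
  have h3 := Complex.slitPlane_ne_zero h1
  unfold trapErr
  fun_prop (disch := assumption)

lemma differentiableOn_trapSeries : DifferentiableOn ℂ trapSeries Complex.slitPlane := by
  intro z hz
  obtain ⟨r, hr, hrs⟩ := Metric.isOpen_iff.1 Complex.isOpen_slitPlane z hz
  have hsub : Metric.closedBall z (r / 2) ⊆ Complex.slitPlane :=
    (Metric.closedBall_subset_ball (by linarith)).trans hrs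
  obtain ⟨δ, hδ, hd⟩ := exists_isSectorBound (isCompact_closedBall z (r / 2)) hsub
  have hb : Metric.ball z (r / 2) ⊆ Metric.closedBall z (r / 2) := Metric.ball_subset_closedBall
  have h := Complex.differentiableOn_tsum_of_summable_norm
    (F := fun (p : ℕ × ℕ) z => trapErr ((p.1 + 1 : ℕ) * z + (p.2 : ℕ)))
    (summable_trapBound.mul_left (δ ^ 3)⁻¹)
    (U := Metric.ball z (r / 2)) (fun p w hw => ?_) Metric.isOpen_ball
    (fun p w hw => norm_trapErr_le_trapBound hδ (hsub (hb hw)) (hd w (hb hw)) p)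
  · exact (h.differentiableAt (Metric.ball_mem_nhds z (by linarith))).differentiableWithinAt
  · have h1 := differentiableAt_trapErr (natCast_mul_add_mem_slitPlane (hsub (hb hw)) p.1 p.2)
    have h2 : DifferentiableAt ℂ (fun w : ℂ => ((p.1 + 1 : ℕ) : ℂ) * w + (p.2 : ℕ)) w := by fun_prop
    exact (h1.comp w h2).differentiableWithinAt

lemma sum_trapErr (z : ℂ) (N : ℕ) : ∑ k ∈ Finset.range N, trapErr (z + (k : ℕ))
    = Complex.log (z + N) - Complex.log z
      - ∑ k ∈ Finset.range N, (1 / (z + k) + 1 / (z + (k + 1))) / 2 := by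
  induction N with
  | zero => simp
  | succ N ih =>
    rw [Finset.sum_range_succ, ih, Finset.sum_range_succ, trapErr]
    push_cast
    ring_nf

lemma log_neg_of_im_pos {z : ℂ} (hz : 0 < z.im) :
    Complex.log (-z) = Complex.log z - Real.pi * Complex.I := by
  rw [Complex.log, Complex.log, norm_neg, Complex.arg_neg_eq_arg_sub_pi_of_im_pos hz]
  push_cast
  ring

/-- The logarithms that telescope in the trapezoidal sums cancel in the limit. -/
lemma tendsto_log_add_sub_log (z : ℂ) :
    Tendsto (fun N : ℕ => Complex.log (z + N) - Complex.log N) atTop (𝓝 0) := by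
  have h1 : Tendsto (fun N : ℕ => 1 + z * ((N : ℂ))⁻¹) atTop (𝓝 1) := by
    have : Tendsto (fun N : ℕ => ((N : ℂ))⁻¹) atTop (𝓝 0) :=
      tendsto_inv₀_cobounded.comp tendsto_natCast_atTop_cobounded
    simpa using (this.const_mul z).const_add 1
  have h2 := (continuousAt_clog (x := 1) (by simp)).tendsto.comp h1
  rw [Complex.log_one] at h2
  refine h2.congr' ?_
  filter_upwards [eventually_gt_atTop 0, h1.eventually_ne one_ne_zero] with N hN hN1
  have h3 : (N : ℂ) ≠ 0 := by exact_mod_cast hN.ne'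
  have h4 : z + N = ((N : ℝ) : ℂ) * (1 + z * ((N : ℂ))⁻¹) := by
    push_cast
    field_simp
    ring
  rw [h4, Complex.log_ofReal_mul (by exact_mod_cast hN) hN1, Function.comp_apply,
    ← Complex.natCast_log, Complex.ofReal_log (by positivity)]
  push_cast
  ring

/-- Reflection: over the two half-lines the trapezoidal sums combine to the partial fraction
expansion of the cotangent, and the logarithms contribute its constant `-πi`. -/
lemma tsum_trapErr_sub {z : ℂ} (hz : 0 < z.im)
    (hs : Summable fun k : ℕ => trapErr (z + k) - trapErr (-z + k)) :
    ∑' k : ℕ, (trapErr (z + k) - trapErr (-z + k))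
      = 2 * Real.pi * Complex.I * (expTwoPiI z / (1 - expTwoPiI z)) := by
  have hint : z ∈ Complex.integerComplement := by
    rintro ⟨m, rfl⟩
    simp at hz
  have hcot := tendsto_logDeriv_euler_cot_sub hint
  have hpart : ∀ N : ℕ, ∑ k ∈ Finset.range N, (trapErr (z + k) - trapErr (-z + k))
      = (Complex.log (z + N) - Complex.log N) - (Complex.log (-z + N) - Complex.log N)
        - Real.pi * Complex.I
        - (1 / z + ∑ j ∈ Finset.range N, cotTerm z j - (1 / (z - N) + 1 / (z + N)) / 2) := by
    intro N
    rw [Finset.sum_sub_distrib, sum_trapErr, sum_trapErr, log_neg_of_im_pos hz]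
    -- The trapezoidal weights halve the end terms; the term `1 / z` appears in both sums and is
    -- restored to its full weight.
    have : ∀ N : ℕ, ∑ k ∈ Finset.range N, (1 / (z + k) + 1 / (z + (k + 1))) / 2
        - ∑ k ∈ Finset.range N, (1 / (-z + k) + 1 / (-z + (k + 1))) / 2
        = 1 / z + ∑ j ∈ Finset.range N, cotTerm z j - (1 / (z - N) + 1 / (z + N)) / 2 := by
      intro N
      induction N with
      | zero => simp
      | succ N ih =>
        rw [Finset.sum_range_succ, Finset.sum_range_succ, Finset.sum_range_succ _ N, cotTerm]
        have e : ∀ w : ℂ, 1 / (-z + w) = -(1 / (z - w)) := fun w => by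
          rw [← one_div_neg_eq_neg_one_div]; ring_nf
        rw [e, e]
        push_cast
        linear_combination ih
    linear_combination -this N
  have hinv : ∀ w : ℂ, Tendsto (fun N : ℕ => 1 / (w + N)) atTop (𝓝 0) := fun w => by
    simp only [one_div]
    refine tendsto_inv₀_cobounded.comp ?_
    exact (tendsto_const_add_cobounded w).comp tendsto_natCast_atTop_cobounded
  have hlim := (((tendsto_log_add_sub_log z).sub (tendsto_log_add_sub_log (-z))).sub_const
    (Real.pi * Complex.I)).sub ((hcot.const_add (1 / z)).sub
      ((((hinv (-z)).neg).add (hinv z)).div_const 2))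
  have hq := pi_mul_cot_pi_q_exp ⟨z, hz⟩
  have hlt : ‖Complex.exp (2 * Real.pi * Complex.I * z)‖ < 1 :=
    UpperHalfPlane.norm_exp_two_pi_I_lt_one ⟨z, hz⟩
  rw [UpperHalfPlane.coe_mk, tsum_geometric_of_norm_lt_one hlt] at hq
  have h1 := hs.hasSum.tendsto_sum_nat
  rw [tendsto_nhds_unique h1 (hlim.congr fun N => ?_), hq, expTwoPiI]
  · have := one_sub_ne_zero_of_norm_lt_one hlt
    generalize Complex.exp (2 * Real.pi * Complex.I * z) = E at *
    field_simp
    ring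
  · rw [hpart N]
    have e : ∀ w : ℂ, 1 / (-z + w) = -(1 / (z - w)) := fun w => by
      rw [← one_div_neg_eq_neg_one_div]; ring_nf
    rw [e]
    ring

lemma norm_expTwoPiI_lt_one {z : ℂ} (hz : 0 < z.im) : ‖expTwoPiI z‖ < 1 :=
  UpperHalfPlane.norm_exp_two_pi_I_lt_one ⟨z, hz⟩

lemma neg_mem_slitPlane_of_im_pos {z : ℂ} (hz : 0 < z.im) : -z ∈ Complex.slitPlane := by
  rw [Complex.mem_slitPlane_iff]
  right
  simpa using hz.ne'

lemma mem_slitPlane_of_im_pos {z : ℂ} (hz : 0 < z.im) : z ∈ Complex.slitPlane :=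
  Complex.mem_slitPlane_iff.2 (Or.inr hz.ne')

/-- The Lambert series is the jump of the double series across the half-planes. -/
lemma trapSeries_sub_trapSeries_neg {z : ℂ} (hz : 0 < z.im) :
    trapSeries z - trapSeries (-z) = 2 * Real.pi * Complex.I * lambertSum (expTwoPiI z) := by
  have h1 := summable_trapErr (mem_slitPlane_of_im_pos hz)
  have h2 := summable_trapErr (neg_mem_slitPlane_of_im_pos hz)
  have h3 := h1.sub h2
  rw [trapSeries, trapSeries, ← h1.tsum_sub h2, h3.tsum_prod, lambertSum, ← tsum_mul_left]
  refine tsum_congr fun n => ?_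
  have hn : 0 < (((n + 1 : ℕ) : ℂ) * z).im := by
    rw [← Complex.ofReal_natCast, Complex.im_ofReal_mul]
    positivity
  have h4 := tsum_trapErr_sub hn ?_
  · simp only [mul_neg]
    rw [h4]
    have : expTwoPiI (((n + 1 : ℕ) : ℂ) * z) = expTwoPiI z ^ (n + 1) := by
      rw [expTwoPiI, expTwoPiI, ← Complex.exp_nat_mul]
      ring_nf
    rw [this]
  · have := h3.prod_factor n
    simpa only [mul_neg] using this

end TrapezoidSeries

/-! ### Guinand's functional equation -/

section Guinand

/-- The restriction of `trapErr` to the positive real axis. -/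
noncomputable def realTrapErr (w : ℝ) : ℝ :=
  Real.log (w + 1) - Real.log w - (1 / w + 1 / (w + 1)) / 2

lemma trapErr_ofReal {w : ℝ} (hw : 0 < w) : trapErr w = realTrapErr w := by
  rw [trapErr, realTrapErr]
  have : (w : ℂ) + 1 = ((w + 1 : ℝ) : ℂ) := by push_cast; ring
  rw [this, ← Complex.ofReal_log hw.le, ← Complex.ofReal_log (by positivity)]
  push_cast
  ring

lemma abs_realTrapErr_le {w : ℝ} (hw : 0 < w) : |realTrapErr w| ≤ (w ^ 3)⁻¹ := by
  have h := norm_trapErr_le (z := w) (Complex.ofReal_mem_slitPlane.2 hw) hw fun s hs _ => ?_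
  · rwa [trapErr_ofReal hw, Complex.norm_real] at h
  · rw [← Complex.ofReal_add, Complex.norm_real, Real.norm_of_nonneg (by positivity)]
    linarith

/-- `∑_{n=1}^{N} 1 / (n + a)`. -/
noncomputable def shiftInv (N : ℕ) (a : ℝ) : ℝ := ∑ n ∈ Finset.range N, 1 / (a + (n + 1))

/-- `∑_{n=1}^{N} log (n + a)`. -/
noncomputable def shiftLog (N : ℕ) (a : ℝ) : ℝ := ∑ n ∈ Finset.range N, Real.log (a + (n + 1))

lemma sum_realTrapErr (y : ℝ) (N : ℕ) : ∑ k ∈ Finset.range N, realTrapErr (y + k)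
    = Real.log (y + N) - Real.log y - shiftInv N y - (1 / y - 1 / (y + N)) / 2 := by
  rw [shiftInv]
  induction N with
  | zero => simp
  | succ N ih =>
    rw [Finset.sum_range_succ, ih, Finset.sum_range_succ, realTrapErr]
    push_cast
    ring_nf

lemma tendsto_natCast_mul_inv_sq (c C : ℝ) :
    Tendsto (fun N : ℕ => (N : ℝ) * (C * ((c * N) ^ 2)⁻¹)) atTop (𝓝 0) := by
  have h : Tendsto (fun N : ℕ => C * (c ^ 2)⁻¹ * ((N : ℝ))⁻¹) atTop (𝓝 0) := by
    simpa using (tendsto_inv_atTop_zero.comp tendsto_natCast_atTop_atTop).const_mul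
      (C * (c ^ 2)⁻¹)
  refine h.congr' ?_
  filter_upwards [eventually_gt_atTop 0] with N hN
  have : (N : ℝ) ≠ 0 := by exact_mod_cast hN.ne'
  field_simp

/-- A sum of `N` terms of size `O(1 / (c N) ^ 2)` tends to zero. -/
lemma tendsto_sum_zero {c C : ℝ} (hc : 0 < c) {e : ℝ → ℝ}
    (he : ∀ w, 1 ≤ w → |e w| ≤ C * (w ^ 2)⁻¹) :
    Tendsto (fun N : ℕ => ∑ n ∈ Finset.range N, e (c * N + n)) atTop (𝓝 0) := by
  refine squeeze_zero_norm' ?_ (tendsto_natCast_mul_inv_sq c C)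
  have h1 : Tendsto (fun N : ℕ => c * (N : ℝ)) atTop atTop :=
    tendsto_natCast_atTop_atTop.const_mul_atTop hc
  have hC : 0 ≤ C := by
    have := (abs_nonneg _).trans (he 1 le_rfl)
    simpa using this
  filter_upwards [h1.eventually_ge_atTop 1] with N hN
  refine (norm_sum_le _ _).trans ?_
  refine (Finset.sum_le_card_nsmul _ _ (C * ((c * N) ^ 2)⁻¹) fun n _ => ?_).trans_eq (by simp)
  have hn : (0 : ℝ) ≤ n := Nat.cast_nonneg n
  refine (he _ (by linarith)).trans ?_
  gcongr
  linarith

lemma abs_realTrapErr_le_inv_sq {w : ℝ} (hw : 1 ≤ w) : |realTrapErr w| ≤ 1 * (w ^ 2)⁻¹ := by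
  refine (abs_realTrapErr_le (by linarith)).trans ?_
  rw [one_mul]
  gcongr
  norm_num

/-- The Riemann sum of `∫ dw / w` over `[cN, (1 + c) N]`. -/
lemma tendsto_shiftInv {c : ℝ} (hc : 0 < c) :
    Tendsto (fun N : ℕ => shiftInv N (c * N)) atTop (𝓝 (Real.log ((1 + c) / c))) := by
  have h1 := tendsto_sum_zero hc (e := realTrapErr) (C := 1) fun w hw =>
    abs_realTrapErr_le_inv_sq hw
  have hi : Tendsto (fun N : ℕ => ((N : ℝ))⁻¹) atTop (𝓝 0) :=
    tendsto_inv_atTop_zero.comp tendsto_natCast_atTop_atTop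
  have h2 := (h1.neg.const_add (Real.log ((1 + c) / c))).sub
    ((hi.const_mul (c⁻¹ - (1 + c)⁻¹)).div_const 2)
  simp only [neg_zero, add_zero, mul_zero, zero_div, sub_zero] at h2
  refine h2.congr' ?_
  filter_upwards [eventually_gt_atTop 0] with N hN
  have hN' : (0 : ℝ) < N := by exact_mod_cast hN
  rw [sum_realTrapErr]
  have e1 : c * N + N = (1 + c) * N := by ring
  rw [e1, Real.log_mul (by positivity) (by positivity),
    Real.log_mul (by positivity) (by positivity), Real.log_div (by positivity) (by positivity)]
  field_simp
  ring

/-- Stirling's formula for `∑_{n=1}^{N} log (cN + n)`. -/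
lemma tendsto_shiftLog {c : ℝ} (hc : 0 < c) :
    Tendsto (fun N : ℕ => shiftLog N (c * N) - N * Real.log N
      - N * ((1 + c) * Real.log (1 + c) - c * Real.log c - 1)) atTop
      (𝓝 (Real.log ((1 + c) / c) / 2)) := by
  have h1 := tendsto_sum_zero hc (C := 2)
    (e := fun w => 1 / (4 * w * (w + 1)) + (w + 1 / 2) * realTrapErr w) fun w hw => by
    have hw0 : 0 < w := by linarith
    have h2 := abs_realTrapErr_le hw0
    refine (abs_add_le _ _).trans ?_
    rw [abs_mul, abs_of_nonneg (by positivity : 0 ≤ 1 / (4 * w * (w + 1))),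
      abs_of_nonneg (by positivity : 0 ≤ w + 1 / 2)]
    have h3 : 1 / (4 * w * (w + 1)) ≤ 1 / 4 * (w ^ 2)⁻¹ := by
      rw [one_div, one_div, ← mul_inv]
      refine inv_anti₀ (by positivity) ?_
      nlinarith
    have h4 : (w + 1 / 2) * |realTrapErr w| ≤ (w + w / 2) * (w ^ 3)⁻¹ := by gcongr
    have h5 : (w + w / 2) * (w ^ 3)⁻¹ = 3 / 2 * (w ^ 2)⁻¹ := by field_simp; ring
    have : 0 ≤ (w ^ 2)⁻¹ := by positivity
    linarith
  have h2 := h1.neg.const_add (Real.log ((1 + c) / c) / 2)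
  rw [neg_zero, add_zero] at h2
  refine h2.congr' ?_
  filter_upwards [eventually_gt_atTop 0] with N hN
  have hN' : (0 : ℝ) < N := by exact_mod_cast hN
  -- Up to an error `O(w⁻²)`, `log (w + 1)` is the increment of `F` at `w`, so that the sum
  -- telescopes.
  set F : ℝ → ℝ := fun w => w * Real.log w - w + Real.log w / 2 with hF
  have key : ∀ n : ℕ, 1 / (4 * (c * N + n) * ((c * N + n) + 1))
      + ((c * N + n) + 1 / 2) * realTrapErr (c * N + n)
      = F (c * N + (n + 1 : ℕ)) - F (c * N + n) - Real.log (c * N + (n + 1)) := by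
    intro n
    have hw : 0 < c * N + n := by positivity
    rw [realTrapErr, hF]
    push_cast
    rw [← add_assoc]
    generalize c * N + (n : ℝ) = w at hw
    field_simp
    ring
  rw [Finset.sum_congr rfl fun n _ => key n, Finset.sum_sub_distrib,
    Finset.sum_range_sub (fun n : ℕ => F (c * N + n)), ← shiftLog, hF]
  have e1 : c * N + N = (1 + c) * N := by ring
  simp only [Nat.cast_zero, add_zero]
  rw [e1, Real.log_mul (by positivity) (by positivity),
    Real.log_mul (by positivity) (by positivity), Real.log_div (by positivity) (by positivity)]
  ring

/-- Stirling's formula for `log N!`. -/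
lemma tendsto_shiftLog_zero :
    Tendsto (fun N : ℕ => shiftLog N 0 - N * Real.log N + N - Real.log N / 2) atTop
      (𝓝 (Real.log (2 * Real.pi) / 2)) := by
  have h1 := Stirling.tendsto_stirlingSeq_sqrt_pi
  have h2 := ((Real.continuousAt_log (by positivity)).tendsto.comp h1).add_const (Real.log 2 / 2)
  have e : Real.log (√Real.pi) + Real.log 2 / 2 = Real.log (2 * Real.pi) / 2 := by
    rw [Real.log_sqrt (by positivity), Real.log_mul (by norm_num) (by positivity)]
    ring
  rw [e] at h2
  refine h2.congr' ?_
  filter_upwards [eventually_gt_atTop 0] with N hN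
  have hN' : (0 : ℝ) < N := by exact_mod_cast hN
  have h3 : shiftLog N 0 = Real.log N.factorial := by
    rw [shiftLog, ← Finset.prod_range_add_one_eq_factorial, Nat.cast_prod, Real.log_prod]
    · simp
    · intro i _
      positivity
  rw [Function.comp_apply, Stirling.log_stirlingSeq_formula, h3, Real.log_div (by positivity)
    (by positivity), Real.log_exp, Real.log_mul (by norm_num) (by positivity)]
  ring

lemma tendsto_shiftInv_zero :
    Tendsto (fun N : ℕ => shiftInv N 0 - Real.log N) atTop (𝓝 Real.eulerMascheroniConstant) := by
  refine Real.tendsto_harmonic_sub_log.congr fun N => ?_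
  simp [shiftInv, harmonic]

/-- The double sum whose symmetry in `x ↦ 1 / x` is the source of the functional equation. -/
noncomputable def boxInv (N : ℕ) (x : ℝ) : ℝ :=
  ∑ n ∈ Finset.range N, shiftInv N ((n + 1) * x)

lemma boxInv_inv {x : ℝ} (hx : 0 < x) (N : ℕ) : boxInv N x⁻¹ = x * boxInv N x := by
  simp only [boxInv, shiftInv]
  rw [Finset.sum_comm, Finset.mul_sum]
  refine Finset.sum_congr rfl fun n _ => ?_
  rw [Finset.mul_sum]
  refine Finset.sum_congr rfl fun k _ => ?_
  field_simp
  ring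

/-- The sum of the trapezoidal errors over the box `n ≤ N`, `k < N` in terms of logarithms, harmonic
sums and the double sum `boxInv`. -/
lemma boxSum_eq {x : ℝ} (hx : 0 < x) (N : ℕ) :
    ∑ n ∈ Finset.range N, ∑ k ∈ Finset.range N, realTrapErr ((n + 1) * x + k)
      = shiftLog N (x⁻¹ * N) - shiftLog N 0 - boxInv N x
        - x⁻¹ * (shiftInv N 0 - shiftInv N (x⁻¹ * N)) / 2 := by
  have h1 : x⁻¹ * (shiftInv N 0 - shiftInv N (x⁻¹ * N)) / 2
      = ∑ n ∈ Finset.range N, (1 / ((n + 1) * x) - 1 / ((n + 1) * x + N)) / 2 := by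
    rw [shiftInv, shiftInv, ← Finset.sum_sub_distrib, Finset.mul_sum, Finset.sum_div]
    refine Finset.sum_congr rfl fun n _ => ?_
    have : (0 : ℝ) ≤ N := Nat.cast_nonneg N
    field_simp
    ring_nf
  simp only [sum_realTrapErr]
  rw [h1, boxInv, shiftLog, shiftLog, ← Finset.sum_sub_distrib, ← Finset.sum_sub_distrib,
    ← Finset.sum_sub_distrib]
  refine Finset.sum_congr rfl fun n _ => ?_
  have e1 : ((n : ℝ) + 1) * x + N = x * (x⁻¹ * N + (n + 1)) := by field_simp; ring
  rw [e1, Real.log_mul (by positivity) (by positivity), mul_comm _ x,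
    Real.log_mul (by positivity) (by positivity), zero_add]
  ring

lemma tendsto_boxSum {x : ℝ} (hx : 0 < x) :
    Tendsto (fun N : ℕ => ((∑ n ∈ Finset.range N, ∑ k ∈ Finset.range N,
      realTrapErr ((n + 1) * x + k) : ℝ) : ℂ)) atTop (𝓝 (trapSeries x)) := by
  have h := (summable_trapErr (Complex.ofReal_mem_slitPlane.2 hx)).hasSum
  have h2 : Tendsto (fun N : ℕ => Finset.range N ×ˢ Finset.range N) atTop atTop :=
    tendsto_finsetProd_atTop.comp
      ((tendsto_finset_range.prodMk tendsto_finset_range).mono_right prod_atTop_atTop_eq.le)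
  have h3 := h.comp h2
  refine h3.congr fun N => ?_
  rw [Function.comp_apply, Finset.sum_product]
  push_cast
  refine Finset.sum_congr rfl fun n _ => Finset.sum_congr rfl fun k _ => ?_
  rw [← trapErr_ofReal (by positivity)]
  push_cast
  rfl

/-- Guinand's functional equation on the positive real axis: in the combination of the box sums at
`x` and `1 / x` the divergent double sums `boxInv` cancel by symmetry, and Stirling's formula
evaluates the limit of what remains. -/
lemma trapSeries_ofReal_sub_inv {x : ℝ} (hx : 0 < x) :
    trapSeries x - trapSeries (x⁻¹ : ℝ) / x
      = (((Real.eulerMascheroniConstant - Real.log (2 * Real.pi) + Real.log x) / 2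
        - (Real.eulerMascheroniConstant - Real.log (2 * Real.pi) - Real.log x) / (2 * x) : ℝ) :
          ℂ) := by
  have hx' : 0 < x⁻¹ := inv_pos.2 hx
  have h1 := (tendsto_boxSum hx).sub ((tendsto_boxSum hx').div_const (x : ℂ))
  refine tendsto_nhds_unique h1 ?_
  have hA := (tendsto_shiftLog hx').sub (tendsto_shiftLog_zero)
  have hB := ((tendsto_shiftLog hx).sub (tendsto_shiftLog_zero)).const_mul x⁻¹
  have hC := (tendsto_shiftInv_zero.sub (tendsto_shiftInv hx')).const_mul (x⁻¹ / 2)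
  have hD := (tendsto_shiftInv_zero.sub (tendsto_shiftInv hx)).div_const 2
  have h2 := ((hA.sub hB).sub hC).add hD
  have e1 : (1 + x⁻¹) / x⁻¹ = 1 + x := by field_simp; ring
  have e2 : 1 + x⁻¹ = (1 + x) / x := by field_simp; ring
  rw [e1, Real.log_div (by positivity) (by positivity)] at h2
  have h3 : Tendsto (fun N : ℕ =>
      (∑ n ∈ Finset.range N, ∑ k ∈ Finset.range N, realTrapErr ((n + 1) * x + k))
      - (∑ n ∈ Finset.range N, ∑ k ∈ Finset.range N, realTrapErr ((n + 1) * x⁻¹ + k)) / x) atTop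
      (𝓝 ((Real.eulerMascheroniConstant - Real.log (2 * Real.pi) + Real.log x) / 2
        - (Real.eulerMascheroniConstant - Real.log (2 * Real.pi) - Real.log x) / (2 * x))) := by
    convert! h2 using 2 with N
    · rw [boxSum_eq hx, boxSum_eq hx', boxInv_inv hx, inv_inv, e2,
        Real.log_div (by positivity) (by positivity), Real.log_inv]
      field_simp
      ring
    · field_simp
      ring
  refine ((Complex.continuous_ofReal.tendsto _).comp h3).congr fun N => ?_
  rw [Function.comp_apply]
  push_cast
  ring

lemma inv_mem_slitPlane {z : ℂ} (hz : z ∈ Complex.slitPlane) : z⁻¹ ∈ Complex.slitPlane := by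
  rw [Complex.mem_slitPlane_iff_arg] at hz ⊢
  rw [Complex.arg_inv, if_neg hz.1]
  exact ⟨fun h => by linarith [Complex.neg_pi_lt_arg z], inv_ne_zero hz.2⟩

/-- The constant of Guinand's functional equation. -/
noncomputable def guinandConst : ℝ := Real.eulerMascheroniConstant - Real.log (2 * Real.pi)

/-- Guinand's functional equation relates `trapSeries z` and `trapSeries (1 / z) / z` for all `z` in
the slit plane, by analytic continuation from the positive real axis. -/
lemma trapSeries_sub_inv {z : ℂ} (hz : z ∈ Complex.slitPlane) :
    trapSeries z - trapSeries z⁻¹ / z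
      = (guinandConst + Complex.log z) / 2 - (guinandConst - Complex.log z) / (2 * z) := by
  have hopen := Complex.isOpen_slitPlane
  have h1 : DifferentiableOn ℂ (fun z => trapSeries z - trapSeries z⁻¹ / z) Complex.slitPlane := by
    refine differentiableOn_trapSeries.sub (DifferentiableOn.div ?_ differentiableOn_id
      fun z hz => Complex.slitPlane_ne_zero hz)
    refine differentiableOn_trapSeries.comp (t := Complex.slitPlane)
      (fun z hz => (differentiableAt_inv (Complex.slitPlane_ne_zero hz)).differentiableWithinAt) ?_
    exact fun z hz => inv_mem_slitPlane hz
  have h2 : DifferentiableOn ℂ (fun z => (guinandConst + Complex.log z) / 2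
      - (guinandConst - Complex.log z) / (2 * z)) Complex.slitPlane := by
    intro z hz
    have := Complex.slitPlane_ne_zero hz
    have h3 : 2 * z ≠ 0 := mul_ne_zero two_ne_zero this
    refine DifferentiableAt.differentiableWithinAt ?_
    fun_prop (disch := assumption)
  have hconn : IsPreconnected Complex.slitPlane :=
    (StarConvex.isPathConnected Complex.starConvex_one_slitPlane
      Complex.one_mem_slitPlane).isConnected.isPreconnected
  refine (h1.analyticOnNhd hopen).eqOn_of_preconnected_of_frequently_eq (h2.analyticOnNhd hopen)
    hconn Complex.one_mem_slitPlane ?_ hz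
  have h3 : Tendsto (fun x : ℝ => (x : ℂ)) (𝓝[>] 1) (𝓝[≠] 1) := by
    refine tendsto_nhdsWithin_iff.2 ⟨?_, ?_⟩
    · exact (Complex.continuous_ofReal.tendsto' 1 1 (by simp)).mono_left nhdsWithin_le_nhds
    · filter_upwards [self_mem_nhdsWithin] with x hx
      have : x ≠ 1 := ne_of_gt hx
      simpa using this
  refine h3.frequently (Eventually.frequently ?_)
  filter_upwards [self_mem_nhdsWithin] with x hx
  have hx0 : 0 < x := lt_trans one_pos hx
  have h4 := trapSeries_ofReal_sub_inv hx0
  rw [Complex.ofReal_inv] at h4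
  rw [h4, guinandConst, ← Complex.ofReal_log hx0.le]
  push_cast
  ring

/-- The period function of the Lambert series, of weight `1` under inversion. It is holomorphic on
the slit plane because `trapSeries` is. -/
noncomputable def lambertPeriod (z : ℂ) : ℂ :=
  (2 * trapSeries z - guinandConst - Complex.log z + Real.pi * Complex.I / 2
    - Real.pi * Complex.I / (2 * z)) / (2 * Real.pi * Complex.I)

lemma differentiableOn_lambertPeriod : DifferentiableOn ℂ lambertPeriod Complex.slitPlane := by
  intro z hz
  have h0 := Complex.slitPlane_ne_zero hz
  have h1 : 2 * z ≠ 0 := mul_ne_zero two_ne_zero h0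
  have h2 : DifferentiableAt ℂ trapSeries z :=
    (differentiableOn_trapSeries z hz).differentiableAt (Complex.isOpen_slitPlane.mem_nhds hz)
  have h3 : (2 * Real.pi * Complex.I : ℂ) ≠ 0 := Complex.two_pi_I_ne_zero
  refine DifferentiableAt.differentiableWithinAt ?_
  unfold lambertPeriod
  fun_prop (disch := assumption)

lemma neg_inv_im_pos {z : ℂ} (hz : 0 < z.im) : 0 < (-z⁻¹).im := by
  rw [Complex.neg_im, Complex.inv_im]
  have : 0 < Complex.normSq z := Complex.normSq_pos.2 fun h => by simp [h] at hz
  rw [neg_div, neg_neg]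
  positivity

/-- The Lambert series is the difference of `trapSeries` at `z` and `-z`. Under inversion these two
values are exchanged with those at `-1 / z` and `1 / z`; Guinand's equation at `z` and at `-z` makes
`trapSeries z` appear twice and `trapSeries (-z)` disappear. -/
lemma lambertSum_sub_neg_inv {z : ℂ} (hz : 0 < z.im) :
    lambertSum (expTwoPiI z) - z⁻¹ * lambertSum (expTwoPiI (-z⁻¹)) = lambertPeriod z := by
  have h0 : z ≠ 0 := fun h => by simp [h] at hz
  have h1 := trapSeries_sub_trapSeries_neg hz
  have h2 := trapSeries_sub_trapSeries_neg (neg_inv_im_pos hz)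
  have h3 := trapSeries_sub_inv (mem_slitPlane_of_im_pos hz)
  have h4 := trapSeries_sub_inv (neg_mem_slitPlane_of_im_pos hz)
  rw [neg_neg] at h2
  rw [inv_neg, log_neg_of_im_pos hz] at h4
  have h5 : (2 * Real.pi * Complex.I : ℂ) ≠ 0 := Complex.two_pi_I_ne_zero
  rw [lambertPeriod, eq_div_iff h5]
  have e3 : trapSeries z⁻¹ / z = trapSeries z - ((guinandConst + Complex.log z) / 2
    - (guinandConst - Complex.log z) / (2 * z)) := by linear_combination -h3
  have e4 : trapSeries (-z⁻¹) / z = -trapSeries (-z) +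
    ((guinandConst + (Complex.log z - Real.pi * Complex.I)) / 2
    - (guinandConst - (Complex.log z - Real.pi * Complex.I)) / (2 * -z)) := by
    rw [div_neg] at h4
    linear_combination h4
  have e : (lambertSum (expTwoPiI z) - z⁻¹ * lambertSum (expTwoPiI (-z⁻¹)))
      * (2 * Real.pi * Complex.I)
      = (trapSeries z - trapSeries (-z)) - (trapSeries (-z⁻¹) / z - trapSeries z⁻¹ / z) := by
    rw [h1, ← sub_div, h2]
    field_simp
  rw [e, e3, e4]
  field_simp
  ring

/-- Behaviour of the Lambert series as `q → 1`, from the functional equation, in which the two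
values of `trapSeries` at the inverse arguments are small. -/
theorem lambertSum_isBigO : (fun t : ℝ => lambertSum (Real.exp (-t))
    - (((Real.eulerMascheroniConstant - Real.log t) / t : ℝ) : ℂ)) =O[𝓝[>] 0] fun _ => (1 : ℝ) := by
  obtain ⟨δ, hδ, hd⟩ := exists_isSectorBound (K := {Complex.I, -Complex.I})
    ((Set.finite_singleton _).insert _).isCompact (by
      rintro z (rfl | rfl) <;> simp [Complex.mem_slitPlane_iff])
  set C : ℝ := (δ ^ 3)⁻¹ * ∑' p, trapBound p with hC
  have hb : ∀ z ∈ ({Complex.I, -Complex.I} : Set ℂ), ∀ y : ℝ, 1 ≤ y →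
      ‖trapSeries (y * z)‖ ≤ y⁻¹ * C := by
    intro z hz y hy
    have hzs : z ∈ Complex.slitPlane := by
      rcases hz with rfl | rfl <;> simp [Complex.mem_slitPlane_iff]
    have h1 := norm_trapErr_mul_add_le hδ hzs (hd z hz) hy
    rw [hC, ← tsum_mul_left, ← tsum_mul_left]
    exact tsum_of_norm_bounded ((summable_trapBound.mul_left _).mul_left _).hasSum h1
  refine Asymptotics.IsBigO.of_bound (1 / 4 + C) ?_
  have h2pi : (0 : ℝ) < 2 * Real.pi := by positivity
  filter_upwards [Ioo_mem_nhdsGT h2pi] with t ht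
  -- The point with `expTwoPiI z = exp (-t)` is `z = it / 2π`, and `1 / z = -iy`.
  set y : ℝ := 2 * Real.pi / t with hy
  have ht0 : 0 < t := ht.1
  have hy1 : 1 ≤ y := by rw [hy, le_div_iff₀ ht0]; linarith [ht.2]
  have hy0 : 0 < y := by linarith
  set z : ℂ := (y⁻¹ : ℝ) * Complex.I with hz
  have hzim : 0 < z.im := by
    rw [hz, Complex.im_ofReal_mul, Complex.I_im, mul_one]
    positivity
  have hz0 : z ≠ 0 := fun h => by simp [h] at hzim
  have hq : expTwoPiI z = Real.exp (-t) := by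
    rw [expTwoPiI, hz, Complex.ofReal_exp]
    congr 1
    have e1 : y⁻¹ = t / (2 * Real.pi) := by rw [hy, inv_div]
    have e2 : ((2 * Real.pi : ℝ) : ℂ) ≠ 0 := by exact_mod_cast h2pi.ne'
    rw [e1]
    push_cast at e2 ⊢
    field_simp
    rw [Complex.I_sq, neg_one_mul]
  have hinv : z⁻¹ = y * -Complex.I := by
    rw [hz, mul_inv, Complex.inv_I]
    push_cast
    rw [inv_inv]
  have hlog : Complex.log z
      = (Real.log t - Real.log (2 * Real.pi) : ℝ) + Real.pi / 2 * Complex.I := by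
    rw [hz, Complex.log_ofReal_mul (by positivity) Complex.I_ne_zero, Complex.log_I, hy, inv_div,
      Real.log_div ht0.ne' h2pi.ne']
  have h1 := trapSeries_sub_trapSeries_neg hzim
  have h3 := trapSeries_sub_inv (mem_slitPlane_of_im_pos hzim)
  have h4 := trapSeries_sub_inv (neg_mem_slitPlane_of_im_pos hzim)
  rw [inv_neg, log_neg_of_im_pos hzim] at h4
  have h5 : lambertSum (expTwoPiI z) - (((Real.eulerMascheroniConstant - Real.log t) / t : ℝ) : ℂ)
      = 1 / 4 + (trapSeries z⁻¹ + trapSeries (-z⁻¹)) * z⁻¹ / (2 * Real.pi * Complex.I) := by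
    have hpi : (2 * Real.pi * Complex.I : ℂ) ≠ 0 := Complex.two_pi_I_ne_zero
    have htC : (t : ℂ) ≠ 0 := by exact_mod_cast ht0.ne'
    have e3 : trapSeries z⁻¹ * z⁻¹ = trapSeries z - ((guinandConst + Complex.log z) / 2
      - (guinandConst - Complex.log z) * z⁻¹ / 2) := by
      rw [← div_eq_mul_inv]
      linear_combination (exp := 1) -h3
    have e4 : trapSeries (-z⁻¹) * z⁻¹ = -trapSeries (-z) +
      ((guinandConst + (Complex.log z - Real.pi * Complex.I)) / 2
      + (guinandConst - (Complex.log z - Real.pi * Complex.I)) * z⁻¹ / 2) := by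
      rw [div_neg] at h4
      rw [← div_eq_mul_inv]
      linear_combination (exp := 1) h4
    have e5 : (guinandConst : ℂ) = (Real.eulerMascheroniConstant - Real.log t)
        + (Complex.log z - Real.pi / 2 * Complex.I) := by
      rw [hlog, guinandConst]
      push_cast
      ring
    have e6 : z⁻¹ = -(2 * Real.pi * Complex.I) / t := by
      rw [hinv, hy]
      push_cast
      ring
    have e7 : (trapSeries z⁻¹ + trapSeries (-z⁻¹)) * z⁻¹
        = (trapSeries z - trapSeries (-z)) - Real.pi * Complex.I / 2
          + (Real.eulerMascheroniConstant - Real.log t) * z⁻¹ := by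
      rw [add_mul, e3, e4, e5]
      ring
    rw [e7, h1, e6]
    push_cast
    have hI := Complex.I_ne_zero
    have hpi0 : (Real.pi : ℂ) ≠ 0 := by exact_mod_cast Real.pi_ne_zero
    field_simp
    ring
  rw [← hq, h5]
  have h6 := hb (-Complex.I) (by simp) y hy1
  have h7 := hb Complex.I (by simp) y hy1
  rw [← hinv] at h6
  have e : -z⁻¹ = y * Complex.I := by rw [hinv]; ring
  rw [← e] at h7
  have hyz : ‖z⁻¹‖ = y := by rw [hinv]; simp [abs_of_pos hy0]
  have h8 : ‖(2 * Real.pi * Complex.I : ℂ)‖ = 2 * Real.pi := by simp [abs_of_pos Real.pi_pos]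
  have h9 : ‖(trapSeries z⁻¹ + trapSeries (-z⁻¹)) * z⁻¹ / (2 * Real.pi * Complex.I)‖ ≤ C := by
    rw [norm_div, norm_mul, h8, hyz]
    have hC0 : 0 ≤ C := by
      have := (norm_nonneg _).trans h6
      exact (mul_nonneg_iff_of_pos_left (by positivity)).1 this
    rw [div_le_iff₀ h2pi]
    calc _ ≤ (y⁻¹ * C + y⁻¹ * C) * y := by
          gcongr
          exact (norm_add_le _ _).trans (add_le_add h6 h7)
      _ = C * 2 := by field_simp; ring
      _ ≤ C * (2 * Real.pi) := by
          gcongr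
          linarith [Real.pi_gt_three]
  refine (norm_add_le _ _).trans ?_
  rw [norm_one, mul_one]
  gcongr
  simp

end Guinand

/-! ### Asymptotic expansions as `q → 1` -/

section Asymptotics

lemma norm_ofReal_exp_neg (t : ℝ) : ‖((Real.exp (-t) : ℝ) : ℂ)‖ = Real.exp (-t) := by
  rw [Complex.norm_real, Real.norm_of_nonneg (Real.exp_pos _).le]

lemma norm_ofReal_exp_neg_lt_one {t : ℝ} (ht : 0 < t) : ‖((Real.exp (-t) : ℝ) : ℂ)‖ < 1 := by
  rw [norm_ofReal_exp_neg, Real.exp_lt_one_iff]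
  linarith

lemma norm_one_sub_exp_neg_pow {t : ℝ} (ht : 0 < t) (n : ℕ) :
    ‖1 - ((Real.exp (-t) : ℝ) : ℂ) ^ n‖ ≤ n * t ∧ ‖1 - ((Real.exp (-t) : ℝ) : ℂ) ^ n‖ ≤ 1 := by
  have h1 : (1 - ((Real.exp (-t) : ℝ) : ℂ) ^ n) = ((1 - Real.exp (-(n * t)) : ℝ) : ℂ) := by
    rw [← Complex.ofReal_pow, ← Real.exp_nat_mul]
    push_cast
    ring_nf
  have h2 : Real.exp (-(n * t)) ≤ 1 := Real.exp_le_one_iff.2 (by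
    have : 0 ≤ n * t := by positivity
    linarith)
  rw [h1, Complex.norm_real, Real.norm_of_nonneg (by linarith)]
  have := Real.add_one_le_exp (-(n * t))
  exact ⟨by linarith, by linarith [Real.exp_pos (-(n * t))]⟩

lemma norm_qPoch_exp_neg_add_le {t : ℝ} (ht : 0 < t) (m n : ℕ) :
    ‖qPoch (Real.exp (-t)) (m + n)‖ ≤ ‖qPoch (Real.exp (-t)) m‖ := by
  induction n with
  | zero => simp
  | succ n ih =>
    rw [← add_assoc, qPoch_succ, norm_mul]
    exact (mul_le_of_le_one_right (norm_nonneg _) (norm_one_sub_exp_neg_pow ht _).2).trans ih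

lemma norm_qPoch_exp_neg_le {t : ℝ} (ht : 0 < t) (n : ℕ) :
    ‖qPoch (Real.exp (-t)) n‖ ≤ n.factorial * t ^ n := by
  induction n with
  | zero => simp
  | succ n ih =>
    rw [qPoch_succ, norm_mul, Nat.factorial_succ]
    calc _ ≤ (n.factorial * t ^ n) * ((n + 1 : ℕ) * t) :=
          mul_le_mul ih (norm_one_sub_exp_neg_pow ht _).1 (norm_nonneg _) (by positivity)
      _ = _ := by push_cast; ring

/-- `(q)_∞` decays faster than any power of `t`, as all its factors have modulus at most `1` and the
first `n` of them are `O(t)`. -/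
lemma norm_qPochInf_exp_neg_le {t : ℝ} (ht : 0 < t) (n : ℕ) :
    ‖qPochInf (Real.exp (-t))‖ ≤ n.factorial * t ^ n := by
  refine le_of_tendsto (tendsto_qPoch (norm_ofReal_exp_neg_lt_one ht)).norm ?_
  filter_upwards [eventually_ge_atTop n] with k hk
  obtain ⟨j, rfl⟩ := Nat.exists_eq_add_of_le hk
  exact (norm_qPoch_exp_neg_add_le ht n j).trans (norm_qPoch_exp_neg_le ht n)

lemma half_le_one_sub_exp_neg {t : ℝ} (ht : 0 < t) (ht1 : t ≤ 1) : t / 2 ≤ 1 - Real.exp (-t) := by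
  have h := Real.abs_exp_sub_one_sub_id_le (x := -t) (by rw [abs_neg, abs_of_pos ht]; exact ht1)
  have h2 := Real.add_one_le_exp t
  have h3 : Real.exp (-t) * Real.exp t = 1 := by rw [← Real.exp_add]; simp
  have h4 := Real.exp_pos (-t)
  nlinarith [mul_le_mul_of_nonneg_left h2 h4.le]

lemma eventually_zero_lt_le_one : ∀ᶠ t : ℝ in 𝓝[>] 0, 0 < t ∧ t ≤ 1 := by
  filter_upwards [Ioo_mem_nhdsGT (show (0 : ℝ) < 1 by norm_num)] with t ht
  exact ⟨ht.1, ht.2.le⟩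

lemma isBigO_qPochInf (n : ℕ) :
    (fun t : ℝ => qPochInf (Real.exp (-t))) =O[𝓝[>] 0] fun t => t ^ n := by
  refine IsBigO.of_bound n.factorial ?_
  filter_upwards [eventually_zero_lt_le_one] with t ht
  rw [Real.norm_of_nonneg (pow_nonneg ht.1.le n)]
  exact norm_qPochInf_exp_neg_le ht.1 n

lemma isBigO_inv_one_sub :
    (fun t : ℝ => (1 - ((Real.exp (-t) : ℝ) : ℂ))⁻¹) =O[𝓝[>] 0] fun t => t⁻¹ := by
  refine IsBigO.of_bound 2 ?_
  filter_upwards [eventually_zero_lt_le_one] with t ht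
  have h := half_le_one_sub_exp_neg ht.1 ht.2
  rw [← Complex.ofReal_one, ← Complex.ofReal_sub, norm_inv, Complex.norm_real,
    Real.norm_of_nonneg (by linarith [ht.1]), norm_inv, Real.norm_of_nonneg ht.1.le]
  calc (1 - Real.exp (-t))⁻¹ ≤ (t / 2)⁻¹ := inv_anti₀ (by linarith [ht.1]) h
    _ = 2 * t⁻¹ := by rw [inv_div]; ring

/-- A crude bound for the Lambert series, sufficient where it is multiplied by `(q)_∞`. -/
lemma isBigO_lambertSum :
    (fun t : ℝ => lambertSum (Real.exp (-t))) =O[𝓝[>] 0] fun t => t⁻¹ ^ 2 := by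
  refine IsBigO.trans (IsBigO.of_bound 1 ?_) (isBigO_inv_one_sub.pow 2)
  filter_upwards [eventually_zero_lt_le_one] with t ht
  have h := norm_lambertSum_le (norm_ofReal_exp_neg_lt_one ht.1)
  have h1 := half_le_one_sub_exp_neg ht.1 ht.2
  rw [one_mul, norm_pow, ← Complex.ofReal_one, ← Complex.ofReal_sub, norm_inv, Complex.norm_real,
    Real.norm_of_nonneg (by linarith [ht.1])]
  rwa [norm_ofReal_exp_neg] at h

lemma isBigO_exp_sub (a : ℝ) :
    (fun t : ℝ => Complex.exp (a * t) - 1 - a * t) =O[𝓝[>] 0] fun t => t ^ 2 := by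
  refine IsBigO.of_bound (|a| ^ 2) ?_
  have h0 : ∀ᶠ t : ℝ in 𝓝[>] 0, ‖(a : ℂ) * t‖ ≤ 1 := by
    have hc : Continuous fun t : ℝ => ‖(a : ℂ) * t‖ := by fun_prop
    have := hc.tendsto 0
    rw [Complex.ofReal_zero, mul_zero, norm_zero] at this
    exact (this.mono_left nhdsWithin_le_nhds).eventually (eventually_le_nhds zero_lt_one)
  filter_upwards [h0] with t ht
  refine (Complex.norm_exp_sub_one_sub_id_le ht).trans_eq ?_
  rw [norm_mul, Complex.norm_real, Complex.norm_real, norm_pow, mul_pow, Real.norm_eq_abs]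

lemma isBigO_pow_of_le {m n : ℕ} (h : m ≤ n) :
    (fun t : ℝ => t ^ n) =O[𝓝[>] 0] fun t => t ^ m := by
  refine IsBigO.of_bound 1 ?_
  filter_upwards [eventually_zero_lt_le_one] with t ht
  rw [Real.norm_of_nonneg (pow_nonneg ht.1.le _), Real.norm_of_nonneg (pow_nonneg ht.1.le _),
    one_mul]
  exact pow_le_pow_of_le_one ht.1.le ht.2 h

lemma isBigO_ofReal_pow (n : ℕ) : (fun t : ℝ => (t : ℂ) ^ n) =O[𝓝[>] 0] fun t : ℝ => t ^ n :=
  IsBigO.of_bound 1 (Eventually.of_forall fun t => by simp)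

lemma isBigO_exp (a : ℝ) :
    (fun t : ℝ => Complex.exp (a * t)) =O[𝓝[>] 0] fun _ => (1 : ℝ) := by
  have hc : Continuous fun t : ℝ => Complex.exp (a * t) := by fun_prop
  exact ((hc.tendsto 0).mono_left nhdsWithin_le_nhds).isBigO_one ℝ

lemma isBigO_exp_sub_one (a : ℝ) :
    (fun t : ℝ => Complex.exp (a * t) - 1) =O[𝓝[>] 0] fun t => t := by
  have h1 := (isBigO_exp_sub a).trans (isBigO_pow_of_le (show 1 ≤ 2 by norm_num))
  have h2 := (isBigO_ofReal_pow 1).const_mul_left (a : ℂ)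
  simp only [pow_one] at h1 h2
  exact (h1.add h2).congr_left fun t => by ring

/-- The sum of tails after summation by parts: the `k`-th term has `k` small factors as `q → 1`. -/
lemma pochTails_eq {q : ℂ} (hq : ‖q‖ < 1) :
    pochTails q = ∑' k : ℕ, (k + 1 : ℂ) * (q ^ (k + 1) * qPoch q k) := by
  obtain ⟨C, _, hC⟩ := exists_norm_qPoch_sub_le hq
  rw [pochTails, tsum_eq_tsum_succ_mul_sub hq hC]
  refine tsum_congr fun n => ?_
  rw [qPoch_succ]
  ring

lemma summable_pochTails_aux {q : ℂ} (hq : ‖q‖ < 1) :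
    Summable fun k : ℕ => (k + 1 : ℂ) * (q ^ (k + 1) * qPoch q k) := by
  obtain ⟨C, hC0⟩ := (tendsto_qPoch hq).norm.bddAbove_range
  have hC : ∀ k, ‖qPoch q k‖ ≤ C := fun k => hC0 ⟨k, rfl⟩
  have hg : Summable fun n : ℕ => (n : ℝ) * ‖q‖ ^ n := by
    simpa using summable_pow_mul_geometric_of_norm_lt_one 1 (r := ‖q‖) (by simpa using hq)
  refine Summable.of_norm_bounded (((summable_nat_add_iff 1).2 hg).mul_left C) fun k => ?_
  have h1 : (k + 1 : ℂ) = ((k + 1 : ℕ) : ℂ) := by push_cast; ring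
  rw [norm_mul, norm_mul, norm_pow, h1, Complex.norm_natCast]
  calc ((k + 1 : ℕ) : ℝ) * (‖q‖ ^ (k + 1) * ‖qPoch q k‖)
      ≤ ((k + 1 : ℕ) : ℝ) * (‖q‖ ^ (k + 1) * C) := by gcongr; exact hC k
    _ = _ := by ring

/-- The terms with `k ≥ 4` are `O(t⁴) * ∑ k qᵏ = O(t²)`. -/
lemma isBigO_pochTails_rest :
    (fun t : ℝ => ∑' k : ℕ, (((k + 4 : ℕ) : ℂ) + 1) *
      (((Real.exp (-t) : ℝ) : ℂ) ^ (k + 4 + 1) * qPoch (Real.exp (-t)) (k + 4)))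
      =O[𝓝[>] 0] fun t => t ^ 2 := by
  refine IsBigO.of_bound (24 * 20) ?_
  filter_upwards [eventually_zero_lt_le_one] with t ht
  have hq := norm_ofReal_exp_neg_lt_one ht.1
  have hqn := norm_ofReal_exp_neg t
  have h1 := half_le_one_sub_exp_neg ht.1 ht.2
  have hp : ∀ k, ‖qPoch (Real.exp (-t)) (k + 4)‖ ≤ 24 * t ^ 4 := fun k => by
    rw [add_comm]
    exact (norm_qPoch_exp_neg_add_le ht.1 4 k).trans
      ((norm_qPoch_exp_neg_le ht.1 4).trans_eq (by norm_num [Nat.factorial]))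
  set q : ℂ := ((Real.exp (-t) : ℝ) : ℂ) with hqdef
  have hsum := (hasSum_choose_mul_geometric_of_norm_lt_one 1 (r := ‖q‖)
    (by simpa using hq)).mul_left (120 * t ^ 4)
  refine (tsum_of_norm_bounded hsum fun k => ?_).trans ?_
  · have h2 : ((k + 4 : ℕ) : ℂ) + 1 = ((k + 5 : ℕ) : ℂ) := by push_cast; ring
    rw [norm_mul, norm_mul, norm_pow, h2, Complex.norm_natCast, Nat.choose_one_right]
    have h3 : ‖q‖ ^ (k + 4 + 1) ≤ ‖q‖ ^ k :=
      pow_le_pow_of_le_one (norm_nonneg _) hq.le (by omega)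
    have h4 : ((k + 5 : ℕ) : ℝ) ≤ 5 * ((k + 1 : ℕ) : ℝ) := by
      push_cast
      linarith [(Nat.cast_nonneg k : (0 : ℝ) ≤ k)]
    calc _ ≤ (5 * ((k + 1 : ℕ) : ℝ)) * (‖q‖ ^ k * (24 * t ^ 4)) := by
          gcongr
          exact hp k
      _ = _ := by ring
  · rw [Real.norm_of_nonneg (by positivity), hqn]
    have ht0 := ht.1
    calc 120 * t ^ 4 * (1 / (1 - Real.exp (-t)) ^ (1 + 1))
        ≤ 120 * t ^ 4 * (1 / (t / 2) ^ (1 + 1)) := by gcongr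
      _ = 24 * 20 * t ^ 2 := by field_simp; ring

lemma ofReal_exp_neg (t : ℝ) : ((Real.exp (-t) : ℝ) : ℂ) = Complex.exp ((-1 : ℝ) * t) := by
  push_cast
  ring_nf

/-- Second-order expansion of the sum of tails. The second order is needed because `H_{A_7}` has an
additional denominator `1 - q`. -/
lemma isBigO_pochTails :
    (fun t : ℝ => pochTails (Real.exp (-t)) - 1 - t) =O[𝓝[>] 0] fun t => t ^ 2 := by
  have hδ : (fun t : ℝ => 1 - ((Real.exp (-t) : ℝ) : ℂ)) =O[𝓝[>] 0] fun t => t :=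
    (isBigO_exp_sub_one (-1)).neg_left.congr_left fun t => by rw [ofReal_exp_neg]; ring
  have hδ2 : (fun t : ℝ => 1 - ((Real.exp (-t) : ℝ) : ℂ) - t) =O[𝓝[>] 0] fun t => t ^ 2 :=
    (isBigO_exp_sub (-1)).neg_left.congr_left fun t => by rw [ofReal_exp_neg]; push_cast; ring
  -- With `δ = 1 - q`, the terms `k < 4` sum to `1 + δ + δ²` times this polynomial in `q`.
  have hpoly : (fun t : ℝ => -2 - 2 * ((Real.exp (-t) : ℝ) : ℂ)
      + 3 * ((Real.exp (-t) : ℝ) : ℂ) ^ 3 * (1 + ((Real.exp (-t) : ℝ) : ℂ))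
      + 4 * ((Real.exp (-t) : ℝ) : ℂ) ^ 4 * (1 + ((Real.exp (-t) : ℝ) : ℂ))
        * (1 - ((Real.exp (-t) : ℝ) : ℂ) ^ 3)) =O[𝓝[>] 0] fun _ => (1 : ℝ) := by
    refine Tendsto.isBigO_one ℝ (Tendsto.mono_left (Continuous.tendsto ?_ 0) nhdsWithin_le_nhds)
    fun_prop
  have h := (hδ2.add ((hδ.pow 2).mul hpoly |>.congr_right fun t => mul_one _)).add
    isBigO_pochTails_rest
  refine h.congr' ?_ EventuallyEq.rfl
  filter_upwards [eventually_zero_lt_le_one] with t ht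
  have hq := norm_ofReal_exp_neg_lt_one ht.1
  rw [pochTails_eq hq, ← (summable_pochTails_aux hq).sum_add_tsum_nat_add 4]
  simp only [Finset.sum_range_succ, Finset.sum_range_zero, qPoch, Finset.prod_range_succ,
    Finset.prod_range_zero]
  push_cast
  ring

lemma tendsto_mul_const_sub_log (c : ℝ) :
    Tendsto (fun t : ℝ => t * (c - Real.log t)) (𝓝[>] 0) (𝓝 0) := by
  have h1 : Tendsto (fun t : ℝ => t * c) (𝓝[>] 0) (𝓝 0) := by
    have hc : Continuous fun t : ℝ => t * c := by fun_prop
    have := hc.tendsto 0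
    rw [zero_mul] at this
    exact this.mono_left nhdsWithin_le_nhds
  have h2 : Tendsto (fun t : ℝ => t * Real.log t) (𝓝[>] 0) (𝓝 0) := by
    have := Real.continuous_mul_log.tendsto 0
    rw [zero_mul] at this
    exact this.mono_left nhdsWithin_le_nhds
  have := h1.sub h2
  rw [sub_zero] at this
  exact this.congr fun t => by ring

/-- Multiplying `(γ - log t) / t` by `e^{at}` produces `-a log t` and a bounded error. It accounts
for the powers of `q` in front of the closed forms. -/
lemma isBigO_exp_mul_sub (a : ℝ) {F : ℝ → ℂ}
    (hF : (fun t : ℝ => F t - (((Real.eulerMascheroniConstant - Real.log t) / t : ℝ) : ℂ))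
      =O[𝓝[>] 0] fun _ => (1 : ℝ)) :
    (fun t : ℝ => Complex.exp (a * t) * F t
      - (((Real.eulerMascheroniConstant - Real.log t) / t - a * Real.log t : ℝ) : ℂ))
      =O[𝓝[>] 0] fun _ => (1 : ℝ) := by
  set γ := Real.eulerMascheroniConstant
  have h1 : (fun t : ℝ => (Complex.exp (a * t) - 1 - a * t)
      * (((γ - Real.log t) / t : ℝ) : ℂ)) =O[𝓝[>] 0] fun _ => (1 : ℝ) := by
    have h2 : (fun t : ℝ => (((γ - Real.log t) / t : ℝ) : ℂ))
        =O[𝓝[>] 0] fun t : ℝ => (γ - Real.log t) / t :=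
      IsBigO.of_bound 1 (Eventually.of_forall fun t => by rw [Complex.norm_real, one_mul])
    refine ((isBigO_exp_sub a).mul h2).trans ?_
    refine IsBigO.congr' ((tendsto_mul_const_sub_log γ).isBigO_one ℝ) ?_ EventuallyEq.rfl
    filter_upwards [eventually_zero_lt_le_one] with t ht
    have := ht.1.ne'
    field_simp
  have h2 := ((isBigO_exp a).mul hF).congr_right fun t => mul_one (1 : ℝ)
  have h3 : (fun _ : ℝ => ((a * γ : ℝ) : ℂ)) =O[𝓝[>] (0 : ℝ)] fun _ => (1 : ℝ) :=
    isBigO_const_const _ one_ne_zero _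
  refine ((h1.add h2).add h3).congr' ?_ EventuallyEq.rfl
  filter_upwards [eventually_zero_lt_le_one] with t ht
  have : (t : ℂ) ≠ 0 := by exact_mod_cast ht.1.ne'
  push_cast
  field_simp
  ring

lemma exp_mul_ofReal_exp_neg (t : ℝ) :
    Complex.exp ((1 : ℝ) * t) * ((Real.exp (-t) : ℝ) : ℂ) = 1 := by
  rw [ofReal_exp_neg, ← Complex.exp_add]
  simp

lemma ofReal_exp_neg_ne_zero (t : ℝ) : ((Real.exp (-t) : ℝ) : ℂ) ≠ 0 := by
  exact_mod_cast (Real.exp_pos _).ne'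

theorem HA_two_isBigO :
    (fun t : ℝ => qPochInf (Real.exp (-t)) * HA 2 (Real.exp (-t)) - ((1 / t : ℝ) : ℂ))
        =O[𝓝[>] 0] fun _ => (1 : ℝ) := by
  have h1 := (isBigO_exp_sub (-1)).mul isBigO_inv_one_sub
  have h2 : (fun t : ℝ => ((t : ℂ))⁻¹) =O[𝓝[>] 0] fun t : ℝ => t⁻¹ :=
    IsBigO.of_bound 1 (Eventually.of_forall fun t => by simp)
  refine ((h1.mul h2).congr' ?_ ?_)
  · filter_upwards [eventually_zero_lt_le_one] with t ht
    have hq := norm_ofReal_exp_neg_lt_one ht.1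
    have h3 := one_sub_ne_zero_of_norm_lt_one hq
    have h4 : (t : ℂ) ≠ 0 := by exact_mod_cast ht.1.ne'
    rw [HA_two hq, ← ofReal_exp_neg]
    push_cast at h3 ⊢
    field_simp
    ring
  · filter_upwards [eventually_zero_lt_le_one] with t ht
    have := ht.1.ne'
    field_simp

theorem HA_three_isBigO :
    (fun t : ℝ => qPochInf (Real.exp (-t)) ^ 2 * HA 3 (Real.exp (-t)) - 1)
        =O[𝓝[>] 0] fun t => t := by
  have h1 := (isBigO_exp 1).mul (isBigO_qPochInf 1)
  simp only [one_mul, pow_one] at h1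
  refine ((isBigO_exp_sub_one 1).sub h1).congr' ?_ EventuallyEq.rfl
  filter_upwards [eventually_zero_lt_le_one] with t ht
  have h := HA_three (norm_ofReal_exp_neg_lt_one ht.1)
  have he := exp_mul_ofReal_exp_neg t
  linear_combination qPochInf (Real.exp (-t)) ^ 2 * HA 3 (Real.exp (-t)) * he
    - Complex.exp ((1 : ℝ) * t) * h

theorem HA_four_isBigO :
    (fun t : ℝ => qPochInf (Real.exp (-t)) ^ 2 * HA 4 (Real.exp (-t))
          - (((Real.eulerMascheroniConstant - Real.log t) / t - Real.log t : ℝ) : ℂ))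
        =O[𝓝[>] 0] fun _ => (1 : ℝ) := by
  refine (isBigO_exp_mul_sub 1 lambertSum_isBigO).congr' ?_ EventuallyEq.rfl
  filter_upwards [eventually_zero_lt_le_one] with t ht
  have h := HA_four (norm_ofReal_exp_neg_lt_one ht.1)
  have he := exp_mul_ofReal_exp_neg t
  rw [one_mul (Real.log t)]
  linear_combination qPochInf (Real.exp (-t)) ^ 2 * HA 4 (Real.exp (-t)) * he
    - Complex.exp ((1 : ℝ) * t) * h

theorem HA_five_isBigO :
    (fun t : ℝ => qPochInf (Real.exp (-t)) ^ 3 * HA 5 (Real.exp (-t)) - 1)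
        =O[𝓝[>] 0] fun t => t := by
  have h1 := isBigO_pochTails.trans (isBigO_pow_of_le (show 1 ≤ 2 by norm_num))
  have h2 := (isBigO_exp 1).mul (h1.add (isBigO_ofReal_pow 1))
  simp only [one_mul, pow_one] at h2
  refine ((isBigO_exp_sub_one 1).add h2).congr' ?_ EventuallyEq.rfl
  filter_upwards [eventually_zero_lt_le_one] with t ht
  have h := HA_five (norm_ofReal_exp_neg_lt_one ht.1) (ofReal_exp_neg_ne_zero t)
  have he := exp_mul_ofReal_exp_neg t
  linear_combination qPochInf (Real.exp (-t)) ^ 3 * HA 5 (Real.exp (-t)) * he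
    - Complex.exp ((1 : ℝ) * t) * h

theorem HA_six_isBigO :
    (fun t : ℝ => qPochInf (Real.exp (-t)) ^ 3 * HA 6 (Real.exp (-t))
          - ((2 * (Real.eulerMascheroniConstant - Real.log t) / t - 2 * Real.log t : ℝ) : ℂ))
        =O[𝓝[>] 0] fun _ => (1 : ℝ) := by
  have h0 := isBigO_qPochInf 0
  have h1 : (fun _ : ℝ => (1 : ℂ)) =O[𝓝[>] (0 : ℝ)] fun _ => (1 : ℝ) :=
    isBigO_const_const _ one_ne_zero _
  simp only [pow_zero] at h0
  have h2 := (isBigO_exp 1).mul (h0.sub h1)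
  simp only [mul_one] at h2
  refine (((isBigO_exp_mul_sub 1 lambertSum_isBigO).const_mul_left 2).add h2).congr' ?_
    EventuallyEq.rfl
  filter_upwards [eventually_zero_lt_le_one] with t ht
  have h := HA_six (norm_ofReal_exp_neg_lt_one ht.1) (ofReal_exp_neg_ne_zero t)
  have he := exp_mul_ofReal_exp_neg t
  have e : 2 * (Real.eulerMascheroniConstant - Real.log t) / t - 2 * Real.log t
    = 2 * ((Real.eulerMascheroniConstant - Real.log t) / t - 1 * Real.log t) := by ring
  rw [e, Complex.ofReal_mul 2, show ((2 : ℝ) : ℂ) = 2 by norm_num]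
  linear_combination qPochInf (Real.exp (-t)) ^ 3 * HA 6 (Real.exp (-t)) * he
    - Complex.exp ((1 : ℝ) * t) * h

theorem HA_seven_isBigO :
    (fun t : ℝ => qPochInf (Real.exp (-t)) ^ 4 * HA 7 (Real.exp (-t)) - 1)
        =O[𝓝[>] 0] fun t => t := by
  have hPD := (isBigO_qPochInf 4).mul isBigO_lambertSum
  have hPD' : (fun t : ℝ => qPochInf (Real.exp (-t)) * lambertSum (Real.exp (-t)))
      =O[𝓝[>] 0] fun t => t ^ 2 := by
    refine hPD.congr' EventuallyEq.rfl ?_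
    filter_upwards [eventually_zero_lt_le_one] with t ht
    have := ht.1.ne'
    field_simp
  have hδ := (isBigO_exp_sub_one (-1)).pow 2
  -- `q (1 - q) = t + O(t²)`
  have hq : (fun t : ℝ => (t : ℂ) - Complex.exp ((-1 : ℝ) * t) * (1 - Complex.exp ((-1 : ℝ) * t)))
      =O[𝓝[>] 0] fun t => t ^ 2 :=
    ((isBigO_exp_sub (-1)).add hδ).congr_left fun t => by push_cast; ring
  have hnum := ((isBigO_pochTails.add (isBigO_qPochInf 2)).add hPD').add hq
  have hinv := (isBigO_exp 1).mul isBigO_inv_one_sub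
  refine (hnum.mul hinv).congr' ?_ ?_
  · filter_upwards [eventually_zero_lt_le_one] with t ht
    have hlt := norm_ofReal_exp_neg_lt_one ht.1
    have h := HA_seven hlt (ofReal_exp_neg_ne_zero t)
    have he := exp_mul_ofReal_exp_neg t
    have h1 := one_sub_ne_zero_of_norm_lt_one hlt
    rw [← ofReal_exp_neg]
    set q : ℂ := ((Real.exp (-t) : ℝ) : ℂ)
    have h2 : (1 - q) * (1 - q)⁻¹ = 1 := mul_inv_cancel₀ h1
    linear_combination (qPochInf q ^ 4 * HA 7 q - 1) * (he + Complex.exp ((1 : ℝ) * t) * q * h2)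
      - Complex.exp ((1 : ℝ) * t) * (1 - q)⁻¹ * h
  · filter_upwards [eventually_zero_lt_le_one] with t ht
    have := ht.1.ne'
    field_simp

theorem HA_eight_isBigO :
    (fun t : ℝ => qPochInf (Real.exp (-t)) ^ 4 * HA 8 (Real.exp (-t))
          - ((3 * (Real.eulerMascheroniConstant - Real.log t) / t - 6 * Real.log t : ℝ) : ℂ))
        =O[𝓝[>] 0] fun _ => (1 : ℝ) := by
  have h0 := isBigO_qPochInf 0
  have h1 : (fun _ : ℝ => (-1 : ℂ)) =O[𝓝[>] (0 : ℝ)] fun _ => (1 : ℝ) :=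
    isBigO_const_const _ one_ne_zero _
  have h3 : (fun t : ℝ => pochTails (Real.exp (-t))) =O[𝓝[>] 0] fun _ => (1 : ℝ) := by
    have e1 := isBigO_pochTails.trans (isBigO_pow_of_le (show 0 ≤ 2 by norm_num))
    have e2 := (isBigO_ofReal_pow 1).trans (isBigO_pow_of_le (show 0 ≤ 1 by norm_num))
    simp only [pow_zero, pow_one] at e1 e2
    exact ((e1.add e2).sub h1).congr_left fun t => by ring
  simp only [pow_zero] at h0
  have h2 := (isBigO_exp 2).mul ((h1.add h0).sub (h3.const_mul_left 2))
  simp only [mul_one] at h2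
  refine (((isBigO_exp_mul_sub 2 lambertSum_isBigO).const_mul_left 3).add h2).congr' ?_
    EventuallyEq.rfl
  filter_upwards [eventually_zero_lt_le_one] with t ht
  have h := HA_eight (norm_ofReal_exp_neg_lt_one ht.1) (ofReal_exp_neg_ne_zero t)
  have he : Complex.exp ((2 : ℝ) * t) * ((Real.exp (-t) : ℝ) : ℂ) ^ 2 = 1 := by
    rw [ofReal_exp_neg, ← Complex.exp_nat_mul, ← Complex.exp_add]
    push_cast
    ring_nf
    simp
  have e : 3 * (Real.eulerMascheroniConstant - Real.log t) / t - 6 * Real.log t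
    = 3 * ((Real.eulerMascheroniConstant - Real.log t) / t - 2 * Real.log t) := by ring
  rw [e, Complex.ofReal_mul 3, show ((3 : ℝ) : ℂ) = 3 by norm_num]
  linear_combination qPochInf (Real.exp (-t)) ^ 4 * HA 8 (Real.exp (-t)) * he
    - Complex.exp ((2 : ℝ) * t) * h

end Asymptotics

/-! ### An induction principle for the modular group -/

section ModularGroup

lemma T_zpow_mul_apply (n : ℤ) (M : SL(2, ℤ)) :
    (ModularGroup.T ^ n * M) 0 0 = M 0 0 + n * M 1 0 ∧
    (ModularGroup.T ^ n * M) 0 1 = M 0 1 + n * M 1 1 ∧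
    (ModularGroup.T ^ n * M) 1 0 = M 1 0 ∧ (ModularGroup.T ^ n * M) 1 1 = M 1 1 := by
  simp [Matrix.SpecialLinearGroup.coe_mul, ModularGroup.coe_T_zpow, Matrix.mul_apply,
    Fin.sum_univ_two]

lemma S_mul_apply (M : SL(2, ℤ)) :
    (ModularGroup.S * M) 0 0 = -M 1 0 ∧ (ModularGroup.S * M) 0 1 = -M 1 1 ∧
    (ModularGroup.S * M) 1 0 = M 0 0 ∧ (ModularGroup.S * M) 1 1 = M 0 1 := by
  simp [Matrix.SpecialLinearGroup.coe_mul, ModularGroup.coe_S, Matrix.mul_apply,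
    Fin.sum_univ_two]

lemma S_inv_mul_apply (M : SL(2, ℤ)) :
    (ModularGroup.S⁻¹ * M) 0 0 = M 1 0 ∧ (ModularGroup.S⁻¹ * M) 0 1 = M 1 1 ∧
    (ModularGroup.S⁻¹ * M) 1 0 = -M 0 0 ∧ (ModularGroup.S⁻¹ * M) 1 1 = -M 0 1 := by
  simp [Matrix.SpecialLinearGroup.coe_mul, ModularGroup.coe_S, Matrix.mul_apply,
    Fin.sum_univ_two, Matrix.SpecialLinearGroup.coe_inv, Matrix.adjugate_fin_two]

lemma det_entries (M : SL(2, ℤ)) : M 0 0 * M 1 1 - M 0 1 * M 1 0 = 1 := by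
  have := M.det_coe
  rwa [Matrix.det_fin_two] at this

/-- Every `M` with lower row different from `(0, -1)` is reached from `1` by left multiplications by
`T`, `T⁻¹`, `S` and `S⁻¹`, where `S` and `S⁻¹` are only applied to matrices whose first column has
the signs `(+, ≥ 0)` and `(+, ≤ 0)` respectively. The signs make the cut planes of the successive
automorphy factors compatible. -/
theorem modularGroup_induction {Q : SL(2, ℤ) → Prop} (one : Q 1)
    (T_mul : ∀ M, Q M → Q (ModularGroup.T * M)) (T_inv_mul : ∀ M, Q M → Q (ModularGroup.T⁻¹ * M))
    (S_mul : ∀ M : SL(2, ℤ), 0 < M 0 0 → 0 ≤ M 1 0 → Q M → Q (ModularGroup.S * M))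
    (S_inv_mul : ∀ M : SL(2, ℤ), 0 < M 0 0 → M 1 0 ≤ 0 → Q M → Q (ModularGroup.S⁻¹ * M))
    (M : SL(2, ℤ)) (hM : ¬ (M 1 0 = 0 ∧ M 1 1 = -1)) : Q M := by
  have T_zpow : ∀ (n : ℤ) (M : SL(2, ℤ)), Q M → Q (ModularGroup.T ^ n * M) := by
    intro n M h
    induction n with
    | zero => simpa
    | succ n ih =>
      rw [add_comm, zpow_add, zpow_one, mul_assoc]
      exact T_mul _ ih
    | pred n ih =>
      rw [sub_eq_add_neg, add_comm, zpow_add, zpow_neg_one, mul_assoc]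
      exact T_inv_mul _ ih
  induction hn : (M 1 0).natAbs using Nat.strong_induction_on generalizing M with
  | _ n ih =>
    by_cases hc : M 1 0 = 0
    · have hdet := det_entries M
      rw [hc, mul_zero, sub_zero] at hdet
      have hd : M 1 1 = 1 := by
        rcases Int.eq_one_or_neg_one_of_mul_eq_one' hdet with h | h
        · exact h.2
        · exact absurd ⟨hc, h.2⟩ hM
      rw [hd, mul_one] at hdet
      have : M = ModularGroup.T ^ (M 0 1) * 1 := by
        obtain ⟨h1, h2, h3, h4⟩ := T_zpow_mul_apply (M 0 1) 1
        ext i j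
        fin_cases i <;> fin_cases j <;> simp [ModularGroup.coe_T_zpow, hc, hd, hdet]
      rw [this]
      exact T_zpow _ _ one
    · set j : ℤ := (-M 0 0) / M 1 0 with hj
      -- Euclid's algorithm on the first column: a power of `T` replaces the upper entry by a value
      -- in `(-|c|, 0]`, after which `S` or `S⁻¹`, chosen by the sign of `c`, moves its absolute
      -- value below and `|c|` above.
      obtain ⟨h1, h2, h3, h4⟩ := T_zpow_mul_apply j M
      have hr0 := Int.emod_nonneg (-M 0 0) hc
      have hr1 := Int.emod_lt_abs (-M 0 0) hc
      have hr2 := Int.mul_ediv_add_emod (-M 0 0) (M 1 0)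
      rw [← hj] at hr2
      have h1' : (ModularGroup.T ^ j * M) 0 0 = -(-M 0 0 % M 1 0) := by
        rw [h1]; linarith
      have hback : ModularGroup.T ^ (-j) * (ModularGroup.T ^ j * M) = M := by
        rw [← mul_assoc, ← zpow_add]; simp
      generalize ModularGroup.T ^ j * M = M' at *
      rw [← hback]
      refine T_zpow _ _ ?_
      generalize -M 0 0 % M 1 0 = r at *
      rcases lt_or_gt_of_ne hc with hneg | hpos
      · obtain ⟨g1, g2, g3, g4⟩ := S_mul_apply M'
        have hdet := det_entries (ModularGroup.S * M')
        rw [← inv_mul_cancel_left ModularGroup.S M']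
        refine S_inv_mul _ (by omega) (by omega) (ih _ ?_ _ ?_ rfl)
        · rw [abs_of_neg hneg] at hr1
          omega
        · rintro ⟨k1, k2⟩
          rw [k1, k2] at hdet
          omega
      · obtain ⟨g1, g2, g3, g4⟩ := S_inv_mul_apply M'
        have hdet := det_entries (ModularGroup.S⁻¹ * M')
        rw [← mul_inv_cancel_left ModularGroup.S M']
        refine S_mul _ (by omega) (by omega) (ih _ ?_ _ ?_ rfl)
        · rw [abs_of_pos hpos] at hr1
          omega
        · rintro ⟨k1, k2⟩
          rw [k1, k2] at hdet
          omega

end ModularGroup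

/-! ### The weight one holomorphic quantum modular form -/

section WeightOne

lemma coe_smul_eq_div (M : SL(2, ℤ)) (τ : ℍ) : ((M • τ : ℍ) : ℂ)
    = ((M 0 0 : ℂ) * τ + (M 0 1 : ℂ)) / ((M 1 0 : ℂ) * τ + (M 1 1 : ℂ)) := by
  rw [coe_specialLinearGroup_apply]
  simp

lemma coe_S_smul (τ : ℍ) : ((ModularGroup.S • τ : ℍ) : ℂ) = -(τ : ℂ)⁻¹ := by
  rw [modular_S_smul, coe_mk, inv_neg]

lemma coe_S_inv_smul (τ : ℍ) : ((ModularGroup.S⁻¹ • τ : ℍ) : ℂ) = -(τ : ℂ)⁻¹ := by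
  have h := coe_S_smul (ModularGroup.S⁻¹ • τ)
  rw [smul_inv_smul] at h
  rw [h, inv_neg, inv_inv, neg_neg]

lemma coe_T_smul (τ : ℍ) : ((ModularGroup.T • τ : ℍ) : ℂ) = τ + 1 := by
  rw [modular_T_smul, coe_vadd]
  push_cast
  ring

lemma coe_T_inv_smul (τ : ℍ) : ((ModularGroup.T⁻¹ • τ : ℍ) : ℂ) = τ - 1 := by
  have h := coe_T_smul (ModularGroup.T⁻¹ • τ)
  rw [smul_inv_smul] at h
  rw [h]
  ring

lemma denom_entries_ne_zero (M : SL(2, ℤ)) (τ : ℍ) : (M 1 0 : ℂ) * (τ : ℂ) + (M 1 1 : ℂ) ≠ 0 := by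
  intro h
  have him := congrArg Complex.im h
  have hre := congrArg Complex.re h
  simp at him hre
  have hdet := det_entries M
  rcases him with h0 | h0
  · rw [h0] at hre hdet
    simp at hre
    rw [hre] at hdet
    simp at hdet
  · exact τ.im_ne_zero h0

lemma num_entries_ne_zero (M : SL(2, ℤ)) (τ : ℍ) : (M 0 0 : ℂ) * (τ : ℂ) + (M 0 1 : ℂ) ≠ 0 := by
  obtain ⟨_, _, h1, h2⟩ := S_mul_apply M
  have := denom_entries_ne_zero (ModularGroup.S * M) τ
  rwa [h1, h2] at this

/-- In a matrix with `a > 0` and `c ≥ 0`, the identity `a (cz + d) = c (az + b) + 1` carries the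
slit plane condition from the numerator `az + b` to the denominator `cz + d` and to the quotient. -/
lemma mem_slitPlane_of_mul_eq {a c : ℝ} (ha : 0 < a) (hc : 0 ≤ c) {v w : ℂ}
    (hw : w ∈ Complex.slitPlane) (h : a * v = c * w + 1) :
    v ∈ Complex.slitPlane ∧ v / w ∈ Complex.slitPlane := by
  have ha' : (a : ℂ) ≠ 0 := by exact_mod_cast ha.ne'
  have hw0 := Complex.slitPlane_ne_zero hw
  have hv : v = (a⁻¹ : ℝ) * (c * w + 1) := by
    rw [← h]
    push_cast
    field_simp
  have hvw : v / w = (a⁻¹ : ℝ) * (w⁻¹ + (c : ℝ)) := by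
    rw [hv]
    field_simp
    ring
  constructor
  · rw [hv]
    refine pos_mul_mem_slitPlane ?_ (inv_pos.2 ha)
    rcases hc.eq_or_lt with rfl | hc
    · simp
    · simpa using add_nonneg_mem_slitPlane (pos_mul_mem_slitPlane hw hc) zero_le_one
  · rw [hvw]
    exact pos_mul_mem_slitPlane (add_nonneg_mem_slitPlane (inv_mem_slitPlane hw) hc) (inv_pos.2 ha)

lemma expTwoPiI_add_one (z : ℂ) : expTwoPiI (z + 1) = expTwoPiI z := by
  rw [expTwoPiI, mul_add, mul_one, Complex.exp_add, Complex.exp_two_pi_mul_I, mul_one, expTwoPiI]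

lemma expTwoPiI_sub_one (z : ℂ) : expTwoPiI (z - 1) = expTwoPiI z := by
  rw [← expTwoPiI_add_one, sub_add_cancel]

/-- The weight `1` obstruction of the Lambert series extends to the cut plane for every `M`. It is
invariant under `T` on the left, and left multiplication by `S` or `S⁻¹` adds `lambertPeriod` at a
Möbius image of `z`; the signs in `modularGroup_induction` keep that image in the slit plane. For
lower row `(0, -1)` the domain is empty. -/
lemma exists_lambertSum_obstruction (M : SL(2, ℤ)) : ∃ g : ℂ → ℂ,
    DifferentiableOn ℂ g {z : ℂ | (M 1 0 : ℂ) * z + (M 1 1 : ℂ) ∈ Complex.slitPlane} ∧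
    ∀ τ : ℍ, (M 1 0 : ℂ) * (τ : ℂ) + (M 1 1 : ℂ) ∈ Complex.slitPlane →
      lambertSum (expTwoPiI τ) - ((M 1 0 : ℂ) * (τ : ℂ) + (M 1 1 : ℂ))⁻¹
        * lambertSum (expTwoPiI ((M • τ : ℍ) : ℂ)) = g τ := by
  by_cases hM : M 1 0 = 0 ∧ M 1 1 = -1
  · refine ⟨0, differentiableOn_const 0, fun τ hτ => ?_⟩
    rw [hM.1, hM.2] at hτ
    simp [Complex.mem_slitPlane_iff] at hτ
    linarith
  refine modularGroup_induction (Q := fun M => ∃ g : ℂ → ℂ,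
    DifferentiableOn ℂ g {z : ℂ | (M 1 0 : ℂ) * z + (M 1 1 : ℂ) ∈ Complex.slitPlane} ∧
    ∀ τ : ℍ, (M 1 0 : ℂ) * (τ : ℂ) + (M 1 1 : ℂ) ∈ Complex.slitPlane →
      lambertSum (expTwoPiI τ) - ((M 1 0 : ℂ) * (τ : ℂ) + (M 1 1 : ℂ))⁻¹
        * lambertSum (expTwoPiI ((M • τ : ℍ) : ℂ)) = g τ) ?_ ?_ ?_ ?_ ?_ M hM
  · refine ⟨0, differentiableOn_const 0, fun τ hτ => ?_⟩
    simp
  · rintro M ⟨g, hg, h⟩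
    obtain ⟨_, _, h3, h4⟩ := T_zpow_mul_apply 1 M
    rw [zpow_one] at h3 h4
    refine ⟨g, by rwa [h3, h4], ?_⟩
    rw [h3, h4]
    intro τ hτ
    rw [mul_smul, coe_T_smul, expTwoPiI_add_one]
    exact h τ hτ
  · rintro M ⟨g, hg, h⟩
    obtain ⟨_, _, h3, h4⟩ := T_zpow_mul_apply (-1) M
    rw [zpow_neg_one] at h3 h4
    refine ⟨g, by rwa [h3, h4], ?_⟩
    rw [h3, h4]
    intro τ hτ
    rw [mul_smul, coe_T_inv_smul, expTwoPiI_sub_one]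
    exact h τ hτ
  · rintro M ha hc ⟨g, hg, h⟩
    obtain ⟨_, _, h3, h4⟩ := S_mul_apply M
    have hdet : (M 0 0 : ℂ) * M 1 1 - M 0 1 * M 1 0 = 1 := by exact_mod_cast det_entries M
    rw [h3, h4]
    have hU : ∀ z : ℂ, (M 0 0 : ℂ) * z + (M 0 1 : ℂ) ∈ Complex.slitPlane →
        (M 1 0 : ℂ) * z + (M 1 1 : ℂ) ∈ Complex.slitPlane ∧
        ((M 0 0 : ℂ) * z + (M 0 1 : ℂ)) / ((M 1 0 : ℂ) * z + (M 1 1 : ℂ)) ∈ Complex.slitPlane := by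
      intro z hz
      obtain ⟨k1, k2⟩ := mem_slitPlane_of_mul_eq (a := (M 0 0 : ℝ)) (c := (M 1 0 : ℝ))
        (by exact_mod_cast ha) (by exact_mod_cast hc) (v := (M 1 0 : ℂ) * z + (M 1 1 : ℂ)) hz (by
          push_cast
          linear_combination hdet)
      refine ⟨k1, ?_⟩
      rw [← inv_div]
      exact inv_mem_slitPlane k2
    refine ⟨fun z => g z + ((M 1 0 : ℂ) * z + (M 1 1 : ℂ))⁻¹ *
      lambertPeriod (((M 0 0 : ℂ) * z + (M 0 1 : ℂ)) / ((M 1 0 : ℂ) * z + (M 1 1 : ℂ))), ?_, ?_⟩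
    · have hd : DifferentiableOn ℂ (fun z : ℂ => (M 1 0 : ℂ) * z + (M 1 1 : ℂ))
          {z : ℂ | (M 0 0 : ℂ) * z + (M 0 1 : ℂ) ∈ Complex.slitPlane} :=
        Differentiable.differentiableOn (by fun_prop)
      have hn : DifferentiableOn ℂ (fun z : ℂ => (M 0 0 : ℂ) * z + (M 0 1 : ℂ))
          {z : ℂ | (M 0 0 : ℂ) * z + (M 0 1 : ℂ) ∈ Complex.slitPlane} :=
        Differentiable.differentiableOn (by fun_prop)
      have h0 := fun z hz => Complex.slitPlane_ne_zero (hU z hz).1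
      exact (hg.mono fun z hz => (hU z hz).1).add ((hd.inv h0).mul
        (differentiableOn_lambertPeriod.comp (hn.div hd h0) fun z hz => (hU z hz).2))
    · intro τ hτ
      have hp := lambertSum_sub_neg_inv (M • τ).im_pos
      have hv := denom_entries_ne_zero M τ
      have hw := num_entries_ne_zero M τ
      rw [mul_smul, coe_S_smul]
      beta_reduce
      rw [← h τ (hU τ hτ).1, ← coe_smul_eq_div, ← hp]
      have e2 : ((M 1 0 : ℂ) * τ + (M 1 1 : ℂ))⁻¹ * ((M • τ : ℍ) : ℂ)⁻¹
          = ((M 0 0 : ℂ) * τ + (M 0 1 : ℂ))⁻¹ := by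
        rw [coe_smul_eq_div]
        field_simp
      linear_combination lambertSum (expTwoPiI (-((M • τ : ℍ) : ℂ)⁻¹)) * e2
  · rintro M ha hc ⟨g, hg, h⟩
    obtain ⟨_, _, h3, h4⟩ := S_inv_mul_apply M
    have hdet : (M 0 0 : ℂ) * M 1 1 - M 0 1 * M 1 0 = 1 := by exact_mod_cast det_entries M
    rw [h3, h4]
    push_cast
    have hU : ∀ z : ℂ, -(M 0 0 : ℂ) * z + -(M 0 1 : ℂ) ∈ Complex.slitPlane →
        (M 1 0 : ℂ) * z + (M 1 1 : ℂ) ∈ Complex.slitPlane ∧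
        ((M 1 0 : ℂ) * z + (M 1 1 : ℂ)) / (-(M 0 0 : ℂ) * z + -(M 0 1 : ℂ))
          ∈ Complex.slitPlane := by
      intro z hz
      exact mem_slitPlane_of_mul_eq (a := (M 0 0 : ℝ)) (c := -(M 1 0 : ℝ))
        (by exact_mod_cast ha) (by simpa using hc) hz (by
          push_cast
          linear_combination hdet)
    refine ⟨fun z => g z - (-(M 0 0 : ℂ) * z + -(M 0 1 : ℂ))⁻¹ *
      lambertPeriod (((M 1 0 : ℂ) * z + (M 1 1 : ℂ)) / (-(M 0 0 : ℂ) * z + -(M 0 1 : ℂ))), ?_, ?_⟩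
    · have hd : DifferentiableOn ℂ (fun z : ℂ => (M 1 0 : ℂ) * z + (M 1 1 : ℂ))
          {z : ℂ | -(M 0 0 : ℂ) * z + -(M 0 1 : ℂ) ∈ Complex.slitPlane} :=
        Differentiable.differentiableOn (by fun_prop)
      have hn : DifferentiableOn ℂ (fun z : ℂ => -(M 0 0 : ℂ) * z + -(M 0 1 : ℂ))
          {z : ℂ | -(M 0 0 : ℂ) * z + -(M 0 1 : ℂ) ∈ Complex.slitPlane} :=
        Differentiable.differentiableOn (by fun_prop)
      have h0 : ∀ z ∈ {z : ℂ | -(M 0 0 : ℂ) * z + -(M 0 1 : ℂ) ∈ Complex.slitPlane},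
        -(M 0 0 : ℂ) * z + -(M 0 1 : ℂ) ≠ 0 := fun z hz => Complex.slitPlane_ne_zero hz
      exact (hg.mono fun z hz => (hU z hz).1).sub ((hn.inv h0).mul
        (differentiableOn_lambertPeriod.comp (hd.div hn h0) fun z hz => (hU z hz).2))
    · intro τ hτ
      have hv := denom_entries_ne_zero M τ
      have hw := num_entries_ne_zero M τ
      have hw' : -(M 0 0 : ℂ) * (τ : ℂ) + -(M 0 1 : ℂ) ≠ 0 := Complex.slitPlane_ne_zero hτ
      have e : -((M • τ : ℍ) : ℂ)⁻¹
          = ((M 1 0 : ℂ) * τ + (M 1 1 : ℂ)) / (-(M 0 0 : ℂ) * τ + -(M 0 1 : ℂ)) := by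
        rw [coe_smul_eq_div, inv_div, ← div_neg]
        ring
      have hp := lambertSum_sub_neg_inv (neg_inv_im_pos (M • τ).im_pos)
      rw [inv_neg, inv_inv, neg_neg] at hp
      rw [mul_smul, coe_S_inv_smul]
      beta_reduce
      rw [← h τ (hU τ hτ).1, ← e, ← hp]
      have e2 : ((M • τ : ℍ) : ℂ) * (-(M 0 0 : ℂ) * τ + -(M 0 1 : ℂ))⁻¹
          = -((M 1 0 : ℂ) * τ + (M 1 1 : ℂ))⁻¹ := by
        have e3 : -(M 0 0 : ℂ) * (τ : ℂ) + -(M 0 1 : ℂ)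
            = -((M 0 0 : ℂ) * τ + (M 0 1 : ℂ)) := by ring
        rw [coe_smul_eq_div, e3, inv_neg]
        field_simp
      linear_combination lambertSum (expTwoPiI ((M • τ : ℍ) : ℂ)) * e2

/-- Holomorphy of the Lambert series comes for free from that of `trapSeries`. -/
lemma differentiableOn_lambertSum :
    DifferentiableOn ℂ (fun z => lambertSum (expTwoPiI z)) {z : ℂ | 0 < z.im} := by
  have h1 : DifferentiableOn ℂ
      (fun z => (trapSeries z - trapSeries (-z)) / (2 * Real.pi * Complex.I))
      {z : ℂ | 0 < z.im} := by
    refine DifferentiableOn.div_const (DifferentiableOn.sub ?_ ?_) _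
    · exact differentiableOn_trapSeries.mono fun z hz => mem_slitPlane_of_im_pos hz
    · exact differentiableOn_trapSeries.comp (differentiableOn_neg _)
        fun z hz => neg_mem_slitPlane_of_im_pos hz
  refine h1.congr fun z hz => ?_
  rw [trapSeries_sub_trapSeries_neg hz, mul_div_cancel_left₀ _ Complex.two_pi_I_ne_zero]

theorem isHolomorphicQuantumModularForm_HA_four :
    IsHolomorphicQuantumModularForm 1 (fun _ => 1) ⊤
      (fun τ : ℍ => expTwoPiI τ * qPochInf (expTwoPiI τ) ^ 2 * HA 4 (expTwoPiI τ)) := by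
  have hf : (fun τ : ℍ => expTwoPiI τ * qPochInf (expTwoPiI τ) ^ 2 * HA 4 (expTwoPiI τ))
      = fun τ : ℍ => lambertSum (expTwoPiI τ) :=
    funext fun τ => HA_four (norm_expTwoPiI_lt_one τ.im_pos)
  rw [hf]
  refine ⟨?_, fun M _ => ?_⟩
  · rw [UpperHalfPlane.mdifferentiable_iff]
    refine differentiableOn_lambertSum.congr fun z hz => ?_
    rw [Function.comp_apply, ofComplex_apply_of_im_pos hz]
  · obtain ⟨g, hg, h⟩ := exists_lambertSum_obstruction M
    refine ⟨g, hg, fun τ hτ => ?_⟩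
    rw [← h τ hτ]
    have : (-((1 : ℝ) : ℂ)) = ((-1 : ℤ) : ℂ) := by push_cast; rfl
    rw [this, Complex.cpow_intCast, zpow_neg_one]
    simp

end WeightOne

/-! ### The Dedekind eta function and its multiplier -/

section Eta

open ModularForm (eta)

lemma eta_eq_qPochInf (z : ℂ) : eta z = expTwoPiI (z / 24) * qPochInf (expTwoPiI z) := by
  rw [eta, qPochInf]
  congr 1
  · rw [Function.Periodic.qParam, expTwoPiI]
    push_cast
    ring_nf
  · simp only [ModularForm.eta_q_eq_pow, expTwoPiI]

lemma differentiableAt_eta {z : ℂ} (hz : 0 < z.im) : DifferentiableAt ℂ eta z :=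
  ModularForm.differentiableAt_eta_of_mem_upperHalfPlaneSet hz

lemma eta_coe_ne_zero (τ : ℍ) : eta τ ≠ 0 := ModularForm.eta_ne_zero τ.im_pos

lemma eta_add_one (z : ℂ) : eta (z + 1) = expTwoPiI (1 / 24) * eta z := by
  rw [eta_eq_qPochInf, eta_eq_qPochInf, expTwoPiI_add_one, add_div, ← mul_assoc]
  congr 1
  rw [expTwoPiI, expTwoPiI, expTwoPiI, ← Complex.exp_add]
  ring_nf

lemma norm_expTwoPiI (z : ℂ) : ‖expTwoPiI z‖ = Real.exp (-(2 * Real.pi * z.im)) := by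
  rw [expTwoPiI, Complex.norm_exp]
  simp

/-- The pentagonal number series bounds `(q)_∞`. -/
lemma norm_qPochInf_le {q : ℂ} (hq : ‖q‖ < 1) : ‖qPochInf q‖ ≤ 2 * (1 - ‖q‖)⁻¹ := by
  have hg := (summable_geometric_of_lt_one (norm_nonneg q) hq).mul_left 2
  rw [← (tsum_thetaTerm_one_and_pochTails hq).1,
    ← tsum_geometric_of_lt_one (norm_nonneg q) hq, ← tsum_mul_left]
  refine tsum_of_norm_bounded hg.hasSum fun k => ?_
  rw [thetaTerm, norm_mul, norm_mul, norm_pow, norm_pow, norm_neg, norm_one, one_pow, one_mul,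
    one_pow, one_pow, mul_one, mul_comm (2 : ℝ)]
  refine mul_le_mul (pow_le_pow_of_le_one (norm_nonneg q) hq.le (le_pent k)) ?_
    (norm_nonneg _) (by positivity)
  refine (norm_sub_le _ _).trans ?_
  rw [norm_one, norm_pow]
  linarith [pow_le_one₀ (norm_nonneg q) hq.le (n := 2 * k + 1)]

/-- Exponential decay of `η` towards the cusp at infinity. -/
lemma exists_norm_eta_le {δ : ℝ} (hδ : 0 < δ) :
    ∃ C : ℝ, 0 < C ∧ ∀ z : ℂ, δ ≤ z.im → ‖eta z‖ ≤ C * Real.exp (-(Real.pi / 12 * z.im)) := by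
  have hr : Real.exp (-(2 * Real.pi * δ)) < 1 := by
    rw [Real.exp_lt_one_iff]
    have : 0 < 2 * Real.pi * δ := by positivity
    linarith
  have hr' : 0 < 1 - Real.exp (-(2 * Real.pi * δ)) := by linarith
  refine ⟨2 * (1 - Real.exp (-(2 * Real.pi * δ)))⁻¹, by positivity, fun z hz => ?_⟩
  have hz0 : 0 < z.im := lt_of_lt_of_le hδ hz
  rw [eta_eq_qPochInf, norm_mul, mul_comm]
  have h1 := norm_qPochInf_le (norm_expTwoPiI_lt_one hz0)
  have h2 : ‖expTwoPiI (z / 24)‖ = Real.exp (-(Real.pi / 12 * z.im)) := by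
    rw [norm_expTwoPiI]
    have : (z / 24).im = z.im / 24 := by
      simp
    rw [this]
    ring_nf
  rw [h2]
  gcongr
  refine h1.trans ?_
  rw [norm_expTwoPiI]
  gcongr

/-- Square roots are multiplicative on the right half-plane, up to the boundary in one argument. -/
lemma cpow_half_mul {a b : ℂ} (ha : 0 ≤ a.re) (ha0 : a ≠ 0) (hb : 0 < b.re) :
    (a * b) ^ (1 / 2 : ℂ) = a ^ (1 / 2 : ℂ) * b ^ (1 / 2 : ℂ) := by
  have hb0 : b ≠ 0 := fun h => by simp [h] at hb
  have h1 := abs_le.1 (Complex.abs_arg_le_pi_div_two_iff.2 ha)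
  have h2 := abs_lt.1 (Complex.abs_arg_lt_pi_div_two_iff.2 (Or.inl hb))
  have h3 : Complex.log (a * b) = Complex.log a + Complex.log b :=
    (Complex.log_mul_eq_add_log_iff ha0 hb0).2 ⟨by linarith, by linarith⟩
  rw [Complex.cpow_def_of_ne_zero (mul_ne_zero ha0 hb0), Complex.cpow_def_of_ne_zero ha0,
    Complex.cpow_def_of_ne_zero hb0, h3, add_mul, Complex.exp_add]

/-- The transformation of `η` under inversion, with a square root on the right half-plane. -/
lemma eta_neg_inv {z : ℂ} (hz : 0 < z.im) :
    eta (-z⁻¹) = (-Complex.I * z) ^ (1 / 2 : ℂ) * eta z := by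
  have h := ModularForm.eta_comp_eq_csqrt_I_inv hz
  have h1 : z ^ (1 / 2 : ℂ) = Complex.I ^ (1 / 2 : ℂ) * (-Complex.I * z) ^ (1 / 2 : ℂ) := by
    rw [← cpow_half_mul (by simp) Complex.I_ne_zero (by simpa using hz), ← mul_assoc, mul_neg,
      Complex.I_mul_I, neg_neg, one_mul]
  have h2 : (Complex.I : ℂ) ^ (1 / 2 : ℂ) ≠ 0 := by
    rw [Complex.cpow_def_of_ne_zero Complex.I_ne_zero]
    exact Complex.exp_ne_zero _
  simp only [Function.comp_apply, Pi.smul_apply, Pi.mul_apply, Complex.sqrt, smul_eq_mul] at h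
  rw [neg_div, one_div] at h
  rw [h]
  norm_num at h1 h2 ⊢
  rw [h1]
  field_simp

open scoped ModularForm in
lemma eta_smul_pow (M : SL(2, ℤ)) (τ : ℍ) : eta ((M • τ : ℍ) : ℂ) ^ 24
    = ((M 1 0 : ℂ) * τ + (M 1 1 : ℂ)) ^ 12 * eta τ ^ 24 := by
  have h : (ModularForm.discriminant ∣[(12 : ℤ)] M) τ = ModularForm.discriminant τ :=
    congrFun (SlashInvariantForm.slash_action_generators_SL2Z
      ModularForm.discriminant_S_invariant ModularForm.discriminant_T_invariant M) τ
  have h2 := denom_entries_ne_zero M τ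
  have h3 : UpperHalfPlane.denom M τ = (M 1 0 : ℂ) * τ + (M 1 1 : ℂ) := by
    simp [UpperHalfPlane.denom]
  rw [ModularForm.SL_slash_apply, h3, ModularForm.discriminant, ModularForm.discriminant,
    zpow_neg] at h
  generalize (M 1 0 : ℂ) * τ + (M 1 1 : ℂ) = j at h h2 ⊢
  have h4 : j ^ (12 : ℤ) = j ^ 12 := by norm_cast
  rw [← h, h4, mul_comm, mul_assoc, inv_mul_cancel₀ (pow_ne_zero _ h2), mul_one]

lemma norm_eta_smul_sq (M : SL(2, ℤ)) (τ : ℍ) : ‖eta ((M • τ : ℍ) : ℂ)‖ ^ 2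
    = ‖(M 1 0 : ℂ) * τ + (M 1 1 : ℂ)‖ * ‖eta τ‖ ^ 2 := by
  have h := congrArg norm (eta_smul_pow M τ)
  rw [norm_mul, norm_pow, norm_pow, norm_pow] at h
  refine (pow_left_inj₀ (n := 12) (by positivity) (by positivity) (by norm_num)).1 ?_
  rw [mul_pow, ← pow_mul, ← pow_mul]
  exact h

/-- The value `cτ + d` of the automorphy factor of `M` at `τ`. -/
noncomputable def autFactor (M : SL(2, ℤ)) (z : ℂ) : ℂ := (M 1 0 : ℂ) * z + (M 1 1 : ℂ)

lemma autFactor_ne_zero (M : SL(2, ℤ)) (τ : ℍ) : autFactor M τ ≠ 0 := denom_entries_ne_zero M τ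

lemma autFactor_mul (M N : SL(2, ℤ)) (τ : ℍ) :
    autFactor (M * N) τ = autFactor M ((N • τ : ℍ) : ℂ) * autFactor N τ := by
  have h := denom_entries_ne_zero N τ
  rw [autFactor, autFactor, autFactor, coe_smul_eq_div]
  simp only [Matrix.SpecialLinearGroup.coe_mul, Matrix.mul_apply, Fin.sum_univ_two]
  push_cast
  field_simp
  ring

lemma autFactor_cpow_half_ne_zero (M : SL(2, ℤ)) (τ : ℍ) : autFactor M τ ^ (1 / 2 : ℂ) ≠ 0 := by
  rw [Complex.cpow_def_of_ne_zero (autFactor_ne_zero M τ)]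
  exact Complex.exp_ne_zero _

lemma continuous_autFactor_cpow_half (M : SL(2, ℤ)) :
    Continuous fun τ : ℍ => autFactor M τ ^ (1 / 2 : ℂ) := by
  by_cases hc : M 1 0 = 0
  · simp only [autFactor, hc, Int.cast_zero, zero_mul, zero_add]
    exact continuous_const
  · rw [continuous_iff_continuousAt]
    intro τ
    have h1 : Continuous fun τ : ℍ => autFactor M τ := by
      unfold autFactor
      exact (continuous_const.mul UpperHalfPlane.continuous_coe).add continuous_const
    refine h1.continuousAt.cpow continuousAt_const (Complex.mem_slitPlane_iff.2 (Or.inr ?_))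
    rw [autFactor, ← Complex.ofReal_intCast, Complex.add_im, Complex.im_ofReal_mul]
    simp only [Complex.intCast_im, add_zero]
    exact mul_ne_zero (by exact_mod_cast hc) τ.im_ne_zero

lemma continuous_eta_smul (M : SL(2, ℤ)) : Continuous fun τ : ℍ => eta ((M • τ : ℍ) : ℂ) := by
  rw [continuous_iff_continuousAt]
  intro τ
  have h1 : ContinuousAt (fun τ : ℍ => ((M • τ : ℍ) : ℂ)) τ := by
    simp only [coe_smul_eq_div]
    have h2 : ∀ a b : ℤ, ContinuousAt (fun τ : ℍ => (a : ℂ) * (τ : ℂ) + b) τ := fun a b =>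
      ((continuous_const.mul UpperHalfPlane.continuous_coe).add continuous_const).continuousAt
    exact (h2 _ _).div (h2 _ _) (denom_entries_ne_zero M τ)
  exact ContinuousAt.comp (f := fun τ : ℍ => ((M • τ : ℍ) : ℂ))
    (differentiableAt_eta (M • τ).im_pos).continuousAt h1

/-- The multiplier of `η` exists: the quotient of the two sides is continuous, and its values are
24th roots of unity because `η ^ 24` is modular of weight `12`. -/
theorem exists_isEtaMultiplier : ∃ χ : SL(2, ℤ) → ℂ, IsEtaMultiplier χ := by
  set r : SL(2, ℤ) → ℍ → ℂ := fun M τ =>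
    eta ((M • τ : ℍ) : ℂ) / (autFactor M τ ^ (1 / 2 : ℂ) * eta τ) with hr
  refine ⟨fun M => r M UpperHalfPlane.I, fun M τ => ?_⟩
  have hne : ∀ τ : ℍ, autFactor M τ ^ (1 / 2 : ℂ) * eta τ ≠ 0 := fun τ =>
    mul_ne_zero (autFactor_cpow_half_ne_zero M τ) (eta_coe_ne_zero τ)
  have hcont : Continuous (r M) := by
    refine (continuous_eta_smul M).div ((continuous_autFactor_cpow_half M).mul ?_) hne
    simpa using continuous_eta_smul 1
  have hpow : ∀ τ, r M τ ^ 24 = 1 := by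
    intro τ
    have h1 : (autFactor M τ ^ (1 / 2 : ℂ)) ^ 24 = autFactor M τ ^ 12 := by
      rw [← Complex.cpow_nat_mul, ← Complex.cpow_natCast]
      norm_num
    have h2 := pow_ne_zero 24 (hne τ)
    rw [mul_pow, h1] at h2
    rw [hr, div_pow, mul_pow, h1, eta_smul_pow, ← autFactor, div_self h2]
  have hfin : (Set.range (r M)).Countable := by
    refine Set.Countable.mono ?_ (Polynomial.nthRoots 24 (1 : ℂ)).toFinset.countable_toSet
    rintro _ ⟨τ, rfl⟩
    simp [Polynomial.mem_nthRoots, hpow]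
  -- A countable subset of `ℂ` is totally disconnected, and the upper half-plane is connected.
  have hconst : r M τ = r M UpperHalfPlane.I :=
    hfin.isTotallyDisconnected _ subset_rfl (isPreconnected_range hcont) ⟨τ, rfl⟩ ⟨_, rfl⟩
  beta_reduce
  rw [← autFactor, mul_assoc, ← hconst, hr, div_mul_cancel₀ _ (hne τ)]

variable {χ : SL(2, ℤ) → ℂ}

lemma IsEtaMultiplier.ne_zero (hχ : IsEtaMultiplier χ) (M : SL(2, ℤ)) : χ M ≠ 0 := by
  intro h
  have h1 := hχ M UpperHalfPlane.I
  rw [h, zero_mul, zero_mul] at h1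
  exact eta_coe_ne_zero _ h1

lemma IsEtaMultiplier.T_mul (hχ : IsEtaMultiplier χ) (M : SL(2, ℤ)) :
    χ (ModularGroup.T * M) = expTwoPiI (1 / 24) * χ M := by
  have h1 := hχ M UpperHalfPlane.I
  have h2 := hχ (ModularGroup.T * M) UpperHalfPlane.I
  obtain ⟨_, _, h3, h4⟩ := T_zpow_mul_apply 1 M
  rw [zpow_one] at h3 h4
  rw [mul_smul, coe_T_smul, eta_add_one, h1, h3, h4, ← autFactor, mul_assoc (χ M), ← mul_assoc,
    mul_assoc (χ _)] at h2
  exact (mul_right_cancel₀ (mul_ne_zero (autFactor_cpow_half_ne_zero M _) (eta_coe_ne_zero _))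
    h2).symm

/-- Multiplicativity of `χ`, at a pair whose principal square roots multiply correctly. -/
lemma IsEtaMultiplier.mul (hχ : IsEtaMultiplier χ) {M N : SL(2, ℤ)} (τ : ℍ)
    (hM : 0 < (autFactor M ((N • τ : ℍ) : ℂ)).re) (hN : 0 < (autFactor N τ).re) :
    χ (M * N) = χ M * χ N := by
  have h1 := hχ N τ
  have h2 := hχ M (N • τ)
  have h3 := hχ (M * N) τ
  rw [← autFactor] at h1 h2 h3
  rw [mul_smul, h2, h1, autFactor_mul, cpow_half_mul hM.le (autFactor_ne_zero M _) hN] at h3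
  have h4 := mul_ne_zero (mul_ne_zero (autFactor_cpow_half_ne_zero M (N • τ))
    (autFactor_cpow_half_ne_zero N τ)) (eta_coe_ne_zero τ)
  refine mul_right_cancel₀ h4 ?_
  linear_combination -h3

lemma IsEtaMultiplier.one (hχ : IsEtaMultiplier χ) : χ 1 = 1 := by
  have h := hχ 1 UpperHalfPlane.I
  have h2 := eta_coe_ne_zero UpperHalfPlane.I
  simp at h
  refine mul_right_cancel₀ h2 ?_
  rw [one_mul, UpperHalfPlane.coe_I]
  exact h.symm

/-- Evaluate at the fixed point `i` of `S`. -/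
lemma IsEtaMultiplier.S_inv (hχ : IsEtaMultiplier χ) :
    (χ ModularGroup.S)⁻¹ = Complex.I ^ (1 / 2 : ℂ) := by
  have h := hχ ModularGroup.S UpperHalfPlane.I
  have h1 : ((ModularGroup.S • UpperHalfPlane.I : ℍ) : ℂ) = (UpperHalfPlane.I : ℂ) := by
    rw [coe_S_smul, UpperHalfPlane.coe_I, Complex.inv_I, neg_neg]
  obtain ⟨_, _, h3, h4⟩ := S_mul_apply 1
  rw [mul_one] at h3 h4
  rw [h1, h3, h4] at h
  have h2 := eta_coe_ne_zero UpperHalfPlane.I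
  simp only [coe_one, Matrix.one_apply_eq, Int.cast_one, UpperHalfPlane.coe_I, one_mul, ne_eq,
    zero_ne_one, not_false_eq_true, Matrix.one_apply_ne, Int.cast_zero, add_zero] at h h2
  refine (eq_inv_of_mul_eq_one_right ?_).symm
  refine mul_right_cancel₀ h2 ?_
  rw [one_mul]
  exact h.symm

end Eta

/-! ### Quantum modularity of weight `3/2` from the two generators -/

section QuantumModularity

/-- The obstruction to modularity of weight `3 / 2` of `f` under `M` is real-analytic where the
automorphy factor is positive. -/
def HasAnalyticObstruction (χ : SL(2, ℤ) → ℂ) (f : ℚ → ℂ) (M : SL(2, ℤ)) : Prop :=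
  ∃ g : ℝ → ℂ, AnalyticOnNhd ℝ g {x : ℝ | 0 < (M 1 0 : ℝ) * x + (M 1 1 : ℝ)} ∧
    ∀ x : ℚ, 0 < (M 1 0 : ℚ) * x + (M 1 1 : ℚ) →
      f x - (χ M)⁻¹ * ((((M 1 0 : ℝ) * (x : ℝ) + (M 1 1 : ℝ)) ^ (-(3 / 2 : ℝ)) : ℝ) : ℂ) *
        f (((M 0 0 : ℚ) * x + (M 0 1 : ℚ)) / ((M 1 0 : ℚ) * x + (M 1 1 : ℚ))) = g (x : ℝ)

lemma analyticAt_ofReal_rpow {u : ℝ → ℝ} {x : ℝ} (hu : AnalyticAt ℝ u x) (h0 : 0 < u x) (s : ℝ) :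
    AnalyticAt ℝ (fun x => ((u x ^ s : ℝ) : ℂ)) x := by
  have h1 : AnalyticAt ℝ (fun x => Real.exp (Real.log (u x) * s)) x :=
    ((hu.log h0).mul analyticAt_const).rexp'
  have h2 : AnalyticAt ℝ (fun x => u x ^ s) x := by
    refine h1.congr ?_
    filter_upwards [hu.continuousAt.eventually (lt_mem_nhds h0)] with y hy
    rw [Real.rpow_def_of_pos hy]
  exact (Complex.ofRealCLM.analyticAt _).comp h2

lemma analyticAt_affine (a b x : ℝ) : AnalyticAt ℝ (fun x => a * x + b) x :=
  (analyticAt_const.mul analyticAt_id).add analyticAt_const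

variable {χ : SL(2, ℤ) → ℂ} {f : ℚ → ℂ}

/-- The cocycle relation of the obstructions. It needs that the multiplier is multiplicative at `M`
and `N`, and that the automorphy factor of `N` is positive on the whole domain for `M * N`. -/
lemma HasAnalyticObstruction.mul {M N : SL(2, ℤ)} (hM : HasAnalyticObstruction χ f M)
    (hN : HasAnalyticObstruction χ f N) (hχ : χ (M * N) = χ M * χ N)
    (hpos : ∀ x : ℝ, 0 < ((M * N) 1 0 : ℝ) * x + ((M * N) 1 1 : ℝ) →
      0 < (N 1 0 : ℝ) * x + (N 1 1 : ℝ)) : HasAnalyticObstruction χ f (M * N) := by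
  obtain ⟨gM, hgM, hM⟩ := hM
  obtain ⟨gN, hgN, hN⟩ := hN
  have e00 : (M * N) 0 0 = M 0 0 * N 0 0 + M 0 1 * N 1 0 := by
    simp [Matrix.mul_apply, Fin.sum_univ_two]
  have e01 : (M * N) 0 1 = M 0 0 * N 0 1 + M 0 1 * N 1 1 := by
    simp [Matrix.mul_apply, Fin.sum_univ_two]
  have e10 : (M * N) 1 0 = M 1 0 * N 0 0 + M 1 1 * N 1 0 := by
    simp [Matrix.mul_apply, Fin.sum_univ_two]
  have e11 : (M * N) 1 1 = M 1 0 * N 0 1 + M 1 1 * N 1 1 := by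
    simp [Matrix.mul_apply, Fin.sum_univ_two]
  have hj : ∀ x : ℝ, 0 < (N 1 0 : ℝ) * x + (N 1 1 : ℝ) →
      ((M * N) 1 0 : ℝ) * x + ((M * N) 1 1 : ℝ)
      = ((M 1 0 : ℝ) * (((N 0 0 : ℝ) * x + (N 0 1 : ℝ)) / ((N 1 0 : ℝ) * x + (N 1 1 : ℝ)))
        + (M 1 1 : ℝ)) * ((N 1 0 : ℝ) * x + (N 1 1 : ℝ)) := by
    intro x hx
    rw [e10, e11]
    push_cast
    field_simp
    ring
  refine ⟨fun x => gN x + (χ N)⁻¹ * ((((N 1 0 : ℝ) * x + (N 1 1 : ℝ)) ^ (-(3 / 2 : ℝ)) : ℝ) : ℂ) *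
    gM (((N 0 0 : ℝ) * x + (N 0 1 : ℝ)) / ((N 1 0 : ℝ) * x + (N 1 1 : ℝ))), ?_, ?_⟩
  · intro x hx
    have h1 := hpos x hx
    have h2 : 0 < (M 1 0 : ℝ) * (((N 0 0 : ℝ) * x + (N 0 1 : ℝ)) / ((N 1 0 : ℝ) * x + (N 1 1 : ℝ)))
        + (M 1 1 : ℝ) := by
      have h3 : 0 < ((M * N) 1 0 : ℝ) * x + ((M * N) 1 1 : ℝ) := hx
      rw [hj x h1] at h3
      exact (mul_pos_iff_of_pos_right h1).1 h3
    refine (hgN x h1).add ((analyticAt_const.mul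
      (analyticAt_ofReal_rpow (analyticAt_affine _ _ _) h1 _)).mul ?_)
    exact AnalyticAt.comp (g := gM)
      (f := fun x => ((N 0 0 : ℝ) * x + (N 0 1 : ℝ)) / ((N 1 0 : ℝ) * x + (N 1 1 : ℝ))) (hgM _ h2)
      ((analyticAt_affine _ _ _).fun_div (analyticAt_affine _ _ _) h1.ne')
  · intro x hx
    have hx' : 0 < ((M * N) 1 0 : ℝ) * x + ((M * N) 1 1 : ℝ) := by exact_mod_cast hx
    have h1 := hpos x hx'
    have h1' : 0 < (N 1 0 : ℚ) * x + (N 1 1 : ℚ) := by exact_mod_cast h1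
    have h3 := hx'
    rw [hj x h1] at h3
    have h2 := (mul_pos_iff_of_pos_right h1).1 h3
    set y : ℚ := ((N 0 0 : ℚ) * x + (N 0 1 : ℚ)) / ((N 1 0 : ℚ) * x + (N 1 1 : ℚ)) with hy
    have hyR : (y : ℝ) = ((N 0 0 : ℝ) * x + (N 0 1 : ℝ)) / ((N 1 0 : ℝ) * x + (N 1 1 : ℝ)) := by
      rw [hy]
      push_cast
      rfl
    have h2' : 0 < (M 1 0 : ℚ) * y + (M 1 1 : ℚ) := by
      rw [← hyR] at h2
      exact_mod_cast h2
    have k1 := hN x h1'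
    have k2 := hM y h2'
    rw [← hy] at k1
    have k3 : ((M 0 0 : ℚ) * y + (M 0 1 : ℚ)) / ((M 1 0 : ℚ) * y + (M 1 1 : ℚ))
        = (((M * N) 0 0 : ℚ) * x + ((M * N) 0 1 : ℚ)) / (((M * N) 1 0 : ℚ) * x
          + ((M * N) 1 1 : ℚ)) := by
      rw [← mul_div_mul_right _ _ h1'.ne', e00, e01, e10, e11, hy]
      have hyv := div_mul_cancel₀ ((N 0 0 : ℚ) * x + (N 0 1 : ℚ)) h1'.ne'
      push_cast
      congr 1
      · linear_combination (M 0 0 : ℚ) * hyv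
      · linear_combination (M 1 0 : ℚ) * hyv
    rw [k3, hyR] at k2
    beta_reduce
    rw [hj x h1, Real.mul_rpow h2.le h1.le, hχ, ← k1, ← k2, mul_inv]
    push_cast
    ring

lemma hasAnalyticObstruction_T_mul_iff (hχ : IsEtaMultiplier χ)
    (hT : ∀ x, f (x + 1) = expTwoPiI (1 / 24) * f x) (M : SL(2, ℤ)) :
    HasAnalyticObstruction χ f (ModularGroup.T * M) ↔ HasAnalyticObstruction χ f M := by
  obtain ⟨h1, h2, h3, h4⟩ := T_zpow_mul_apply 1 M
  rw [zpow_one] at h1 h2 h3 h4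
  have he : expTwoPiI (1 / 24) ≠ 0 := Complex.exp_ne_zero _
  rw [HasAnalyticObstruction, HasAnalyticObstruction, h1, h2, h3, h4, hχ.T_mul]
  refine exists_congr fun g => and_congr_right fun _ => forall_congr' fun x =>
    forall_congr' fun hx => ?_
  have e1 : (((M 0 0 + 1 * M 1 0 : ℤ) : ℚ) * x + ((M 0 1 + 1 * M 1 1 : ℤ) : ℚ))
      / ((M 1 0 : ℚ) * x + (M 1 1 : ℚ))
      = ((M 0 0 : ℚ) * x + (M 0 1 : ℚ)) / ((M 1 0 : ℚ) * x + (M 1 1 : ℚ)) + 1 := by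
    push_cast
    field_simp
    ring
  rw [e1, hT, mul_inv]
  generalize ((((M 1 0 : ℝ) * (x : ℝ) + (M 1 1 : ℝ)) ^ (-(3 / 2 : ℝ)) : ℝ) : ℂ) = u
  generalize f (((M 0 0 : ℚ) * x + (M 0 1 : ℚ)) / ((M 1 0 : ℚ) * x + (M 1 1 : ℚ))) = v
  have e2 : (expTwoPiI (1 / 24))⁻¹ * (χ M)⁻¹ * u * (expTwoPiI (1 / 24) * v)
      = (χ M)⁻¹ * u * v := by field_simp
  rw [e2]

lemma autFactor_S (z : ℂ) : autFactor ModularGroup.S z = z := by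
  obtain ⟨_, _, h3, h4⟩ := S_mul_apply 1
  rw [mul_one] at h3 h4
  rw [autFactor, h3, h4]
  simp

lemma autFactor_S_inv (z : ℂ) : autFactor ModularGroup.S⁻¹ z = -z := by
  obtain ⟨_, _, h3, h4⟩ := S_inv_mul_apply 1
  rw [mul_one] at h3 h4
  rw [autFactor, h3, h4]
  simp

lemma HasAnalyticObstruction.S_inv (hχ : IsEtaMultiplier χ)
    (hS : HasAnalyticObstruction χ f ModularGroup.S) :
    HasAnalyticObstruction χ f ModularGroup.S⁻¹ := by
  have hmul : χ ModularGroup.S * χ ModularGroup.S⁻¹ = 1 := by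
    obtain ⟨_, _, h3, h4⟩ := S_mul_apply 1
    obtain ⟨_, _, g3, g4⟩ := S_inv_mul_apply 1
    rw [mul_one] at h3 h4 g3 g4
    rw [← hχ.mul (M := ModularGroup.S) (N := ModularGroup.S⁻¹) ⟨-1 + Complex.I, by simp⟩,
      mul_inv_cancel, hχ.one]
    · rw [autFactor, h3, h4, coe_S_inv_smul]
      simp [Complex.normSq_apply]
      norm_num
    · rw [autFactor, g3, g4]
      simp
  have h0 := hχ.ne_zero ModularGroup.S
  have hinv : (χ ModularGroup.S⁻¹)⁻¹ = χ ModularGroup.S := (eq_inv_of_mul_eq_one_left hmul).symm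
  obtain ⟨g, hg, h⟩ := hS
  obtain ⟨h1, h2, h3, h4⟩ := S_mul_apply 1
  obtain ⟨g1, g2, g3, g4⟩ := S_inv_mul_apply 1
  rw [mul_one] at h1 h2 h3 h4 g1 g2 g3 g4
  rw [h3, h4] at hg
  rw [h1, h2, h3, h4] at h
  rw [HasAnalyticObstruction, g1, g2, g3, g4, hinv]
  simp only [coe_one, Matrix.one_apply_eq, ne_eq, one_ne_zero, zero_ne_one, not_false_eq_true,
    Matrix.one_apply_ne, neg_zero, Int.cast_zero, Int.cast_one, Int.cast_neg, zero_mul, one_mul,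
    add_zero, zero_add, neg_mul] at hg h ⊢
  refine ⟨fun x => -(χ ModularGroup.S * (((-x) ^ (-(3 / 2 : ℝ)) : ℝ) : ℂ) * g (-x)⁻¹), ?_, ?_⟩
  · intro x hx
    have hx : 0 < -x := hx
    refine ((analyticAt_const.mul (analyticAt_ofReal_rpow analyticAt_id.fun_neg hx _)).mul
      ?_).fun_neg
    exact AnalyticAt.comp (g := g) (f := fun x => (-x)⁻¹) (hg _ (inv_pos.2 hx))
      (analyticAt_id.fun_neg.fun_inv hx.ne')
  · intro x hx
    have k := h (-x)⁻¹ (inv_pos.2 hx)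
    have hxR : (0 : ℝ) < -x := by exact_mod_cast hx
    have e1 : -1 / (-x)⁻¹ = x := by field_simp
    have e2 : (1 : ℚ) / (-x) = (-x)⁻¹ := one_div _
    rw [e1] at k
    push_cast at k
    beta_reduce
    rw [e2, ← k, Real.inv_rpow hxR.le]
    have e3 : (((-(x : ℝ)) ^ (-(3 / 2 : ℝ)) : ℝ) : ℂ) ≠ 0 := by
      exact_mod_cast (Real.rpow_pos_of_pos hxR _).ne'
    push_cast
    field_simp
    ring

/-- The automorphy factors `cτ + d` of `M` and `Mτ` of `S` must both lie in the right half-plane for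
some `τ`. -/
lemma IsEtaMultiplier.S_mul (hχ : IsEtaMultiplier χ) {M : SL(2, ℤ)} (ha : 0 < M 0 0)
    (hc : 0 ≤ M 1 0) : χ (ModularGroup.S * M) = χ ModularGroup.S * χ M := by
  have haR : (0 : ℝ) < M 0 0 := by exact_mod_cast ha
  have hcR : (0 : ℝ) ≤ M 1 0 := by exact_mod_cast hc
  have hdet : (M 0 0 : ℝ) * M 1 1 - M 0 1 * M 1 0 = 1 := by exact_mod_cast det_entries M
  -- At this point the numerator of `M τ` is `1 + ai`.
  set t : ℝ := (1 - M 0 1) / M 0 0 with ht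
  have hat : M 0 0 * t = 1 - M 0 1 := by rw [ht]; field_simp
  have hv : 0 < M 1 0 * t + M 1 1 := by
    have : M 0 0 * (M 1 0 * t + M 1 1) = M 1 0 + 1 := by
      linear_combination M 1 0 * hat + hdet
    refine (mul_pos_iff_of_pos_left haR).1 (this ▸ ?_)
    positivity
  have hre : 0 < (autFactor M (t + Complex.I)).re := by simpa [autFactor] using hv
  refine hχ.mul ⟨t + Complex.I, by simp⟩ ?_ hre
  rw [autFactor_S, coe_smul_eq_div, coe_mk, ← autFactor, Complex.div_re, ← add_div]
  refine div_pos ?_ (Complex.normSq_pos.2 fun h => by simp [h] at hre)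
  simp only [autFactor, Complex.add_re, Complex.mul_re, Complex.intCast_re, Complex.ofReal_re,
    Complex.I_re, Complex.intCast_im, Complex.add_im, Complex.ofReal_im, Complex.I_im,
    Complex.mul_im, add_zero, zero_mul, mul_one, sub_zero, zero_add, hat]
  have : 0 ≤ (M 0 0 : ℝ) * M 1 0 := by positivity
  linarith

lemma IsEtaMultiplier.S_inv_mul (hχ : IsEtaMultiplier χ) {M : SL(2, ℤ)} (ha : 0 < M 0 0)
    (hc : M 1 0 ≤ 0) : χ (ModularGroup.S⁻¹ * M) = χ ModularGroup.S⁻¹ * χ M := by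
  have haR : (0 : ℝ) < M 0 0 := by exact_mod_cast ha
  have hcR : (M 1 0 : ℝ) ≤ 0 := by exact_mod_cast hc
  have hdet : (M 0 0 : ℝ) * M 1 1 - M 0 1 * M 1 0 = 1 := by exact_mod_cast det_entries M
  -- At this point the numerator of `M τ` is `-1 + ai`.
  set t : ℝ := (-1 - M 0 1) / M 0 0 with ht
  have hat : M 0 0 * t = -1 - M 0 1 := by rw [ht]; field_simp
  have hv : 0 < M 1 0 * t + M 1 1 := by
    have : M 0 0 * (M 1 0 * t + M 1 1) = -M 1 0 + 1 := by
      linear_combination M 1 0 * hat + hdet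
    refine (mul_pos_iff_of_pos_left haR).1 (this ▸ ?_)
    linarith
  have hre : 0 < (autFactor M (t + Complex.I)).re := by simpa [autFactor] using hv
  refine hχ.mul ⟨t + Complex.I, by simp⟩ ?_ hre
  rw [autFactor_S_inv, coe_smul_eq_div, coe_mk, ← autFactor, Complex.neg_re, Complex.div_re,
    ← add_div, ← neg_div]
  refine div_pos ?_ (Complex.normSq_pos.2 fun h => by simp [h] at hre)
  simp only [autFactor, Complex.add_re, Complex.mul_re, Complex.intCast_re, Complex.ofReal_re,
    Complex.I_re, Complex.intCast_im, Complex.add_im, Complex.ofReal_im, Complex.I_im,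
    Complex.mul_im, add_zero, zero_mul, mul_one, sub_zero, zero_add, hat]
  have : (M 0 0 : ℝ) * M 1 0 ≤ 0 := mul_nonpos_of_nonneg_of_nonpos haR.le hcR
  linarith

/-- A `T`-equivariant function whose obstruction under `S` is real-analytic on the positive axis is
a quantum modular form. -/
theorem isQuantumModularForm_of_S (hχ : IsEtaMultiplier χ)
    (hT : ∀ x, f (x + 1) = expTwoPiI (1 / 24) * f x)
    (hS : HasAnalyticObstruction χ f ModularGroup.S) :
    IsQuantumModularForm (3 / 2) χ ⊤ Set.univ f := by
  have key : ∀ M, HasAnalyticObstruction χ f M := by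
    intro M
    by_cases hM : M 1 0 = 0 ∧ M 1 1 = -1
    · rw [HasAnalyticObstruction, hM.1, hM.2]
      refine ⟨0, fun _ _ => analyticAt_const, fun x hx => ?_⟩
      norm_num at hx
    refine modularGroup_induction ?_ (fun M h => (hasAnalyticObstruction_T_mul_iff hχ hT M).2 h)
      (fun M h => ?_) ?_ ?_ M hM
    · refine ⟨0, fun _ _ => analyticAt_const, fun x hx => ?_⟩
      simp [hχ.one]
    · rw [← hasAnalyticObstruction_T_mul_iff hχ hT, mul_inv_cancel_left]
      exact h
    · intro M ha hc h
      obtain ⟨_, _, h3, h4⟩ := S_mul_apply M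
      refine hS.mul h (hχ.S_mul ha hc) fun x hx => ?_
      have haR : (0 : ℝ) < M 0 0 := by exact_mod_cast ha
      have hcR : (0 : ℝ) ≤ M 1 0 := by exact_mod_cast hc
      have hdet : (M 0 0 : ℝ) * M 1 1 - M 0 1 * M 1 0 = 1 := by exact_mod_cast det_entries M
      rw [h3, h4] at hx
      refine (mul_pos_iff_of_pos_left haR).1 ?_
      nlinarith [mul_nonneg hcR hx.le]
    · intro M ha hc h
      obtain ⟨_, _, h3, h4⟩ := S_inv_mul_apply M
      refine (hS.S_inv hχ).mul h (hχ.S_inv_mul ha hc) fun x hx => ?_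
      have haR : (0 : ℝ) < M 0 0 := by exact_mod_cast ha
      have hcR : (M 1 0 : ℝ) ≤ 0 := by exact_mod_cast hc
      have hdet : (M 0 0 : ℝ) * M 1 1 - M 0 1 * M 1 0 = 1 := by exact_mod_cast det_entries M
      rw [h3, h4] at hx
      push_cast at hx
      refine (mul_pos_iff_of_pos_left haR).1 ?_
      nlinarith [mul_nonneg (neg_nonneg.2 hcR) hx.le]
  intro M _
  obtain ⟨g, hg, h⟩ := key M
  exact ⟨g, hg, fun x _ hx _ => h x hx⟩

end QuantumModularity

/-! ### Decay of the eta function at rational points -/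

section EtaDecay

open ModularForm (eta)

/-- At a rational point `x`, inside the cone of vertices `x` and aperture a right angle, `η` decays
faster than any power; the cube of the imaginary part is enough here. The transformation formula for
a matrix that sends `x` to `∞` reduces this to the decay at infinity. -/
lemma exists_norm_eta_le_im_pow (x : ℚ) : ∃ C : ℝ, 0 < C ∧ ∀ z : ℂ, 0 < z.im → z.im ≤ 1 →
    |z.re - x| ≤ z.im → ‖eta z‖ ≤ C * z.im ^ 3 := by
  have hcop : IsCoprime (x.den : ℤ) (-x.num) := by
    rw [IsCoprime.neg_right_iff, Int.isCoprime_iff_gcd_eq_one, Int.gcd_comm]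
    exact x.reduced
  -- The lower row `(den, -num)` makes the automorphy factor vanish at `x`.
  obtain ⟨M, h0, h1⟩ := hcop.exists_SL2_row 1
  have hden : (1 : ℝ) ≤ x.den := by exact_mod_cast x.den_pos
  set n : ℝ := (x.den : ℝ) with hn
  have hn0 : 0 < n := by linarith
  have hxn : (x : ℝ) * n = x.num := by
    rw [hn]
    exact_mod_cast Rat.mul_den_eq_num x
  obtain ⟨C, hC, hb⟩ := exists_norm_eta_le (δ := (2 * n ^ 2)⁻¹) (by positivity)
  set a : ℝ := Real.pi / (12 * n ^ 2) with ha
  have ha0 : 0 < a := by positivity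
  refine ⟨√(C ^ 2 * (Nat.factorial 7 / a ^ 7)), by positivity, fun z hz hz1 hcone => ?_⟩
  set y := z.im with hy
  have hj := norm_eta_smul_sq M ⟨z, hz⟩
  rw [h0, h1, coe_mk] at hj
  have hjz : ((x.den : ℤ) : ℂ) * z + ((-x.num : ℤ) : ℂ) = (n : ℂ) * (z - (x : ℝ)) := by
    have : ((x : ℝ) : ℂ) * (n : ℂ) = (x.num : ℂ) := by exact_mod_cast congrArg Complex.ofReal hxn
    have h2 : ((x.den : ℤ) : ℂ) = (n : ℂ) := by simp [hn]
    rw [h2]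
    push_cast at this ⊢
    linear_combination this
  rw [hjz] at hj
  set N : ℝ := Complex.normSq (z - (x : ℝ)) with hN
  have hN' : N = (z.re - x) ^ 2 + y ^ 2 := by
    rw [hN, Complex.normSq_apply]
    simp
    ring
  have hN1 : y ^ 2 ≤ N := by rw [hN']; nlinarith [sq_nonneg (z.re - x)]
  have hN2 : N ≤ 2 * y ^ 2 := by
    have := sq_le_sq' (by linarith [(abs_le.1 hcone).1]) (abs_le.1 hcone).2
    rw [hN']
    linarith
  have hNpos : 0 < N := lt_of_lt_of_le (by positivity) hN1
  have hY : (M • (⟨z, hz⟩ : ℍ)).im = y / (n ^ 2 * N) := by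
    rw [ModularGroup.im_smul_eq_div_normSq]
    have : UpperHalfPlane.denom M (⟨z, hz⟩ : ℍ) = (n : ℂ) * (z - (x : ℝ)) := by
      rw [← hjz, ← h0, ← h1]
      simp [UpperHalfPlane.denom]
    rw [this, Complex.normSq_mul, Complex.normSq_ofReal, ← hN, ← sq]
    rfl
  have hYlow : (2 * n ^ 2 * y)⁻¹ ≤ y / (n ^ 2 * N) := by
    rw [inv_eq_one_div, div_le_div_iff₀ (by positivity) (by positivity)]
    nlinarith [mul_le_mul_of_nonneg_left hN2 (sq_nonneg n)]
  have hYδ : (2 * n ^ 2)⁻¹ ≤ y / (n ^ 2 * N) := by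
    refine le_trans (inv_anti₀ (by positivity) ?_) hYlow
    exact mul_le_of_le_one_right (by positivity) hz1
  have h2 := hb ((M • (⟨z, hz⟩ : ℍ) : ℍ) : ℂ) (by rw [coe_im, hY]; exact hYδ)
  rw [coe_im, hY] at h2
  have h3 : ‖eta ((M • (⟨z, hz⟩ : ℍ) : ℍ) : ℂ)‖ ^ 2 ≤ C ^ 2 * Real.exp (-(a / y)) := by
    have h4 : ‖eta ((M • (⟨z, hz⟩ : ℍ) : ℍ) : ℂ)‖ ≤ C * Real.exp (-(a / y / 2)) := by
      refine h2.trans ?_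
      gcongr
      calc a / y / 2 = Real.pi / 12 * (2 * n ^ 2 * y)⁻¹ := by rw [ha]; field_simp
        _ ≤ _ := by gcongr
    calc _ ≤ (C * Real.exp (-(a / y / 2))) ^ 2 := by gcongr
      _ = _ := by
        rw [mul_pow, ← Real.exp_nat_mul]
        congr 2
        push_cast
        ring
  -- Seven powers of `y`: one is lost to the automorphy factor, and the square root of the rest is
  -- `y ^ 3`.
  have h5 : Real.exp (-(a / y)) ≤ Nat.factorial 7 / a ^ 7 * y ^ 7 := by
    have := Real.pow_div_factorial_le_exp (a / y) (by positivity) 7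
    rw [Real.exp_neg]
    calc (Real.exp (a / y))⁻¹ ≤ ((a / y) ^ 7 / Nat.factorial 7)⁻¹ := by gcongr
      _ = _ := by field_simp
  have h6 : y ≤ ‖(n : ℂ) * (z - (x : ℝ))‖ := by
    rw [norm_mul, Complex.norm_real, Real.norm_of_nonneg hn0.le]
    have h7 : y ≤ ‖z - (x : ℝ)‖ := by
      refine le_trans (le_of_eq ?_) ((le_abs_self _).trans (Complex.abs_im_le_norm _))
      simp [hy]
    calc y = 1 * y := (one_mul y).symm
      _ ≤ _ := by gcongr
  have h8 : y * ‖eta z‖ ^ 2 ≤ y * (C ^ 2 * (Nat.factorial 7 / a ^ 7) * y ^ 6) := by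
    calc y * ‖eta z‖ ^ 2 ≤ ‖(n : ℂ) * (z - (x : ℝ))‖ * ‖eta z‖ ^ 2 := by gcongr
      _ = _ := hj.symm
      _ ≤ _ := h3
      _ ≤ C ^ 2 * (Nat.factorial 7 / a ^ 7 * y ^ 7) := by gcongr
      _ = _ := by ring
  have h9 := le_of_mul_le_mul_left h8 hz
  refine (sq_le_sq₀ (norm_nonneg _) (by positivity)).1 (h9.trans_eq ?_)
  rw [mul_pow, Real.sq_sqrt (by positivity)]
  ring

/-- Boundedness of `η` in the cone at a rational point, with linear decay at the vertex. -/
lemma exists_norm_eta_le_of_cone (x : ℚ) : ∃ C : ℝ, 0 < C ∧ ∀ z : ℂ, 0 < z.im →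
    |z.re - x| ≤ z.im → ‖eta z‖ ≤ C ∧ ‖eta z‖ ≤ C * z.im := by
  obtain ⟨C, hC, h⟩ := exists_norm_eta_le_im_pow x
  obtain ⟨D, hD, h'⟩ := exists_norm_eta_le one_pos
  refine ⟨max C D, by positivity, fun z hz hcone => ?_⟩
  rcases le_total z.im 1 with hz1 | hz1
  · have h1 := h z hz hz1 hcone
    have h2 : z.im ^ 3 ≤ z.im := pow_le_of_le_one hz.le hz1 (by norm_num)
    have h3 : ‖eta z‖ ≤ max C D * z.im := by
      calc _ ≤ _ := h1
        _ ≤ max C D * z.im := by gcongr; exact le_max_left _ _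
    exact ⟨h3.trans (mul_le_of_le_one_right (by positivity) hz1), h3⟩
  · have h1 : ‖eta z‖ ≤ max C D := by
      refine (h' z hz1).trans ((mul_le_of_le_one_right hD.le ?_).trans (le_max_right _ _))
      rw [Real.exp_le_one_iff, Left.neg_nonpos_iff]
      positivity
    exact ⟨h1, h1.trans (le_mul_of_one_le_right (by positivity) hz1)⟩

lemma hasDerivAt_eta_vertical (x : ℝ) {v : ℝ} (hv : 0 < v) :
    HasDerivAt (fun v : ℝ => eta (x + v * Complex.I)) (deriv eta (x + v * Complex.I) * Complex.I)
      v := by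
  have h1 : HasDerivAt (fun v : ℝ => (x : ℂ) + v * Complex.I) Complex.I v := by
    have := ((Complex.ofRealCLM.hasDerivAt (x := v)).mul_const Complex.I).const_add (x : ℂ)
    simpa using this
  exact (differentiableAt_eta (z := x + v * Complex.I) (by simpa using hv)).hasDerivAt.comp v h1

/-- On the vertical line over a rational point, `η` is bounded and Lipschitz up to the real axis,
with boundary value `0`. -/
lemma exists_norm_eta_vertical_le (x : ℚ) : ∃ C : ℝ, 0 < C ∧
    (∀ v : ℝ, 0 < v → ‖eta ((x : ℝ) + v * Complex.I)‖ ≤ C * min 1 v) ∧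
    ∀ v u : ℝ, 0 < v → 0 < u → ‖eta ((x : ℝ) + v * Complex.I)
      - eta ((x : ℝ) + (v + u : ℝ) * Complex.I)‖ ≤ C * min 1 u := by
  obtain ⟨C, hC, h⟩ := exists_norm_eta_le_of_cone x
  have hb : ∀ v : ℝ, 0 < v → ‖eta ((x : ℝ) + v * Complex.I)‖ ≤ C * min 1 v := by
    intro v hv
    have := h ((x : ℝ) + v * Complex.I) (by simpa using hv) (by simpa using hv.le)
    rcases le_total 1 v with h1 | h1
    · simpa [h1] using this.1
    · simpa [h1] using this.2
  -- Cauchy's estimate on the disc of radius `v / 2`, which lies in the cone and on which `η` is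
  -- `O(v)`.
  have hd : ∀ v : ℝ, 0 < v → ‖deriv eta ((x : ℝ) + v * Complex.I)‖ ≤ 3 * C := by
    intro v hv
    have hsph : ∀ z ∈ Metric.closedBall (((x : ℝ) : ℂ) + v * Complex.I) (v / 2),
        |z.re - x| ≤ v / 2 ∧ v / 2 ≤ z.im ∧ z.im ≤ 3 * v / 2 := by
      intro z hz
      rw [Metric.mem_closedBall, dist_eq_norm] at hz
      have h1 := (Complex.abs_re_le_norm _).trans hz
      have h2 := abs_le.1 ((Complex.abs_im_le_norm _).trans hz)
      simp at h1 h2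
      exact ⟨h1, by linarith, by linarith⟩
    have h3 := Complex.norm_deriv_le_of_forall_mem_sphere_norm_le (f := eta)
      (c := ((x : ℝ) : ℂ) + v * Complex.I) (R := v / 2) (C := C * (3 * v / 2)) (by positivity)
      (DifferentiableOn.diffContOnCl fun z hz => ?_) fun z hz => ?_
    · refine h3.trans (le_of_eq ?_)
      field_simp
    · rw [closure_ball _ (by positivity)] at hz
      exact (differentiableAt_eta (by linarith [(hsph z hz).2.1])).differentiableWithinAt
    · obtain ⟨k1, k2, k3⟩ := hsph z (Metric.sphere_subset_closedBall hz)
      exact (h z (by linarith) (k1.trans k2)).2.trans (by gcongr)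
  refine ⟨3 * C, by positivity, fun v hv => (hb v hv).trans ?_, fun v u hv hu => ?_⟩
  · have : 0 ≤ min 1 v := le_min zero_le_one hv.le
    nlinarith [mul_nonneg hC.le this]
  · rw [norm_sub_rev]
    rcases le_total 1 u with h1 | h1
    · rw [min_eq_left h1]
      refine (norm_sub_le _ _).trans ?_
      have h2 := (hb v hv).trans (mul_le_of_le_one_right hC.le (min_le_left _ _))
      have h3 := (hb (v + u) (by linarith)).trans (mul_le_of_le_one_right hC.le (min_le_left _ _))
      linarith
    · rw [min_eq_right h1]
      have h2 := (convex_Ioi (0 : ℝ)).norm_image_sub_le_of_norm_hasDerivWithin_le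
        (f := fun v : ℝ => eta ((x : ℝ) + v * Complex.I)) (C := 3 * C)
        (fun w hw => (hasDerivAt_eta_vertical x hw).hasDerivWithinAt) (fun w hw => by
          rw [norm_mul, Complex.norm_I, mul_one]
          exact hd w hw) (x := v) (y := v + u) hv (show 0 < v + u by linarith)
      simpa [abs_of_pos hu] using h2

end EtaDecay

/-! ### The Eichler integral of the eta function and its boundary values -/

section EichlerIntegral

open MeasureTheory
open ModularForm (eta)

/-- The majorant of the Eichler integrals: `u ^ (-1/2)` near `0` and `u ^ (-3/2)` near infinity. -/
lemma integrableOn_min_mul_rpow :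
    IntegrableOn (fun u : ℝ => min 1 u * u ^ (-(3 / 2) : ℝ)) (Set.Ioi 0) := by
  rw [← Set.Ioc_union_Ioi_eq_Ioi zero_le_one]
  refine IntegrableOn.union ?_ ?_
  · have h1 : IntegrableOn (fun u : ℝ => u ^ (-(1 / 2) : ℝ)) (Set.Ioc 0 1) := by
      rw [integrableOn_Ioc_iff_integrableOn_Ioo, intervalIntegral.integrableOn_Ioo_rpow_iff one_pos]
      norm_num
    refine h1.congr_fun (fun u hu => ?_) measurableSet_Ioc
    beta_reduce
    rw [min_eq_right hu.2]
    nth_rewrite 2 [← Real.rpow_one u]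
    rw [← Real.rpow_add hu.1]
    norm_num
  · have h1 := integrableOn_Ioi_rpow_of_lt (a := -(3 / 2 : ℝ)) (by norm_num) one_pos
    refine h1.congr_fun (fun u hu => ?_) measurableSet_Ioi
    have hu : 1 < u := hu
    beta_reduce
    rw [min_eq_left hu.le, one_mul]

lemma continuousOn_rpow_Ioi (s : ℝ) : ContinuousOn (fun u : ℝ => u ^ s) (Set.Ioi 0) :=
  fun u hu => (Real.continuousAt_rpow_const u s (Or.inl (ne_of_gt hu))).continuousWithinAt

/-- A continuous function of size `O(min (1, u))` is integrable against `u ^ (-3/2)`. -/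
lemma integrableOn_rpow_mul {E : Type*} [NormedAddCommGroup E] [NormedSpace ℝ E] {g : ℝ → E}
    (hg : ContinuousOn g (Set.Ioi 0)) {C : ℝ} (hC : ∀ u, 0 < u → ‖g u‖ ≤ C * min 1 u) :
    IntegrableOn (fun u : ℝ => u ^ (-(3 / 2) : ℝ) • g u) (Set.Ioi 0) := by
  refine Integrable.mono' (integrableOn_min_mul_rpow.const_mul C)
    (((continuousOn_rpow_Ioi _).smul hg).aestronglyMeasurable measurableSet_Ioi) ?_
  filter_upwards [ae_restrict_mem measurableSet_Ioi] with u hu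
  have hu : 0 < u := hu
  have h1 : 0 ≤ u ^ (-(3 / 2) : ℝ) := Real.rpow_nonneg hu.le _
  rw [norm_smul, Real.norm_of_nonneg h1]
  calc _ ≤ u ^ (-(3 / 2) : ℝ) * (C * min 1 u) := by gcongr; exact hC u hu
    _ = _ := by ring

/-- The constant `∫_0^∞ (1 - e^{-u}) u^{-3/2} du`. Its value `2 √π` plays no role, only that it is
positive. -/
noncomputable def sqrtKernelConst : ℝ :=
  ∫ u in Set.Ioi (0 : ℝ), u ^ (-(3 / 2) : ℝ) * (1 - Real.exp (-u))

lemma one_sub_exp_neg_mul_le {s : ℝ} (hs : 0 < s) {u : ℝ} (hu : 0 < u) :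
    ‖1 - Real.exp (-(s * u))‖ ≤ max 1 s * min 1 u := by
  have h1 : Real.exp (-(s * u)) ≤ 1 := Real.exp_le_one_iff.2 (by
    have := mul_pos hs hu
    linarith)
  rw [Real.norm_of_nonneg (by linarith)]
  have h2 := Real.add_one_le_exp (-(s * u))
  rcases le_total 1 u with h | h
  · rw [min_eq_left h, mul_one]
    exact le_max_of_le_left (by linarith [Real.exp_pos (-(s * u))])
  · rw [min_eq_right h]
    have : s * u ≤ max 1 s * u := by gcongr; exact le_max_right _ _
    linarith

lemma integrableOn_rpow_mul_one_sub_exp {s : ℝ} (hs : 0 < s) :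
    IntegrableOn (fun u : ℝ => u ^ (-(3 / 2) : ℝ) * (1 - Real.exp (-(s * u)))) (Set.Ioi 0) :=
  integrableOn_rpow_mul (g := fun u : ℝ => 1 - Real.exp (-(s * u)))
    (Continuous.continuousOn (by fun_prop)) fun _ hu => one_sub_exp_neg_mul_le hs hu

lemma sqrtKernelConst_pos : 0 < sqrtKernelConst := by
  have hpos : ∀ u ∈ Set.Ioi (0 : ℝ), 0 < u ^ (-(3 / 2) : ℝ) * (1 - Real.exp (-u)) := by
    intro u hu
    have hu : 0 < u := hu
    have : Real.exp (-u) < 1 := Real.exp_lt_one_iff.2 (by linarith)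
    exact mul_pos (Real.rpow_pos_of_pos hu _) (by linarith)
  have hint := integrableOn_rpow_mul_one_sub_exp one_pos
  simp only [one_mul] at hint
  rw [sqrtKernelConst, setIntegral_pos_iff_support_of_nonneg_ae _ hint]
  · refine lt_of_lt_of_le ?_ (measure_mono (s := Set.Ioi (0 : ℝ)) fun u hu => ⟨(hpos u hu).ne', hu⟩)
    simp
  · filter_upwards [ae_restrict_mem measurableSet_Ioi] with u hu using (hpos u hu).le

/-- The square root as an integral of exponentials. -/
lemma integral_rpow_mul_one_sub_exp {s : ℝ} (hs : 0 < s) :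
    ∫ u in Set.Ioi (0 : ℝ), u ^ (-(3 / 2) : ℝ) * (1 - Real.exp (-(s * u)))
      = √s * sqrtKernelConst := by
  have h := integral_comp_mul_left_Ioi' (fun u : ℝ => u ^ (-(3 / 2) : ℝ) * (1 - Real.exp (-u))) 0 hs
  rw [mul_zero] at h
  rw [sqrtKernelConst, ← h, smul_eq_mul, ← integral_const_mul, ← integral_const_mul]
  refine setIntegral_congr_fun measurableSet_Ioi fun u hu => ?_
  have hu : 0 < u := hu
  have h1 : √s * (s * s ^ (-(3 / 2) : ℝ)) = 1 := by
    nth_rewrite 2 [← Real.rpow_one s]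
    rw [Real.sqrt_eq_rpow, ← Real.rpow_add hs, ← Real.rpow_add hs]
    norm_num
  rw [Real.mul_rpow hs.le hu.le]
  linear_combination -(u ^ (-(3 / 2) : ℝ) * (1 - Real.exp (-(s * u)))) * h1

/-- The term `e(ν² z / 24)` of the theta series of `η`. -/
noncomputable def thetaExp (ν : ℕ) (z : ℂ) : ℂ := expTwoPiI ((ν : ℂ) ^ 2 * (z / 24))

lemma thetaExp_add_mul_I (ν : ℕ) (z : ℂ) (u : ℝ) : thetaExp ν (z + u * Complex.I)
    = thetaExp ν z * (Real.exp (-(Real.pi / 12 * ν ^ 2 * u)) : ℝ) := by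
  rw [thetaExp, thetaExp, expTwoPiI, expTwoPiI, Complex.ofReal_exp, ← Complex.exp_add]
  congr 1
  push_cast
  linear_combination ((ν : ℂ) ^ 2 * Real.pi * u / 12) * Complex.I_mul_I

lemma norm_thetaExp (ν : ℕ) (z : ℂ) :
    ‖thetaExp ν z‖ = Real.exp (-(Real.pi / 12 * ν ^ 2 * z.im)) := by
  rw [thetaExp, norm_expTwoPiI, ← Nat.cast_pow, ← Complex.ofReal_natCast, Complex.im_ofReal_mul]
  have : (z / 24).im = z.im / 24 := by simp
  rw [this]
  push_cast
  ring_nf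

lemma summable_mul_norm_thetaExp {z : ℂ} (hz : 0 < z.im) (j : ℕ) :
    Summable fun k : ℕ => ((6 * k + j : ℕ) : ℝ) * ‖thetaExp (6 * k + j) z‖ := by
  have hr0 : 0 < Real.exp (-(Real.pi / 12 * z.im)) := Real.exp_pos _
  have hr : ‖Real.exp (-(Real.pi / 12 * z.im))‖ < 1 := by
    rw [Real.norm_of_nonneg hr0.le, Real.exp_lt_one_iff]
    have : 0 < Real.pi / 12 * z.im := by positivity
    linarith
  have h1 := summable_pow_mul_geometric_of_norm_lt_one 1 hr
  have hinj : Function.Injective fun k : ℕ => 6 * k + j := fun a b h => by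
    simp only at h
    omega
  refine Summable.of_nonneg_of_le (fun k => by positivity) (fun k => ?_) (h1.comp_injective hinj)
  rw [Function.comp_apply, pow_one, norm_thetaExp, ← Real.exp_nat_mul]
  gcongr
  generalize 6 * k + j = ν
  have h2 : (ν : ℝ) ≤ (ν : ℝ) ^ 2 := by
    rcases Nat.eq_zero_or_pos ν with rfl | h
    · simp
    · have : (1 : ℝ) ≤ ν := by exact_mod_cast h
      nlinarith
  have h3 : 0 ≤ Real.pi / 12 * z.im := by positivity
  nlinarith

lemma summable_norm_thetaExp {z : ℂ} (hz : 0 < z.im) {j : ℕ} (hj : 1 ≤ j) :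
    Summable fun k : ℕ => ‖thetaExp (6 * k + j) z‖ := by
  refine Summable.of_nonneg_of_le (fun k => norm_nonneg _) (fun k => ?_)
    (summable_mul_norm_thetaExp hz j)
  refine le_mul_of_one_le_left (norm_nonneg _) ?_
  exact_mod_cast (by omega : 1 ≤ 6 * k + j)

lemma thetaExp_one (z : ℂ) (k : ℕ) :
    expTwoPiI (z / 24) * expTwoPiI z ^ pent k = thetaExp (6 * k + 1) z := by
  have h : (2 : ℂ) * (pent k : ℂ) = k * (3 * k + 1) := by exact_mod_cast two_mul_pent k
  rw [thetaExp, expTwoPiI, expTwoPiI, expTwoPiI, ← Complex.exp_nat_mul, ← Complex.exp_add]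
  congr 1
  push_cast
  linear_combination (Real.pi * Complex.I * z) * h

lemma thetaExp_five (z : ℂ) (k : ℕ) : expTwoPiI (z / 24) * (expTwoPiI z ^ pent k
    * expTwoPiI z ^ (2 * k + 1)) = thetaExp (6 * k + 5) z := by
  have h : (2 : ℂ) * (pent k : ℂ) = k * (3 * k + 1) := by exact_mod_cast two_mul_pent k
  rw [thetaExp, expTwoPiI, expTwoPiI, expTwoPiI, ← Complex.exp_nat_mul, ← Complex.exp_nat_mul,
    ← Complex.exp_add, ← Complex.exp_add]
  congr 1
  push_cast
  linear_combination (Real.pi * Complex.I * z) * h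

/-- The theta series of `η`, from the pentagonal number theorem. -/
lemma eta_eq_tsum {z : ℂ} (hz : 0 < z.im) :
    eta z = ∑' k : ℕ, (-1) ^ k * (thetaExp (6 * k + 1) z - thetaExp (6 * k + 5) z) := by
  have hq := norm_expTwoPiI_lt_one hz
  rw [eta_eq_qPochInf, ← (tsum_thetaTerm_one_and_pochTails hq).1, ← tsum_mul_left]
  refine tsum_congr fun k => ?_
  rw [← thetaExp_one, ← thetaExp_five, thetaTerm]
  ring

lemma summable_thetaExp_sub {z : ℂ} (hz : 0 < z.im) :
    Summable fun k : ℕ => (-1) ^ k * (thetaExp (6 * k + 1) z - thetaExp (6 * k + 5) z) := by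
  refine Summable.of_norm_bounded
    ((summable_norm_thetaExp hz le_rfl).add (summable_norm_thetaExp hz (j := 5) (by norm_num)))
    fun k => ?_
  rw [norm_mul, norm_pow, norm_neg, norm_one, one_pow, one_mul]
  exact norm_sub_le _ _

/-- The theta series of weight `3 / 2` obtained from that of `η` by inserting the factors `6k + 1`
and `6k + 5`. -/
noncomputable def thetaSeries (z : ℂ) : ℂ :=
  ∑' k : ℕ, (-1) ^ k * (((6 * k + 1 : ℕ) : ℂ) * thetaExp (6 * k + 1) z
    - ((6 * k + 5 : ℕ) : ℂ) * thetaExp (6 * k + 5) z)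

lemma summable_thetaSeries {z : ℂ} (hz : 0 < z.im) :
    Summable fun k : ℕ => (-1) ^ k * (((6 * k + 1 : ℕ) : ℂ) * thetaExp (6 * k + 1) z
      - ((6 * k + 5 : ℕ) : ℂ) * thetaExp (6 * k + 5) z) := by
  refine Summable.of_norm_bounded
    ((summable_mul_norm_thetaExp hz 1).add (summable_mul_norm_thetaExp hz 5)) fun k => ?_
  rw [norm_mul, norm_pow, norm_neg, norm_one, one_pow, one_mul]
  refine (norm_sub_le _ _).trans_eq ?_
  rw [norm_mul, norm_mul, Complex.norm_natCast, Complex.norm_natCast]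

/-- The exponents `3k` and `3k + 2` are `(ν - 1) / 2` for `ν = 6k + 1` and `ν = 6k + 5`. -/
lemma expTwoPiI_mul_thetaDeriv {z : ℂ} (hz : 0 < z.im) :
    expTwoPiI (z / 24) * thetaDeriv (expTwoPiI z) = (thetaSeries z - eta z) / 2 := by
  rw [thetaDeriv, ← tsum_mul_left, thetaSeries, eta_eq_tsum hz,
    ← (summable_thetaSeries hz).tsum_sub (summable_thetaExp_sub hz), ← tsum_div_const]
  refine tsum_congr fun k => ?_
  rw [← thetaExp_one, ← thetaExp_five]
  push_cast
  ring

/-- The factor between the theta series of weight `3 / 2` and the regularized Eichler integral. -/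
noncomputable def eichlerConst : ℝ := √(Real.pi / 12) * sqrtKernelConst

lemma eichlerConst_pos : 0 < eichlerConst := mul_pos (by positivity) sqrtKernelConst_pos

/-- The theta series of weight `3 / 2` as a regularized Eichler integral: the half-derivative
`ν ↦ ν e(ν² z / 24)` is realized by the square root kernel. -/
lemma integral_eta_sub_eq_thetaSeries {z : ℂ} (hz : 0 < z.im) :
    ∫ u in Set.Ioi (0 : ℝ), u ^ (-(3 / 2) : ℝ) • (eta z - eta (z + u * Complex.I))
      = eichlerConst * thetaSeries z := by
  set ker : ℕ → ℝ → ℝ := fun ν u =>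
    u ^ (-(3 / 2) : ℝ) * (1 - Real.exp (-(Real.pi / 12 * ν ^ 2 * u))) with hker
  have hs : ∀ ν : ℕ, 1 ≤ ν → 0 < Real.pi / 12 * (ν : ℝ) ^ 2 := fun ν hν => by
    have : 0 < ν := hν
    positivity
  have hint : ∀ ν : ℕ, 1 ≤ ν → IntegrableOn (ker ν) (Set.Ioi 0) := fun ν hν =>
    integrableOn_rpow_mul_one_sub_exp (hs ν hν)
  have hval : ∀ ν : ℕ, 1 ≤ ν → ∫ u in Set.Ioi (0 : ℝ), ker ν u = eichlerConst * ν := fun ν hν => by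
    rw [hker, integral_rpow_mul_one_sub_exp (hs ν hν), Real.sqrt_mul (by positivity),
      Real.sqrt_sq (by positivity), eichlerConst]
    ring
  have hvalC : ∀ ν : ℕ, 1 ≤ ν →
      ∫ u in Set.Ioi (0 : ℝ), ((ker ν u : ℝ) : ℂ) = ((eichlerConst * ν : ℝ) : ℂ) := fun ν hν =>
    (integral_ofReal (𝕜 := ℂ)).trans (congrArg _ (hval ν hν))
  set F : ℕ → ℝ → ℂ := fun k u => (-1) ^ k * (thetaExp (6 * k + 1) z * (ker (6 * k + 1) u : ℝ)
    - thetaExp (6 * k + 5) z * (ker (6 * k + 5) u : ℝ)) with hF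
  have hi : ∀ ν : ℕ, 1 ≤ ν → IntegrableOn (fun u => thetaExp ν z * (ker ν u : ℝ)) (Set.Ioi 0) :=
    fun ν hν => (hint ν hν).ofReal.const_mul _
  have hFint : ∀ k, IntegrableOn (F k) (Set.Ioi 0) := fun k =>
    ((hi _ (by omega)).sub (hi _ (by omega))).const_mul _
  have hFval : ∀ k, ∫ u in Set.Ioi (0 : ℝ), F k u = eichlerConst *
      ((-1) ^ k * (((6 * k + 1 : ℕ) : ℂ) * thetaExp (6 * k + 1) z
        - ((6 * k + 5 : ℕ) : ℂ) * thetaExp (6 * k + 5) z)) := by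
    intro k
    rw [hF, integral_const_mul, integral_sub (hi _ (by omega)) (hi _ (by omega)),
      integral_const_mul, integral_const_mul, hvalC _ (by omega), hvalC _ (by omega)]
    push_cast
    ring
  have hkn : ∀ ν : ℕ, ∀ u ∈ Set.Ioi (0 : ℝ), 0 ≤ ker ν u := fun ν u hu => by
    have hu : 0 < u := hu
    have : Real.exp (-(Real.pi / 12 * ν ^ 2 * u)) ≤ 1 := Real.exp_le_one_iff.2 (by
      have : 0 ≤ Real.pi / 12 * (ν : ℝ) ^ 2 * u := by positivity
      linarith)
    exact mul_nonneg (Real.rpow_nonneg hu.le _) (by linarith)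
  have hFnorm : ∀ k, ∫ u in Set.Ioi (0 : ℝ), ‖F k u‖ ≤ eichlerConst *
      (((6 * k + 1 : ℕ) : ℝ) * ‖thetaExp (6 * k + 1) z‖
        + ((6 * k + 5 : ℕ) : ℝ) * ‖thetaExp (6 * k + 5) z‖) := by
    intro k
    have h1 := (hint (6 * k + 1) (by omega)).const_mul ‖thetaExp (6 * k + 1) z‖
    have h2 := (hint (6 * k + 5) (by omega)).const_mul ‖thetaExp (6 * k + 5) z‖
    refine (setIntegral_mono_on (hFint k).norm (h1.add h2) measurableSet_Ioi fun u hu => ?_).trans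
      (le_of_eq ?_)
    · rw [hF, norm_mul, norm_pow, norm_neg, norm_one, one_pow, one_mul]
      refine (norm_sub_le _ _).trans_eq ?_
      rw [norm_mul, norm_mul, Complex.norm_real, Complex.norm_real,
        Real.norm_of_nonneg (hkn _ u hu), Real.norm_of_nonneg (hkn _ u hu)]
      rfl
    · rw [integral_add' h1 h2, integral_const_mul, integral_const_mul, hval _ (by omega),
        hval _ (by omega)]
      ring
  have hsum := hasSum_integral_of_summable_integral_norm hFint (Summable.of_nonneg_of_le
    (fun k => integral_nonneg fun u => norm_nonneg _) hFnorm
    (((summable_mul_norm_thetaExp hz 1).add (summable_mul_norm_thetaExp hz 5)).mul_left _))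
  rw [thetaSeries, ← tsum_mul_left, ← tsum_congr hFval, hsum.tsum_eq]
  refine setIntegral_congr_fun measurableSet_Ioi fun u hu => ?_
  have hu : 0 < u := hu
  have hzu : 0 < (z + u * Complex.I).im := by
    simp
    positivity
  rw [eta_eq_tsum hz, eta_eq_tsum hzu, ← (summable_thetaExp_sub hz).tsum_sub
    (summable_thetaExp_sub hzu), Complex.real_smul, ← tsum_mul_left]
  refine tsum_congr fun k => ?_
  rw [thetaExp_add_mul_I, thetaExp_add_mul_I, hF, hker]
  push_cast
  ring

/-- The Eichler integral `∫_0^∞ η(x + iu) u^{-3/2} du` of `η` along the vertical line over `x`. It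
converges for rational `x`. -/
noncomputable def eichlerIntegral (x : ℝ) : ℂ :=
  ∫ u in Set.Ioi (0 : ℝ), u ^ (-(3 / 2) : ℝ) • eta (x + u * Complex.I)

lemma continuousOn_eta_vertical (x : ℝ) :
    ContinuousOn (fun v : ℝ => eta (x + v * Complex.I)) (Set.Ioi 0) := fun _ hv =>
  (hasDerivAt_eta_vertical x hv).continuousAt.continuousWithinAt

lemma integrableOn_eichlerIntegral (x : ℚ) :
    IntegrableOn (fun u : ℝ => u ^ (-(3 / 2) : ℝ) • eta ((x : ℝ) + u * Complex.I)) (Set.Ioi 0) := by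
  obtain ⟨C, -, h, -⟩ := exists_norm_eta_vertical_le x
  exact integrableOn_rpow_mul (continuousOn_eta_vertical x) h

lemma eichlerIntegral_add_one (x : ℝ) :
    eichlerIntegral (x + 1) = expTwoPiI (1 / 24) * eichlerIntegral x := by
  rw [eichlerIntegral, eichlerIntegral, ← integral_const_mul]
  refine integral_congr_ae (Eventually.of_forall fun u => ?_)
  beta_reduce
  rw [show ((x + 1 : ℝ) : ℂ) + u * Complex.I = (x + u * Complex.I) + 1 by push_cast; ring,
    eta_add_one, mul_smul_comm]

lemma tendsto_eta_vertical (x : ℚ) :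
    Tendsto (fun y : ℝ => eta ((x : ℝ) + y * Complex.I)) (𝓝[>] 0) (𝓝 0) := by
  obtain ⟨C, hC, h, -⟩ := exists_norm_eta_vertical_le x
  refine squeeze_zero_norm' (a := fun y : ℝ => C * y) ?_ ?_
  · filter_upwards [self_mem_nhdsWithin] with y hy
    exact (h y hy).trans (by gcongr; exact min_le_right _ _)
  · exact ((by fun_prop : Continuous fun y : ℝ => C * y).tendsto' 0 0 (by simp)).mono_left
      nhdsWithin_le_nhds

/-- The boundary value of the theta series of weight `3 / 2`: as `η` vanishes at rational points,
only the second half of the regularized Eichler integral survives. -/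
lemma tendsto_thetaSeries (x : ℚ) :
    Tendsto (fun y : ℝ => eichlerConst * thetaSeries ((x : ℝ) + y * Complex.I)) (𝓝[>] 0)
      (𝓝 (-eichlerIntegral x)) := by
  obtain ⟨C, hC, -, h⟩ := exists_norm_eta_vertical_le x
  have hlim : Tendsto (fun y : ℝ => ∫ u in Set.Ioi (0 : ℝ), u ^ (-(3 / 2) : ℝ) •
      (eta ((x : ℝ) + y * Complex.I) - eta ((x : ℝ) + (y + u : ℝ) * Complex.I))) (𝓝[>] 0)
      (𝓝 (∫ u in Set.Ioi (0 : ℝ), u ^ (-(3 / 2) : ℝ) •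
        (0 - eta ((x : ℝ) + u * Complex.I)))) := by
    refine tendsto_integral_filter_of_dominated_convergence
      (fun u => C * (min 1 u * u ^ (-(3 / 2) : ℝ))) ?_ ?_
      (integrableOn_min_mul_rpow.const_mul C) ?_
    · filter_upwards [self_mem_nhdsWithin] with y hy
      have hy : 0 < y := hy
      refine ContinuousOn.aestronglyMeasurable ?_ measurableSet_Ioi
      refine (continuousOn_rpow_Ioi _).smul (continuousOn_const.sub ?_)
      refine (continuousOn_eta_vertical x).comp (f := fun u : ℝ => y + u) (by fun_prop)
        fun u hu => ?_
      have hu : 0 < u := hu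
      exact add_pos hy hu
    · filter_upwards [self_mem_nhdsWithin] with y hy
      filter_upwards [ae_restrict_mem measurableSet_Ioi] with u hu
      have hu : 0 < u := hu
      have h1 : 0 ≤ u ^ (-(3 / 2) : ℝ) := Real.rpow_nonneg hu.le _
      rw [norm_smul, Real.norm_of_nonneg h1]
      calc _ ≤ u ^ (-(3 / 2) : ℝ) * (C * min 1 u) := by gcongr; exact h y u hy hu
        _ = _ := by ring
    · filter_upwards [ae_restrict_mem measurableSet_Ioi] with u hu
      refine ((tendsto_eta_vertical x).sub ?_).const_smul _
      have h1 : Tendsto (fun y : ℝ => y + u) (𝓝[>] 0) (𝓝 u) :=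
        ((by fun_prop : Continuous fun y : ℝ => y + u).tendsto' 0 u (by simp)).mono_left
          nhdsWithin_le_nhds
      exact ((hasDerivAt_eta_vertical x hu).continuousAt.tendsto).comp h1
  have hval : ∫ u in Set.Ioi (0 : ℝ), u ^ (-(3 / 2) : ℝ) •
      (0 - eta ((x : ℝ) + u * Complex.I)) = -eichlerIntegral x := by
    rw [eichlerIntegral, ← integral_neg]
    simp only [zero_sub, smul_neg]
  rw [hval] at hlim
  refine hlim.congr' ?_
  filter_upwards [self_mem_nhdsWithin] with y hy
  rw [← integral_eta_sub_eq_thetaSeries (by simpa using hy)]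
  refine integral_congr_ae (Eventually.of_forall fun u => ?_)
  beta_reduce
  rw [show ((x : ℝ) : ℂ) + (y + u : ℝ) * Complex.I = (x : ℝ) + y * Complex.I + u * Complex.I by
    push_cast; ring]

/-- The cuspidal decay of `η` outweighs the growth of the Lambert series. -/
lemma tendsto_eta_mul_lambertSum (x : ℚ) :
    Tendsto (fun y : ℝ => eta ((x : ℝ) + y * Complex.I)
      * lambertSum (expTwoPiI ((x : ℝ) + y * Complex.I))) (𝓝[>] 0) (𝓝 0) := by
  have hpi := Real.pi_pos
  obtain ⟨C, hC, h⟩ := exists_norm_eta_le_im_pow x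
  refine squeeze_zero_norm' (a := fun y : ℝ => C / Real.pi ^ 2 * y) ?_ ?_
  · filter_upwards [Ioo_mem_nhdsGT (inv_pos.2 Real.two_pi_pos)] with y hy
    obtain ⟨hy, hy'⟩ := hy
    have h2 : 2 * Real.pi * y ≤ 1 := by
      have := mul_le_mul_of_nonneg_left hy'.le Real.two_pi_pos.le
      rwa [mul_inv_cancel₀ Real.two_pi_pos.ne'] at this
    have hy1 : y ≤ 1 := by nlinarith [Real.pi_gt_three]
    have him : (((x : ℝ) : ℂ) + y * Complex.I).im = y := by simp
    have h3 := h ((x : ℝ) + y * Complex.I) (by rw [him]; exact hy) (by rw [him]; exact hy1)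
      (by rw [him]; simpa using hy.le)
    rw [him] at h3
    have h4 := norm_lambertSum_le (norm_expTwoPiI_lt_one (z := ((x : ℝ) : ℂ) + y * Complex.I)
      (by rw [him]; exact hy))
    rw [norm_expTwoPiI, him] at h4
    have h5 := half_le_one_sub_exp_neg (t := 2 * Real.pi * y) (by positivity) h2
    rw [show 2 * Real.pi * y / 2 = Real.pi * y by ring] at h5
    rw [norm_mul]
    calc _ ≤ C * y ^ 3 * (Real.pi * y)⁻¹ ^ 2 := by
          have h6 : 0 < Real.pi * y := by positivity
          gcongr
          exact h4.trans (pow_le_pow_left₀ (inv_nonneg.2 (h6.le.trans h5)) (inv_anti₀ h6 h5) 2)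
      _ = _ := by field_simp
  · exact ((by fun_prop : Continuous fun y : ℝ => C / Real.pi ^ 2 * y).tendsto' 0 0
      (by simp)).mono_left nhdsWithin_le_nhds

/-- The common non-analytic part of the boundary values attached to `A_5` and `A_7`. -/
noncomputable def eichlerValue (x : ℚ) : ℂ := eichlerIntegral x / (2 * eichlerConst)

lemma tendsto_half_thetaSeries (x : ℚ) :
    Tendsto (fun y : ℝ => -(thetaSeries ((x : ℝ) + y * Complex.I)
      - eta ((x : ℝ) + y * Complex.I)) / 2) (𝓝[>] 0) (𝓝 (eichlerValue x)) := by
  have h0 : (eichlerConst : ℂ) ≠ 0 := by exact_mod_cast eichlerConst_pos.ne'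
  have h1 := (((tendsto_thetaSeries x).div_const (eichlerConst : ℂ)).sub
    (tendsto_eta_vertical x)).neg.div_const 2
  have h2 : -(-eichlerIntegral x / eichlerConst - 0) / 2 = eichlerValue x := by
    rw [eichlerValue]
    field_simp
    ring
  rw [h2] at h1
  refine h1.congr fun y => ?_
  rw [mul_div_cancel_left₀ _ h0]

/-- In the closed form of `H_{A_5}` the product of `η` and the Lambert series does not contribute in
the limit. -/
lemma isBoundaryValue_HA_five : IsBoundaryValue
    (fun τ : ℂ => expTwoPiI (τ / 24) *
      (expTwoPiI τ * qPochInf (expTwoPiI τ) ^ 3 * HA 5 (expTwoPiI τ))) eichlerValue := by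
  intro x
  have h1 := (tendsto_half_thetaSeries x).sub (tendsto_eta_mul_lambertSum x)
  rw [sub_zero] at h1
  refine h1.congr' ?_
  filter_upwards [self_mem_nhdsWithin] with y hy
  have hz : 0 < (((x : ℝ) : ℂ) + y * Complex.I).im := by simpa using hy
  rw [← Complex.ofReal_ratCast, HA_five (norm_expTwoPiI_lt_one hz) (Complex.exp_ne_zero _),
    (tsum_thetaTerm_one_and_pochTails (norm_expTwoPiI_lt_one hz)).2, mul_sub,
    expTwoPiI_mul_thetaDeriv hz, eta_eq_qPochInf]
  ring

/-- In the closed form of `H_{A_7}` the Lambert series cancels against the one in the sum of tails.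
-/
lemma isBoundaryValue_HA_seven : IsBoundaryValue
    (fun τ : ℂ => expTwoPiI (τ / 24) *
      (expTwoPiI τ * (1 - expTwoPiI τ) * qPochInf (expTwoPiI τ) ^ 4 * HA 7 (expTwoPiI τ)))
    fun x => eichlerValue x - expTwoPiI (x / 24) := by
  intro x
  have h2 : Tendsto (fun y : ℝ => expTwoPiI ((((x : ℝ) : ℂ) + y * Complex.I) / 24)) (𝓝[>] 0)
      (𝓝 (expTwoPiI (x / 24))) := by
    have : Continuous fun y : ℝ => expTwoPiI ((((x : ℝ) : ℂ) + y * Complex.I) / 24) := by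
      unfold expTwoPiI
      fun_prop
    have := this.tendsto 0
    simp only [Complex.ofReal_zero, zero_mul, add_zero, Complex.ofReal_ratCast] at this
    simpa only [Complex.ofReal_ratCast] using this.mono_left nhdsWithin_le_nhds
  have h1 := ((tendsto_half_thetaSeries x).sub h2).add (tendsto_eta_vertical x)
  rw [add_zero] at h1
  refine h1.congr' ?_
  filter_upwards [self_mem_nhdsWithin] with y hy
  have hz : 0 < (((x : ℝ) : ℂ) + y * Complex.I).im := by simpa using hy
  rw [← Complex.ofReal_ratCast, HA_seven (norm_expTwoPiI_lt_one hz) (Complex.exp_ne_zero _),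
    (tsum_thetaTerm_one_and_pochTails (norm_expTwoPiI_lt_one hz)).2, eta_eq_qPochInf]
  have h3 := expTwoPiI_mul_thetaDeriv hz
  rw [eta_eq_qPochInf] at h3
  linear_combination h3

end EichlerIntegral

/-! ### The transformation of the Eichler integral under inversion -/

section EichlerInversion

open MeasureTheory
open ModularForm (eta)

/-- The fundamental theorem of calculus on the half-line `(0, ∞)`, with symmetric cut-offs. -/
lemma tendsto_sub_of_hasDerivAt_Ioi {E : Type*} [NormedAddCommGroup E] [NormedSpace ℝ E]
    [CompleteSpace E] {f f' : ℝ → E}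
    (hf : ∀ u, 0 < u → HasDerivAt f (f' u) u) (hi : IntegrableOn f' (Set.Ioi 0)) :
    Tendsto (fun N : ℝ => f N - f N⁻¹) atTop (𝓝 (∫ u in Set.Ioi (0 : ℝ), f' u)) := by
  have hcov : AECover (volume.restrict (Set.Ioi (0 : ℝ))) atTop fun N : ℝ => Set.Ioc N⁻¹ N :=
    (aecover_Ioi_of_Ioi tendsto_inv_atTop_zero).inter (aecover_Iic tendsto_id)
  refine (hcov.integral_tendsto_of_countably_generated hi).congr' ?_
  filter_upwards [eventually_ge_atTop (1 : ℝ)] with N hN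
  have hN0 : 0 < N⁻¹ := by positivity
  have hle : N⁻¹ ≤ N := (inv_le_one_of_one_le₀ hN).trans hN
  have hsub : Set.Ioc N⁻¹ N ⊆ Set.Ioi 0 := fun u hu => hN0.trans hu.1
  rw [Measure.restrict_restrict measurableSet_Ioc, Set.inter_eq_left.2 hsub,
    ← intervalIntegral.integral_of_le hle]
  refine intervalIntegral.integral_eq_sub_of_hasDerivAt (fun u hu => hf u ?_) ?_
  · rw [Set.uIcc_of_le hle] at hu
    exact hN0.trans_le hu.1
  · rw [intervalIntegrable_iff_integrableOn_Ioc_of_le hle]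
    exact hi.mono_set hsub

/-- The kernel `w ↦ w^{-3/2}` of the Eichler integral, with the principal branch. -/
noncomputable def eichlerKernel (w : ℂ) : ℂ := w ^ ((-(3 / 2) : ℝ) : ℂ)

lemma eichlerKernel_ofReal {u : ℝ} (hu : 0 ≤ u) :
    eichlerKernel u = ((u ^ (-(3 / 2) : ℝ) : ℝ) : ℂ) := (Complex.ofReal_cpow hu _).symm

lemma norm_eichlerKernel (w : ℂ) : ‖eichlerKernel w‖ = ‖w‖ ^ (-(3 / 2) : ℝ) :=
  Complex.norm_cpow_real _ _

lemma norm_eichlerKernel_le {w : ℂ} {r : ℝ} (hr : 0 < r) (h : r ≤ ‖w‖) :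
    ‖eichlerKernel w‖ ≤ r ^ (-(3 / 2) : ℝ) := by
  rw [norm_eichlerKernel]
  exact Real.rpow_le_rpow_of_nonpos hr h (by norm_num)

lemma eichlerKernel_mul_sq {w : ℂ} (hw : w ≠ 0) : eichlerKernel w * w ^ 2 = w ^ (1 / 2 : ℂ) := by
  rw [eichlerKernel, ← Complex.cpow_ofNat w 2, ← Complex.cpow_add _ _ hw]
  congr 1
  push_cast
  norm_num

/-- The holomorphic differential whose integrals over the vertical line at `x` and over its images
are the Eichler integrals. -/
noncomputable def eichlerForm (x : ℝ) (τ : ℂ) : ℂ :=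
  eta τ * eichlerKernel (-Complex.I * (τ - x))

lemma differentiableAt_eichlerForm (x : ℝ) {τ : ℂ} (hτ : 0 < τ.im) :
    DifferentiableAt ℂ (eichlerForm x) τ := by
  refine (differentiableAt_eta hτ).mul ?_
  refine DifferentiableAt.cpow_const (by fun_prop) (Or.inl ?_)
  simpa using hτ

lemma exists_primitive_eichlerForm (x : ℝ) :
    ∃ Φ : ℂ → ℂ, ∀ τ : ℂ, 0 < τ.im → HasDerivAt Φ (eichlerForm x τ) τ := by
  obtain ⟨Φ, hΦ⟩ := (convex_halfSpace_im_gt 0).exists_forall_hasDerivWithinAt (𝕜 := ℂ)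
    (f := eichlerForm x) fun τ hτ => (differentiableAt_eichlerForm x hτ).differentiableWithinAt
  exact ⟨Φ, fun τ hτ => (hΦ τ hτ).hasDerivAt
    ((isOpen_lt continuous_const Complex.continuous_im).mem_nhds hτ)⟩

lemma eichlerForm_vertical (x : ℝ) {u : ℝ} (hu : 0 < u) :
    eichlerForm x (x + u * Complex.I) = u ^ (-(3 / 2) : ℝ) • eta (x + u * Complex.I) := by
  rw [eichlerForm, show -Complex.I * ((x : ℂ) + u * Complex.I - x) = u by
    linear_combination -(u : ℂ) * Complex.I_mul_I, eichlerKernel_ofReal hu.le, Complex.real_smul,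
    mul_comm]

lemma one_sub_I_mul_ne_zero (x s : ℝ) : (1 : ℂ) - Complex.I * s * x ≠ 0 := fun h => by
  simpa using congrArg Complex.re h

/-- The image of the vertical line at `-1 / x` under inversion, a semicircle from `x` to `0`. -/
noncomputable def semicircle (x s : ℝ) : ℂ := x / (1 - Complex.I * s * x)

lemma semicircle_eq (x s : ℝ) :
    semicircle x s = ((x / (1 + (s * x) ^ 2) : ℝ) : ℂ)
      + ((s * x ^ 2 / (1 + (s * x) ^ 2) : ℝ) : ℂ) * Complex.I := by
  have h : (1 : ℂ) + ((s : ℂ) * x) ^ 2 ≠ 0 := by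
    have : (1 + (s * x) ^ 2 : ℝ) ≠ 0 := by positivity
    exact_mod_cast this
  rw [semicircle, div_eq_iff (one_sub_I_mul_ne_zero x s)]
  push_cast
  rw [← mul_div_right_comm, ← add_div, div_mul_eq_mul_div, eq_div_iff h]
  linear_combination ((s : ℂ) ^ 2 * x ^ 3) * Complex.I_sq

lemma semicircle_re (x s : ℝ) : (semicircle x s).re = x / (1 + (s * x) ^ 2) := by
  rw [semicircle_eq, Complex.add_re, Complex.ofReal_re, Complex.re_ofReal_mul, Complex.I_re,
    mul_zero, add_zero]

lemma semicircle_im (x s : ℝ) : (semicircle x s).im = s * x ^ 2 / (1 + (s * x) ^ 2) := by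
  rw [semicircle_eq, Complex.add_im, Complex.ofReal_im, Complex.im_ofReal_mul, Complex.I_im,
    mul_one, zero_add]

lemma hasDerivAt_semicircle (x s : ℝ) : HasDerivAt (semicircle x)
    (Complex.I * x ^ 2 / (1 - Complex.I * s * x) ^ 2) s := by
  have h1 : HasDerivAt (fun s : ℝ => (1 : ℂ) - Complex.I * s * x) (-(Complex.I * x)) s := by
    have := (((Complex.ofRealCLM.hasDerivAt (x := s)).const_mul Complex.I).mul_const
      (x : ℂ)).const_sub 1
    simpa using this
  convert! (h1.fun_inv (one_sub_I_mul_ne_zero x s)).const_mul (x : ℂ) using 1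
  ring

/-- The pull-back of the differential to the semicircle is, up to a constant factor, the integrand
of the Eichler integral at `-1 / x`, by the transformation of `η`. All square roots involved are
taken in the closed right half-plane, where they are multiplicative. -/
lemma eichlerForm_semicircle {x s : ℝ} (hx : 0 < x) (hs : 0 < s) :
    eichlerForm x (semicircle x s) * (Complex.I * x ^ 2 / (1 - Complex.I * s * x) ^ 2)
      = Complex.I * (Complex.I ^ (1 / 2 : ℂ) * ((x ^ (-(3 / 2) : ℝ) : ℝ) : ℂ)) *
        (s ^ (-(3 / 2) : ℝ) • eta ((-1 / x : ℝ) + s * Complex.I)) := by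
  have hr := one_sub_I_mul_ne_zero x s
  set r : ℂ := 1 - Complex.I * s * x with hrdef
  have hx0 : (x : ℂ) ≠ 0 := by exact_mod_cast hx.ne'
  have hs0 : (s : ℂ) ≠ 0 := by exact_mod_cast hs.ne'
  -- The semicircle is the image of `z = -1/x + is` under `z ↦ -1/z`.
  set z : ℂ := (-1 / x : ℝ) + s * Complex.I with hz
  have hzim : 0 < z.im := by simpa [hz] using hs
  have hz0 : z ≠ 0 := fun h => by simp [h] at hzim
  have hrz : r = -(x * z) := by
    rw [hrdef, hz]
    push_cast
    field_simp
    ring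
  have hγ : semicircle x s = -z⁻¹ := by
    rw [semicircle, ← hrdef, hrz]
    field_simp
  set w : ℂ := -Complex.I * (semicircle x s - x) with hw
  have hwre : 0 < w.re := by
    have : w.re = (semicircle x s).im := by simp [hw]
    rw [this, semicircle_im]
    positivity
  have hw0 : w ≠ 0 := fun h => by simp [h] at hwre
  have hwr : w * r = s * x ^ 2 := by
    have : semicircle x s * r = x := div_mul_cancel₀ _ hr
    rw [hw]
    linear_combination (-Complex.I) * this + Complex.I * x * hrdef - s * x ^ 2 * Complex.I_sq
  have hprod : (-Complex.I * z) * w = Complex.I * ((s * x : ℝ) : ℂ) := by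
    refine mul_right_cancel₀ hx0 ?_
    push_cast
    linear_combination Complex.I * hwr - Complex.I * w * hrz
  have h1 : (-Complex.I * z) ^ (1 / 2 : ℂ) * (eichlerKernel w * w ^ 2) = Complex.I ^ (1 / 2 : ℂ) *
      (eichlerKernel ((s * x : ℝ) : ℂ) * ((s * x : ℝ) : ℂ) ^ 2) := by
    rw [eichlerKernel_mul_sq hw0, eichlerKernel_mul_sq (by exact_mod_cast (mul_pos hs hx).ne'),
      ← cpow_half_mul (by simpa using hzim.le) (by simpa using hz0) hwre, hprod,
      cpow_half_mul (by simp) Complex.I_ne_zero (by simpa using mul_pos hs hx)]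
  rw [eichlerKernel_ofReal (mul_pos hs hx).le, Real.mul_rpow hs.le hx.le] at h1
  rw [eichlerForm, ← hw, hγ, eta_neg_inv hzim, Complex.real_smul]
  have h2 : (x : ℂ) ^ 2 / r ^ 2 = w ^ 2 / ((s : ℂ) * x) ^ 2 := by
    rw [div_eq_div_iff (pow_ne_zero 2 hr) (pow_ne_zero 2 (mul_ne_zero hs0 hx0))]
    linear_combination (-(w * r) - s * x ^ 2) * hwr
  rw [mul_div_assoc, h2]
  have h3 : (-Complex.I * z) ^ (1 / 2 : ℂ) * (eichlerKernel w * w ^ 2) / ((s : ℂ) * x) ^ 2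
      = Complex.I ^ (1 / 2 : ℂ)
        * (((s ^ (-(3 / 2) : ℝ) : ℝ) : ℂ) * ((x ^ (-(3 / 2) : ℝ) : ℝ) : ℂ)) := by
    rw [h1, div_eq_iff (pow_ne_zero 2 (mul_ne_zero hs0 hx0))]
    push_cast
    ring
  clear_value w
  linear_combination (eta z * Complex.I) * h3

/-- The mean value inequality for a primitive of the differential, on a convex set. -/
lemma norm_primitive_sub_le {x : ℝ} {Φ : ℂ → ℂ}
    (hΦ : ∀ τ : ℂ, 0 < τ.im → HasDerivAt Φ (eichlerForm x τ) τ) {S : Set ℂ} (hS : Convex ℝ S)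
    (hpos : ∀ τ ∈ S, 0 < τ.im) {K : ℝ} (hK : ∀ τ ∈ S, ‖eichlerForm x τ‖ ≤ K) {p q : ℂ}
    (hp : p ∈ S) (hq : q ∈ S) : ‖Φ q - Φ p‖ ≤ K * ‖q - p‖ :=
  hS.norm_image_sub_le_of_norm_hasDerivWithin_le
    (fun τ hτ => (hΦ τ (hpos τ hτ)).hasDerivWithinAt) hK hp hq

lemma norm_eichlerForm_le {x r : ℝ} {τ : ℂ} (hr : 0 < r) (h : r ≤ ‖τ - x‖) :
    ‖eichlerForm x τ‖ ≤ ‖eta τ‖ * r ^ (-(3 / 2) : ℝ) := by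
  rw [eichlerForm, norm_mul]
  gcongr
  refine norm_eichlerKernel_le hr ?_
  rwa [norm_mul, norm_neg, Complex.norm_I, one_mul]

/-- The cone with vertex `a` and a right angle as aperture, where the decay of `η` is known. -/
lemma convex_cone (a : ℝ) : Convex ℝ {τ : ℂ | 0 < τ.im ∧ |τ.re - a| ≤ τ.im} := by
  have h := ((convex_halfSpace_im_gt 0).inter
    (convex_halfSpace_le (Complex.reLm - Complex.imLm).isLinear a)).inter
    (convex_halfSpace_ge (Complex.reLm + Complex.imLm).isLinear a)
  convert h using 1
  ext τ
  simp only [Set.mem_ofPred_eq, Set.mem_inter_iff, abs_le, LinearMap.sub_apply,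
    LinearMap.add_apply, Complex.reLm_coe, Complex.imLm_coe]
  constructor
  · rintro ⟨h1, h2, h3⟩
    exact ⟨⟨h1, by linarith⟩, by linarith⟩
  · rintro ⟨⟨h1, h2⟩, h3⟩
    exact ⟨h1, by linarith, by linarith⟩

lemma tendsto_vertical_inv (a : ℝ) :
    Tendsto (fun N : ℝ => (a : ℂ) + (N⁻¹ : ℝ) * Complex.I) atTop (𝓝 a) := by
  have h : Continuous fun s : ℝ => (a : ℂ) + s * Complex.I := by fun_prop
  exact (h.tendsto' 0 a (by simp)).comp tendsto_inv_atTop_zero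

/-- At the common end point `x` of the vertical line and the semicircle the cuspidal decay of `η`
outweighs the singularity of the kernel. -/
lemma tendsto_primitive_at_right {x : ℚ} (hx : 0 < x) {Φ : ℂ → ℂ}
    (hΦ : ∀ τ : ℂ, 0 < τ.im → HasDerivAt Φ (eichlerForm x τ) τ) :
    Tendsto (fun N : ℝ => Φ ((x : ℝ) + (N⁻¹ : ℝ) * Complex.I) - Φ (semicircle x N⁻¹)) atTop
      (𝓝 0) := by
  have hx : (0 : ℝ) < x := by exact_mod_cast hx
  obtain ⟨C, hC, h⟩ := exists_norm_eta_le_im_pow x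
  have hdist : Tendsto (fun N : ℝ => C * ‖((x : ℝ) : ℂ) + (N⁻¹ : ℝ) * Complex.I
      - semicircle x N⁻¹‖) atTop (𝓝 0) := by
    have h1 : Tendsto (semicircle x) (𝓝 0) (𝓝 (x : ℝ)) := by
      have := (hasDerivAt_semicircle x 0).continuousAt.tendsto
      simpa [semicircle] using this
    have h2 := (((tendsto_vertical_inv x).sub
      (h1.comp tendsto_inv_atTop_zero)).norm).const_mul C
    simpa using h2
  refine squeeze_zero_norm' ?_ hdist
  filter_upwards [eventually_ge_atTop (max (max 1 (x : ℝ)) ((x : ℝ) ^ 2))] with N hN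
  have hN1 : 1 ≤ N := (le_max_left _ _).trans ((le_max_left _ _).trans hN)
  have hN2 : (x : ℝ) ≤ N := (le_max_right _ _).trans ((le_max_left _ _).trans hN)
  have hN3 : (x : ℝ) ^ 2 ≤ N := (le_max_right _ _).trans hN
  have hN0 : 0 < N := by linarith
  have hs1 : N⁻¹ ≤ 1 := inv_le_one_of_one_le₀ hN1
  have hs2 : N⁻¹ * x ≤ 1 := by rw [inv_mul_le_iff₀ hN0]; linarith
  have hs3 : N⁻¹ * (x : ℝ) ^ 2 ≤ 1 := by rw [inv_mul_le_iff₀ hN0]; linarith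
  have hs0 : 0 < N⁻¹ := by positivity
  set s := N⁻¹
  refine norm_primitive_sub_le hΦ ((convex_cone x).inter (convex_halfSpace_im_le 1))
    (fun τ hτ => hτ.1.1) (fun τ hτ => ?_) ?_ ?_
  · obtain ⟨⟨h0, hc⟩, h1⟩ := hτ
    have h1 : τ.im ≤ 1 := h1
    have h2 : τ.im ≤ ‖τ - (x : ℝ)‖ := by
      refine le_trans (le_of_eq ?_) ((le_abs_self _).trans (Complex.abs_im_le_norm _))
      simp
    refine (norm_eichlerForm_le h0 h2).trans ?_
    have h3 : τ.im ^ 3 * τ.im ^ (-(3 / 2) : ℝ) ≤ 1 := by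
      rw [← Real.rpow_natCast, ← Real.rpow_add h0]
      exact Real.rpow_le_one h0.le h1 (by norm_num)
    calc _ ≤ C * τ.im ^ 3 * τ.im ^ (-(3 / 2) : ℝ) := by gcongr; exact h τ h0 h1 hc
      _ = C * (τ.im ^ 3 * τ.im ^ (-(3 / 2) : ℝ)) := by ring
      _ ≤ C := mul_le_of_le_one_right hC.le h3
  · have hD : (0 : ℝ) < 1 + (s * x) ^ 2 := by positivity
    refine ⟨⟨?_, ?_⟩, ?_⟩
    · rw [semicircle_im]
      positivity
    · rw [semicircle_re, semicircle_im, abs_le]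
      constructor
      · rw [div_sub' hD.ne', ← neg_div, div_le_div_iff_of_pos_right hD]
        nlinarith [mul_nonneg (mul_pos hs0 (pow_pos hx 2)).le (sub_nonneg.2 hs2)]
      · rw [div_sub' hD.ne', div_le_div_iff_of_pos_right hD]
        have : 0 < s * (x : ℝ) ^ 2 := by positivity
        have : 0 < (s * x) ^ 2 * (x : ℝ) := by positivity
        linarith
    · change (semicircle x s).im ≤ 1
      rw [semicircle_im, div_le_one hD]
      nlinarith [sq_nonneg (s * (x : ℝ))]
  · refine ⟨⟨?_, ?_⟩, ?_⟩
    · simpa using hs0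
    · simpa using hs0.le
    · simpa using hs1

/-- At the common end point `0` of the imaginary axis and the semicircle the differential is
bounded. -/
lemma tendsto_primitive_at_left {x : ℝ} (hx : 0 < x) {Φ : ℂ → ℂ}
    (hΦ : ∀ τ : ℂ, 0 < τ.im → HasDerivAt Φ (eichlerForm x τ) τ) :
    Tendsto (fun N : ℝ => Φ ((0 : ℝ) + (N⁻¹ : ℝ) * Complex.I) - Φ (semicircle x N)) atTop
      (𝓝 0) := by
  obtain ⟨C, hC, h⟩ := exists_norm_eta_le_of_cone 0
  have hdist : Tendsto (fun N : ℝ => C * (x / 2) ^ (-(3 / 2) : ℝ) *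
      ‖((0 : ℝ) : ℂ) + (N⁻¹ : ℝ) * Complex.I - semicircle x N‖) atTop (𝓝 0) := by
    have h1 : Tendsto (semicircle x) atTop (𝓝 ((0 : ℝ) : ℂ)) := by
      rw [Complex.ofReal_zero]
      refine squeeze_zero_norm' ?_ tendsto_inv_atTop_zero
      filter_upwards [eventually_gt_atTop 0] with N hN
      have h2 : N * x ≤ ‖(1 : ℂ) - Complex.I * N * x‖ := by
        refine le_trans (le_of_eq ?_) (Complex.abs_im_le_norm _)
        simp [abs_of_pos hN, abs_of_pos hx]
      rw [semicircle, norm_div, Complex.norm_real, Real.norm_of_nonneg hx.le]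
      calc x / _ ≤ x / (N * x) := by gcongr
        _ = _ := by field_simp
    have h2 := (((tendsto_vertical_inv 0).sub h1).norm).const_mul
      (C * (x / 2) ^ (-(3 / 2) : ℝ))
    simpa using h2
  refine squeeze_zero_norm' ?_ hdist
  filter_upwards [eventually_ge_atTop x⁻¹] with N hN
  have hN0 : 0 < N := (inv_pos.2 hx).trans_le hN
  have hN1 : 1 ≤ N * x := by rwa [← inv_le_iff_one_le_mul₀ hx]
  refine norm_primitive_sub_le hΦ ((convex_cone 0).inter (convex_halfSpace_re_le (x / 2)))
    (fun τ hτ => hτ.1.1) (fun τ hτ => ?_) ?_ ?_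
  · obtain ⟨⟨h0, hc⟩, h1⟩ := hτ
    have h1 : τ.re ≤ x / 2 := h1
    have h2 : x / 2 ≤ ‖τ - x‖ := by
      refine le_trans ?_ ((neg_le_abs _).trans (Complex.abs_re_le_norm _))
      simp
      linarith
    refine (norm_eichlerForm_le (by positivity) h2).trans ?_
    gcongr
    exact (h τ h0 (by simpa using hc)).1
  · have hD : (0 : ℝ) < 1 + (N * x) ^ 2 := by positivity
    refine ⟨⟨?_, ?_⟩, ?_⟩
    · rw [semicircle_im]
      positivity
    · rw [sub_zero, semicircle_re, semicircle_im, abs_of_pos (by positivity)]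
      gcongr
      nlinarith
    · change (semicircle x N).re ≤ x / 2
      rw [semicircle_re]
      gcongr
      nlinarith
  · have hs0 : 0 < N⁻¹ := by positivity
    refine ⟨⟨?_, ?_⟩, ?_⟩
    · simpa using hs0
    · simpa using hs0.le
    · change (((0 : ℝ) : ℂ) + (N⁻¹ : ℝ) * Complex.I).re ≤ x / 2
      have := half_pos hx
      simpa using this.le

/-- The horizontal side at height `N` of the truncated triangle contributes nothing in the limit. -/
lemma tendsto_primitive_at_top {x : ℝ} {Φ : ℂ → ℂ}
    (hΦ : ∀ τ : ℂ, 0 < τ.im → HasDerivAt Φ (eichlerForm x τ) τ) :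
    Tendsto (fun N : ℝ => Φ (x + N * Complex.I) - Φ ((0 : ℝ) + N * Complex.I)) atTop (𝓝 0) := by
  obtain ⟨C, hC, h⟩ := exists_norm_eta_le one_pos
  have hlim : Tendsto (fun N : ℝ => C * Real.exp (-(Real.pi / 12 * N)) * |x|) atTop (𝓝 0) := by
    have h1 : Tendsto (fun N : ℝ => Real.pi / 12 * N) atTop atTop :=
      tendsto_id.const_mul_atTop (by positivity)
    have h2 := ((Real.tendsto_exp_neg_atTop_nhds_zero.comp h1).const_mul C).mul_const |x|
    simpa using h2
  refine squeeze_zero_norm' ?_ hlim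
  filter_upwards [eventually_ge_atTop 1] with N hN
  have hN0 : 0 < N := by linarith
  have h1 := norm_primitive_sub_le hΦ (convex_halfSpace_im_ge N)
    (K := C * Real.exp (-(Real.pi / 12 * N))) (fun τ hτ => hN0.trans_le hτ) (fun τ hτ => ?_)
    (p := (0 : ℝ) + N * Complex.I) (q := x + N * Complex.I) (by simp) (by simp)
  · simpa using h1
  · have hτ : N ≤ τ.im := hτ
    have h2 : N ≤ ‖τ - x‖ := by
      refine hτ.trans (le_trans (le_of_eq ?_) ((le_abs_self _).trans (Complex.abs_im_le_norm _)))
      simp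
    refine (norm_eichlerForm_le hN0 h2).trans ?_
    calc _ ≤ ‖eta τ‖ * 1 := by
          gcongr
          exact Real.rpow_le_one_of_one_le_of_nonpos hN (by norm_num)
      _ ≤ C * Real.exp (-(Real.pi / 12 * τ.im)) := by
          rw [mul_one]
          exact h τ (hN.trans hτ)
      _ ≤ _ := by gcongr

lemma integrableOn_eta_imaginary_axis :
    IntegrableOn (fun v : ℝ => eta ((0 : ℝ) + v * Complex.I)) (Set.Ioi 0) := by
  obtain ⟨C, hC, h, -⟩ := exists_norm_eta_vertical_le 0
  obtain ⟨D, -, h'⟩ := exists_norm_eta_le one_pos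
  have hc := continuousOn_eta_vertical 0
  rw [← Set.Ioc_union_Ioi_eq_Ioi zero_le_one]
  refine IntegrableOn.union ?_ ?_
  · refine Integrable.mono' (g := fun _ => C) (by simp)
      ((hc.mono Set.Ioc_subset_Ioi_self).aestronglyMeasurable measurableSet_Ioc) ?_
    filter_upwards [ae_restrict_mem measurableSet_Ioc] with v hv
    have h1 := h v hv.1
    rw [Rat.cast_zero] at h1
    exact h1.trans (mul_le_of_le_one_right hC.le (min_le_left _ _))
  · refine Integrable.mono' ((exp_neg_integrableOn_Ioi 1
      (show 0 < Real.pi / 12 by positivity)).const_mul D)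
      ((hc.mono (Set.Ioi_subset_Ioi zero_le_one)).aestronglyMeasurable measurableSet_Ioi) ?_
    filter_upwards [ae_restrict_mem measurableSet_Ioi] with v hv
    have hv : 1 < v := hv
    have h1 := h' ((0 : ℝ) + v * Complex.I) (by simpa using hv.le)
    simpa using h1

/-- The period integral `∫_0^∞ η(iv) (v + iz)^{-3/2} dv` of `η` along the imaginary axis. -/
noncomputable def periodIntegral (z : ℂ) : ℂ :=
  ∫ v in Set.Ioi (0 : ℝ), eta ((0 : ℝ) + v * Complex.I) * eichlerKernel (v + Complex.I * z)

lemma re_le_norm_add_I_mul (v : ℝ) (z : ℂ) : z.re ≤ ‖(v : ℂ) + Complex.I * z‖ := by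
  refine le_trans (le_of_eq ?_) ((le_abs_self _).trans (Complex.abs_im_le_norm _))
  simp

lemma add_I_mul_mem_slitPlane (v : ℝ) {z : ℂ} (hz : 0 < z.re) :
    (v : ℂ) + Complex.I * z ∈ Complex.slitPlane := by
  refine Or.inr ?_
  simpa using hz.ne'

lemma continuousOn_periodIntegrand {k : ℂ → ℂ} {z : ℂ} (hz : 0 < z.re)
    (hk : ∀ w ∈ Complex.slitPlane, ContinuousAt k w) : ContinuousOn
      (fun v : ℝ => eta ((0 : ℝ) + v * Complex.I) * k (v + Complex.I * z)) (Set.Ioi 0) := by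
  refine (continuousOn_eta_vertical 0).mul (Continuous.continuousOn ?_)
  exact continuous_iff_continuousAt.2 fun v => ContinuousAt.comp
    (f := fun v : ℝ => (v : ℂ) + Complex.I * z) (hk _ (add_I_mul_mem_slitPlane v hz)) (by fun_prop)

lemma integrableOn_periodIntegral {z : ℂ} (hz : 0 < z.re) : IntegrableOn
    (fun v : ℝ => eta ((0 : ℝ) + v * Complex.I) * eichlerKernel (v + Complex.I * z))
      (Set.Ioi 0) := by
  refine Integrable.mono' (integrableOn_eta_imaginary_axis.norm.mul_const (z.re ^ (-(3 / 2) : ℝ)))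
    ((continuousOn_periodIntegrand hz fun w hw =>
      (Complex.hasStrictDerivAt_cpow_const hw).hasDerivAt.continuousAt).aestronglyMeasurable
        measurableSet_Ioi) (Eventually.of_forall fun v => ?_)
  rw [norm_mul]
  gcongr
  exact norm_eichlerKernel_le hz (re_le_norm_add_I_mul v z)

/-- The failure of the Eichler integral to be invariant under inversion is the period integral:
integrate the differential `eichlerForm x` over the ideal triangle with vertices `0`, `x`, `∞`. -/
theorem eichlerIntegral_sub_inversion {x : ℚ} (hx : 0 < x) :
    eichlerIntegral x - Complex.I ^ (1 / 2 : ℂ) * (((x : ℝ) ^ (-(3 / 2) : ℝ) : ℝ) : ℂ)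
      * eichlerIntegral (-1 / x : ℝ) = periodIntegral (x : ℝ) := by
  have hx' : (0 : ℝ) < x := by exact_mod_cast hx
  obtain ⟨Φ, hΦ⟩ := exists_primitive_eichlerForm x
  have hline : ∀ a u : ℝ, 0 < u → HasDerivAt (fun u : ℝ => Φ (a + u * Complex.I))
      (Complex.I * eichlerForm x (a + u * Complex.I)) u := by
    intro a u hu
    have h1 : HasDerivAt (fun v : ℝ => (a : ℂ) + v * Complex.I) Complex.I u := by
      have := ((Complex.ofRealCLM.hasDerivAt (x := u)).mul_const Complex.I).const_add (a : ℂ)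
      simpa using this
    rw [mul_comm]
    exact (hΦ _ (by simpa using hu)).comp u h1
  -- The three sides of the ideal triangle: the vertical lines over `x` and over `0`, and the
  -- semicircle.
  have hA := tendsto_sub_of_hasDerivAt_Ioi
    (f' := fun u : ℝ => Complex.I * (u ^ (-(3 / 2) : ℝ) • eta ((x : ℝ) + u * Complex.I)))
    (fun u hu => by rw [← eichlerForm_vertical x hu]; exact hline x u hu)
    ((integrableOn_eichlerIntegral x).const_mul _)
  have hB := tendsto_sub_of_hasDerivAt_Ioi
    (f' := fun v : ℝ => Complex.I * (eta ((0 : ℝ) + v * Complex.I)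
      * eichlerKernel (v + Complex.I * ((x : ℝ) : ℂ))))
    (fun v hv => by
      have := hline 0 v hv
      rwa [eichlerForm, show -Complex.I * (((0 : ℝ) : ℂ) + v * Complex.I - (x : ℝ))
        = v + Complex.I * ((x : ℝ) : ℂ) by
          rw [Complex.ofReal_zero]; linear_combination -(v : ℂ) * Complex.I_mul_I] at this)
    ((integrableOn_periodIntegral (z := (x : ℝ)) (by simpa using hx')).const_mul _)
  have hC := tendsto_sub_of_hasDerivAt_Ioi (f := fun s => Φ (semicircle x s))
    (f' := fun s : ℝ => Complex.I * (Complex.I ^ (1 / 2 : ℂ)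
      * (((x : ℝ) ^ (-(3 / 2) : ℝ) : ℝ) : ℂ)) *
        (s ^ (-(3 / 2) : ℝ) • eta ((-1 / x : ℝ) + s * Complex.I)))
    (fun s hs => by
      rw [← eichlerForm_semicircle hx' hs]
      refine (hΦ _ ?_).comp s (hasDerivAt_semicircle x s)
      rw [semicircle_im]
      positivity)
    (by
      have := (integrableOn_eichlerIntegral (-1 / x)).const_mul
        (Complex.I * (Complex.I ^ (1 / 2 : ℂ) * (((x : ℝ) ^ (-(3 / 2) : ℝ) : ℝ) : ℂ)))
      rwa [show ((-1 / x : ℚ) : ℝ) = -1 / (x : ℝ) by push_cast; ring] at this)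
  rw [integral_const_mul] at hA hB hC
  -- The six end points pair off at the three cusps.
  have hsum := ((hA.sub hB).sub hC).add ((tendsto_primitive_at_right hx hΦ).sub
    ((tendsto_primitive_at_left hx' hΦ).add (tendsto_primitive_at_top hΦ)))
  have h0 := tendsto_nhds_unique hsum ((tendsto_const_nhds (x := (0 : ℂ))).congr fun N => by ring)
  refine mul_left_cancel₀ Complex.I_ne_zero ?_
  rw [periodIntegral, eichlerIntegral, eichlerIntegral]
  linear_combination h0

lemma differentiableAt_periodIntegral {z : ℂ} (hz : 0 < z.re) :
    DifferentiableAt ℂ periodIntegral z := by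
  set c : ℂ := ((-(3 / 2) : ℝ) : ℂ) with hc
  have hs : {w : ℂ | z.re / 2 < w.re} ∈ 𝓝 z :=
    (isOpen_lt continuous_const Complex.continuous_re).mem_nhds (half_lt_self hz)
  have hcont : ∀ e : ℂ, ∀ w ∈ Complex.slitPlane, ContinuousAt (fun w : ℂ => w ^ e) w :=
    fun e w hw => (Complex.hasStrictDerivAt_cpow_const hw).hasDerivAt.continuousAt
  refine (hasDerivAt_integral_of_dominated_loc_of_deriv_le (μ := volume.restrict (Set.Ioi 0))
    (F := fun w (v : ℝ) => eta ((0 : ℝ) + v * Complex.I) * eichlerKernel (v + Complex.I * w))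
    (F' := fun w (v : ℝ) => eta ((0 : ℝ) + v * Complex.I)
      * (c * (v + Complex.I * w) ^ (c - 1) * Complex.I))
    (bound := fun v : ℝ => ‖eta ((0 : ℝ) + v * Complex.I)‖
      * (3 / 2 * (z.re / 2) ^ (-(5 / 2) : ℝ))) hs ?_ (integrableOn_periodIntegral hz) ?_ ?_
    (integrableOn_eta_imaginary_axis.norm.mul_const _) ?_).2.differentiableAt
  · filter_upwards [hs] with w hw
    have hw : z.re / 2 < w.re := hw
    exact (continuousOn_periodIntegrand (by linarith)
      (hcont _)).aestronglyMeasurable measurableSet_Ioi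
  · exact (continuousOn_periodIntegrand (k := fun w => c * w ^ (c - 1) * Complex.I) hz fun w hw =>
      (continuousAt_const.mul (hcont _ w hw)).mul continuousAt_const).aestronglyMeasurable
        measurableSet_Ioi
  · refine Eventually.of_forall fun v w hw => ?_
    have hw : z.re / 2 < w.re := hw
    rw [norm_mul, norm_mul, norm_mul, Complex.norm_I, mul_one]
    gcongr
    · rw [hc, Complex.norm_real]
      norm_num
    · rw [show c - 1 = ((-(5 / 2) : ℝ) : ℂ) by rw [hc]; push_cast; norm_num, Complex.norm_cpow_real]
      exact Real.rpow_le_rpow_of_nonpos (by positivity)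
        (hw.le.trans (re_le_norm_add_I_mul v w)) (by norm_num)
  · refine Eventually.of_forall fun v w hw => ?_
    have hw : z.re / 2 < w.re := hw
    have h1 : HasDerivAt (fun w : ℂ => (v : ℂ) + Complex.I * w) Complex.I w := by
      simpa using ((hasDerivAt_id w).const_mul Complex.I).const_add (v : ℂ)
    exact (h1.cpow_const (add_I_mul_mem_slitPlane v (by linarith))).const_mul _

lemma analyticAt_periodIntegral {x : ℝ} (hx : 0 < x) :
    AnalyticAt ℝ (fun x : ℝ => periodIntegral x) x := by
  have h1 : AnalyticAt ℂ periodIntegral x :=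
    DifferentiableOn.analyticAt (s := {z : ℂ | 0 < z.re})
      (fun z hz => (differentiableAt_periodIntegral hz).differentiableWithinAt)
      ((isOpen_lt continuous_const Complex.continuous_re).mem_nhds (by simpa using hx))
  exact (h1.restrictScalars (𝕜 := ℝ)).comp (Complex.ofRealCLM.analyticAt x)

variable {χ : SL(2, ℤ) → ℂ}

lemma hasAnalyticObstruction_S_iff (hχ : IsEtaMultiplier χ) {f : ℚ → ℂ} :
    HasAnalyticObstruction χ f ModularGroup.S ↔ ∃ g : ℝ → ℂ, AnalyticOnNhd ℝ g (Set.Ioi 0) ∧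
      ∀ x : ℚ, 0 < x → f x - Complex.I ^ (1 / 2 : ℂ) * (((x : ℝ) ^ (-(3 / 2 : ℝ)) : ℝ) : ℂ)
        * f (-1 / x) = g x := by
  obtain ⟨h1, h2, h3, h4⟩ := S_mul_apply 1
  rw [mul_one] at h1 h2 h3 h4
  rw [HasAnalyticObstruction, h1, h2, h3, h4, hχ.S_inv]
  simp only [Matrix.SpecialLinearGroup.coe_one, Matrix.one_apply_eq, ne_eq, Fin.isValue,
    zero_ne_one, not_false_eq_true, Matrix.one_apply_ne, one_ne_zero, neg_zero, Int.cast_one,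
    Int.cast_zero, Int.cast_neg, one_mul, add_zero, zero_mul, zero_add]
  rfl

lemma hasAnalyticObstruction_eichlerValue (hχ : IsEtaMultiplier χ) :
    HasAnalyticObstruction χ eichlerValue ModularGroup.S := by
  refine (hasAnalyticObstruction_S_iff hχ).2
    ⟨fun x => periodIntegral x / (2 * eichlerConst), fun x hx => ?_, fun x hx => ?_⟩
  · exact (analyticAt_periodIntegral hx).fun_div analyticAt_const
      (mul_ne_zero two_ne_zero (by exact_mod_cast eichlerConst_pos.ne'))
  · beta_reduce
    rw [← eichlerIntegral_sub_inversion hx, eichlerValue, eichlerValue,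
      show ((-1 / x : ℚ) : ℝ) = -1 / (x : ℝ) by push_cast; ring]
    ring

lemma eichlerValue_add_one (x : ℚ) :
    eichlerValue (x + 1) = expTwoPiI (1 / 24) * eichlerValue x := by
  rw [eichlerValue, eichlerValue, Rat.cast_add, Rat.cast_one, eichlerIntegral_add_one,
    mul_div_assoc]

lemma isQuantumModularForm_eichlerValue (hχ : IsEtaMultiplier χ) :
    IsQuantumModularForm (3 / 2) χ ⊤ Set.univ eichlerValue :=
  isQuantumModularForm_of_S hχ eichlerValue_add_one (hasAnalyticObstruction_eichlerValue hχ)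

lemma analyticAt_expTwoPiI {u : ℝ → ℝ} {x : ℝ} (hu : AnalyticAt ℝ u x) :
    AnalyticAt ℝ (fun x => expTwoPiI (u x)) x := by
  have h : AnalyticAt ℂ expTwoPiI (u x) := (analyticAt_const.mul analyticAt_id).cexp'
  have hv : AnalyticAt ℝ (fun x => (u x : ℂ)) x := (Complex.ofRealCLM.analyticAt _).comp hu
  exact AnalyticAt.comp (g := expTwoPiI) (f := fun x => (u x : ℂ)) (h.restrictScalars (𝕜 := ℝ)) hv

/-- The correction `e(x / 24)` is analytic on its own, and so is its image under inversion away from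
the pole `0`. -/
lemma isQuantumModularForm_eichlerValue_sub (hχ : IsEtaMultiplier χ) :
    IsQuantumModularForm (3 / 2) χ ⊤ Set.univ
      fun x => eichlerValue x - expTwoPiI (x / 24) := by
  refine isQuantumModularForm_of_S hχ (fun x => ?_) ?_
  · rw [eichlerValue_add_one, mul_sub, expTwoPiI, expTwoPiI, expTwoPiI, ← Complex.exp_add]
    congr 2
    push_cast
    ring
  · obtain ⟨g, hg, h⟩ :=
      (hasAnalyticObstruction_S_iff hχ).1 (hasAnalyticObstruction_eichlerValue hχ)
    refine (hasAnalyticObstruction_S_iff hχ).2 ⟨fun x => g x - (expTwoPiI ((x / 24 : ℝ) : ℂ)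
      - Complex.I ^ (1 / 2 : ℂ) * ((x ^ (-(3 / 2 : ℝ)) : ℝ) : ℂ)
        * expTwoPiI ((-1 / x / 24 : ℝ) : ℂ)), fun x hx => ?_, fun x hx => ?_⟩
    · have hx : 0 < x := hx
      have h1 : AnalyticAt ℝ (fun x : ℝ => -1 / x / 24) x :=
        (analyticAt_const.fun_div analyticAt_id hx.ne').fun_div analyticAt_const (by norm_num)
      have h2 : AnalyticAt ℝ (fun x : ℝ => x / 24) x :=
        analyticAt_id.fun_div analyticAt_const (by norm_num)
      exact (hg x hx).sub ((analyticAt_expTwoPiI h2).sub ((analyticAt_const.mul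
        (analyticAt_ofReal_rpow analyticAt_id hx _)).mul (analyticAt_expTwoPiI h1)))
    · beta_reduce
      rw [← h x hx]
      push_cast
      ring

end EichlerInversion

theorem proposition3p1 :
    ((fun t : ℝ => qPochInf (Real.exp (-t)) * HA 2 (Real.exp (-t)) - ((1 / t : ℝ) : ℂ))
        =O[𝓝[>] 0] fun _ => (1 : ℝ)) ∧
    ((fun t : ℝ => qPochInf (Real.exp (-t)) ^ 2 * HA 3 (Real.exp (-t)) - 1)
        =O[𝓝[>] 0] fun t => t) ∧
    ((fun t : ℝ => qPochInf (Real.exp (-t)) ^ 2 * HA 4 (Real.exp (-t))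
          - (((Real.eulerMascheroniConstant - Real.log t) / t - Real.log t : ℝ) : ℂ))
        =O[𝓝[>] 0] fun _ => (1 : ℝ)) ∧
    ((fun t : ℝ => qPochInf (Real.exp (-t)) ^ 3 * HA 5 (Real.exp (-t)) - 1)
        =O[𝓝[>] 0] fun t => t) ∧
    ((fun t : ℝ => qPochInf (Real.exp (-t)) ^ 3 * HA 6 (Real.exp (-t))
          - ((2 * (Real.eulerMascheroniConstant - Real.log t) / t - 2 * Real.log t : ℝ) : ℂ))
        =O[𝓝[>] 0] fun _ => (1 : ℝ)) ∧
    ((fun t : ℝ => qPochInf (Real.exp (-t)) ^ 4 * HA 7 (Real.exp (-t)) - 1)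
        =O[𝓝[>] 0] fun t => t) ∧
    ((fun t : ℝ => qPochInf (Real.exp (-t)) ^ 4 * HA 8 (Real.exp (-t))
          - ((3 * (Real.eulerMascheroniConstant - Real.log t) / t - 6 * Real.log t : ℝ) : ℂ))
        =O[𝓝[>] 0] fun _ => (1 : ℝ)) ∧
    IsHolomorphicQuantumModularForm 1 (fun _ => 1) ⊤
      (fun τ : ℍ => expTwoPiI τ * qPochInf (expTwoPiI τ) ^ 2 * HA 4 (expTwoPiI τ)) ∧
    (∃ χ : SL(2, ℤ) → ℂ, IsEtaMultiplier χ ∧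
      (∃ f : ℚ → ℂ,
        IsBoundaryValue
          (fun τ : ℂ => expTwoPiI (τ / 24) *
            (expTwoPiI τ * qPochInf (expTwoPiI τ) ^ 3 * HA 5 (expTwoPiI τ))) f ∧
        IsQuantumModularForm (3 / 2) χ ⊤ Set.univ f) ∧
      (∃ f : ℚ → ℂ,
        IsBoundaryValue
          (fun τ : ℂ => expTwoPiI (τ / 24) *
            (expTwoPiI τ * (1 - expTwoPiI τ) * qPochInf (expTwoPiI τ) ^ 4 *
              HA 7 (expTwoPiI τ))) f ∧
        IsQuantumModularForm (3 / 2) χ ⊤ Set.univ f)) := by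
  obtain ⟨χ, hχ⟩ := exists_isEtaMultiplier
  exact ⟨HA_two_isBigO, HA_three_isBigO, HA_four_isBigO, HA_five_isBigO, HA_six_isBigO,
    HA_seven_isBigO, HA_eight_isBigO, isHolomorphicQuantumModularForm_HA_four, χ, hχ,
    ⟨_, isBoundaryValue_HA_five, isQuantumModularForm_eichlerValue hχ⟩,
    ⟨_, isBoundaryValue_HA_seven, isQuantumModularForm_eichlerValue_sub hχ⟩⟩
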